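/- Let $K$ be a commutative ring and let $\mathcal C$ be a small dg-category over $K$. Write $\mathcal C(X,Y)=\bigoplus_{n}\mathcal C(X,Y)^n$ for its morphism complexes, and regard $\mathcal C$ as a $K$-category with all, not necessarily homogeneous, elements of $\mathcal C(X,Y)$ as morphisms. Assume that $\mathcal C$ has finite coproducts. Let $\mathcal B$ be a full dg-subcategory of $\mathcal C$ closed under finite coproducts (including the empty one). Let $\mathcal I_{\mathcal B}(X,Y)^n$ be the set of those $f\in\mathcal C(X,Y)^n$ that can be written $f=h\circ g$ with $g\in\mathcal C(X,B)$, $h\in\mathcal C(B,Y)$ for some $B\in\mathcal B$; then $\mathcal I_{\mathcal B}=\bigoplus_n\mathcal I_{\mathcal B}^n$ is a dg-ideal. Let $\mathcal C/\mathcal I_{\mathcal B}$ be the quotient dg-category (same objects, morphism complexes $\mathcal C(X,Y)/\mathcal I_{\mathcal B}(X,Y)$), $\pi:\mathcal C\to\mathcal C/\mathcal I_{\mathcal B}$ the projection and $j:\mathcal B\to\mathcal C$ the inclusion. For a small dg-category $\mathcal A$ let $\mathrm{DgMod}(\mathcal A)$ be the dg-category of dg-functors $\mathcal A\to\mathrm{DgMod}(K)$,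 with dg-natural transformations as morphisms, and let $Z^0(\mathrm{DgMod}(\mathcal A))$ be its underlying category, with the same objects and with the closed morphisms of degree $0$ as morphisms. For a dg-functor $F$ between such dg-categories of modules, let $F_0$ be the induced functor between underlying categories. Let $\pi_*$ and $j^*$ be the dg-functors given by precomposition with $\pi$ and $j$. Then the dg-functors of left and right Kan extension $$\pi^*=\mathbb L\mathrm{an}_\pi,\ \pi^!=\mathbb R\mathrm{an}_\pi:\mathrm{DgMod}(\mathcal C)\to\mathrm{DgMod}(\mathcal C/\mathcal I_{\mathcal B}),\qquad j_!=\mathbb L\mathrm{an}_j,\ j_*=\mathbb R\mathrm{an}_j:\mathrm{DgMod}(\mathcal B)\to\mathrm{DgMod}(\mathcal C)$$ exist (Kan extensions in the pointwise, dg-enriched sense), and $$Z^0(\mathrm{DgMod}(\mathcal C/\mathcal I_{\mathcal B}))\xrightarrow{(\pi_*)_0}Z^0(\mathrm{DgMod}(\mathcal C))\xrightarrow{(j^*)_0}Z^0(\mathrm{DgMod}(\mathcal B)),$$ together with $(\pi^*)_0,(\pi^!)_0,(j_!)_0,(j_*)_0$, is a recollement of abelian categories. That is: the three categories are abelian and the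 six functors are additive; $((\pi^*)_0,(\pi_*)_0)$, $((\pi_*)_0,(\pi^!)_0)$, $((j_!)_0,(j^*)_0)$ and $((j^*)_0,(j_*)_0)$ are adjoint pairs; an object $M$ of $Z^0(\mathrm{DgMod}(\mathcal C))$ satisfies $(j^*)_0M\cong 0$ if and only if it is isomorphic to an object in the image of $(\pi_*)_0$; and $(\pi_*)_0$, $(j_!)_0$ and $(j_*)_0$ are full and faithful. -/

import Mathlib

open CategoryTheory CategoryTheory.Limits CochainComplex.HomComplex
open scoped DirectSum

universe u v w v' w' v'' w''

/-! ### Differential graded categories -/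

/-- A differential graded category over `K`. The dg `K`-module of morphisms from `X` to `Y` is
given by its homogeneous components `Hom X Y n`, its differential by
`d n m _ : Hom X Y n → Hom X Y m` for `n + 1 = m`. Composition is written in diagrammatic order:
`comp h f g` is "`g ∘ f`" for `f` of degree `p`, `g` of degree `q`, and `h : p + q = n`.
The axiom `d_comp` is `d (g ∘ f) = d g ∘ f + (-1)^|g| g ∘ d f`. -/
class DGCategory (K : Type u) [CommRing K] (C : Type w) where
  Hom : C → C → ℤ → Type v
  [addCommGroup : ∀ X Y n, AddCommGroup (Hom X Y n)]
  [module : ∀ X Y n, Module K (Hom X Y n)]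
  d {X Y : C} (n m : ℤ) (h : n + 1 = m) : Hom X Y n →ₗ[K] Hom X Y m
  comp {X Y Z : C} {p q n : ℤ} (h : p + q = n) : Hom X Y p →ₗ[K] Hom Y Z q →ₗ[K] Hom X Z n
  id (X : C) : Hom X X 0
  d_d {X Y : C} (n m l : ℤ) (h : n + 1 = m) (h' : m + 1 = l) (f : Hom X Y n) :
    d m l h' (d n m h f) = 0
  d_comp {X Y Z : C} {p q n : ℤ} (h : p + q = n) (p' q' n' : ℤ) (hp : p + 1 = p')
    (hq : q + 1 = q') (hn : n + 1 = n') (f : Hom X Y p) (g : Hom Y Z q) :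
    d n n' hn (comp h f g) =
      comp (show p + q' = n' by lia) f (d q q' hq g) +
        q.negOnePow • comp (show p' + q = n' by lia) (d p p' hp f) g
  id_comp {X Y : C} {n : ℤ} (f : Hom X Y n) : comp (zero_add n) (id X) f = f
  comp_id {X Y : C} {n : ℤ} (f : Hom X Y n) : comp (add_zero n) f (id Y) = f
  assoc {X Y Z W : C} {p q r pq qr n : ℤ} (hpq : p + q = pq) (hqr : q + r = qr)
    (hn : p + q + r = n) (f : Hom X Y p) (g : Hom Y Z q) (k : Hom Z W r) :
    comp (show pq + r = n by lia) (comp hpq f g) k =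
      comp (show p + qr = n by lia) f (comp hqr g k)

attribute [reducible, instance] DGCategory.addCommGroup DGCategory.module

namespace DGCategory

theorem d_id (K : Type u) [CommRing K] {C : Type w} [DGCategory.{u, v} K C] (X : C) :
    d (K := K) 0 1 (zero_add 1) (DGCategory.id (K := K) X) = 0 := by
  have h := d_comp (K := K) (zero_add 0) 1 1 1 (zero_add 1) (zero_add 1) (zero_add 1)
    (DGCategory.id (K := K) X) (DGCategory.id (K := K) X)
  rw [id_comp, id_comp, comp_id, Int.negOnePow_zero, one_smul] at h
  simpa using h

theorem units_smul_eq {K : Type u} [CommRing K] {M : Type v} [AddCommGroup M] [Module K M]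
    (a : ℤˣ) (x : M) : a • x = (((a : ℤ) : K)) • x := by
  rw [Units.smul_def, Int.cast_smul_eq_zsmul]

theorem map_units_smul {K : Type u} [CommRing K] {M : Type v} [AddCommGroup M] [Module K M]
    {N : Type v'} [AddCommGroup N] [Module K N] (f : M →ₗ[K] N) (a : ℤˣ) (x : M) :
    f (a • x) = a • f x := by
  rw [units_smul_eq (K := K), units_smul_eq (K := K), map_smul]

theorem units_smul_map {K : Type u} [CommRing K] {M : Type v} [AddCommGroup M] [Module K M]
    {N : Type v'} [AddCommGroup N] [Module K N] {L : Type v''} [AddCommGroup L] [Module K L]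
    (f : M →ₗ[K] N →ₗ[K] L) (a : ℤˣ) (x : M) (y : N) :
    f (a • x) y = a • f x y :=
  map_units_smul (f.flip y) a x

end DGCategory

open DGCategory

/-! ### The underlying category -/

/-- The underlying category `A₀` of a dg-category `A` (also written `Z⁰(A)`): the same objects,
and as morphisms the closed morphisms of degree zero. -/
structure Z0 (K : Type u) [CommRing K] (A : Type w) where
  of ::
  obj : A

namespace Z0

variable {K : Type u} [CommRing K] {A : Type w} [DGCategory.{u, v} K A]

/-- The closed morphisms of degree zero from `X` to `Y`. -/
def closed (X Y : A) : Submodule K (DGCategory.Hom K X Y 0) :=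
  LinearMap.ker (d 0 1 (zero_add 1))

instance : Category.{v} (Z0 K A) where
  Hom X Y := closed (K := K) X.obj Y.obj
  id X := ⟨DGCategory.id X.obj, d_id K X.obj⟩
  comp f g := ⟨comp (zero_add 0) f.1 g.1, by
    have hf : d 0 1 (zero_add 1) f.1 = 0 := f.2
    have hg : d 0 1 (zero_add 1) g.1 = 0 := g.2
    change d 0 1 (zero_add 1) (comp (zero_add 0) f.1 g.1) = 0
    rw [d_comp (zero_add 0) 1 1 1 (zero_add 1) (zero_add 1) (zero_add 1), hf, hg]
    simp⟩
  id_comp f := Subtype.ext (DGCategory.id_comp f.1)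
  comp_id f := Subtype.ext (DGCategory.comp_id f.1)
  assoc f g h := Subtype.ext
    (DGCategory.assoc (zero_add 0) (zero_add 0) (by lia) f.1 g.1 h.1)

instance (X Y : Z0 K A) : AddCommGroup (X ⟶ Y) :=
  inferInstanceAs (AddCommGroup (closed (K := K) X.obj Y.obj))

instance : Preadditive (Z0 K A) where
  add_comp _ _ _ f f' g := Subtype.ext
    (LinearMap.congr_fun (map_add (comp (zero_add 0)) f.1 f'.1) g.1)
  comp_add _ _ _ f g g' := Subtype.ext (map_add (comp (zero_add 0) f.1) g.1 g'.1)

end Z0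

/-! ### The total category -/

/-- A dg-category `C` regarded as a plain (ungraded) category: the morphisms from `X` to `Y` are
all the elements of `⨁ n, Hom X Y n`, homogeneous or not. -/
structure TotalCat (K : Type u) [CommRing K] (C : Type w) where
  of ::
  obj : C

namespace TotalCat

variable {K : Type u} [CommRing K] {C : Type w} [DGCategory.{u, v} K C]

/-- The composition `⨁ p, Hom X Y p → ⨁ q, Hom Y Z q → ⨁ n, Hom X Z n`, the bilinear extension
of the composition of homogeneous morphisms. -/
noncomputable def compHom (X Y Z : C) :
    (⨁ p, DGCategory.Hom K X Y p) →ₗ[K] (⨁ q, DGCategory.Hom K Y Z q) →ₗ[K]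
      (⨁ n, DGCategory.Hom K X Z n) :=
  DirectSum.toModule K ℤ _ fun p =>
    (DirectSum.toModule K ℤ _ fun q =>
      ((comp (K := K) (X := X) (Y := Y) (Z := Z) (rfl : p + q = p + q)).compr₂
        (DirectSum.lof K ℤ (fun n => DGCategory.Hom K X Z n) (p + q))).flip).flip

theorem lof_eq {X Y Z : C} {p q n : ℤ} (h : p + q = n) (f : DGCategory.Hom K X Y p)
    (g : DGCategory.Hom K Y Z q) :
    DirectSum.lof K ℤ (fun n => DGCategory.Hom K X Z n) (p + q) (comp rfl f g) =
      DirectSum.lof K ℤ (fun n => DGCategory.Hom K X Z n) n (comp h f g) := by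
  subst h; rfl

theorem compHom_lof {X Y Z : C} {p q n : ℤ} (h : p + q = n) (f : DGCategory.Hom K X Y p)
    (g : DGCategory.Hom K Y Z q) :
    compHom X Y Z (DirectSum.lof K ℤ _ p f) (DirectSum.lof K ℤ _ q g) =
      DirectSum.lof K ℤ _ n (comp h f g) := by
  rw [← lof_eq h]
  simp [compHom]

theorem compHom_add_left {X Y Z : C} (f f' : ⨁ n, DGCategory.Hom K X Y n)
    (g : ⨁ n, DGCategory.Hom K Y Z n) :
    compHom X Y Z (f + f') g = compHom X Y Z f g + compHom X Y Z f' g := by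
  rw [map_add, LinearMap.add_apply]

theorem compHom_add_right {X Y Z : C} (f : ⨁ n, DGCategory.Hom K X Y n)
    (g g' : ⨁ n, DGCategory.Hom K Y Z n) :
    compHom X Y Z f (g + g') = compHom X Y Z f g + compHom X Y Z f g' :=
  map_add _ _ _

noncomputable instance : Category.{v} (TotalCat K C) where
  Hom X Y := ⨁ n, DGCategory.Hom K X.obj Y.obj n
  id X := DirectSum.lof K ℤ _ 0 (DGCategory.id X.obj)
  comp f g := compHom _ _ _ f g
  id_comp {X Y} f := by
    have : compHom (K := K) X.obj X.obj Y.obj (DirectSum.lof K ℤ _ 0 (DGCategory.id X.obj)) =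
        LinearMap.id := by
      refine DirectSum.linearMap_ext _ fun n => LinearMap.ext fun f => ?_
      rw [LinearMap.comp_apply, compHom_lof (zero_add n), DGCategory.id_comp]; rfl
    exact LinearMap.congr_fun this f
  comp_id {X Y} f := by
    have : (compHom (K := K) X.obj Y.obj Y.obj).flip (DirectSum.lof K ℤ _ 0 (DGCategory.id Y.obj)) =
        LinearMap.id := by
      refine DirectSum.linearMap_ext _ fun n => LinearMap.ext fun f => ?_
      rw [LinearMap.comp_apply, LinearMap.flip_apply, compHom_lof (add_zero n),
        DGCategory.comp_id]; rfl
    exact LinearMap.congr_fun this f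
  assoc {X Y Z W} f g k := by
    induction f using DirectSum.induction_on with
    | zero => simp
    | add f f' hf hf' => simp only [map_add, LinearMap.add_apply, hf, hf']
    | of p f =>
      induction g using DirectSum.induction_on with
      | zero => simp
      | add g g' hg hg' => simp only [map_add, LinearMap.add_apply, hg, hg']
      | of q g =>
        induction k using DirectSum.induction_on with
        | zero => simp
        | add k k' hk hk' => simp only [map_add, hk, hk']
        | of r k =>
          simp only [← DirectSum.lof_eq_of K]
          rw [compHom_lof rfl f g, compHom_lof (n := p + q + r) rfl _ k, compHom_lof rfl g k,
            compHom_lof (n := p + q + r) (by lia) f _, DGCategory.assoc rfl rfl rfl]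

noncomputable instance : Preadditive (TotalCat K C) where
  homGroup X Y := (inferInstance : AddCommGroup (⨁ n, DGCategory.Hom K X.obj Y.obj n))
  add_comp X Y Z := by
    intro (f : ⨁ n, DGCategory.Hom K X.obj Y.obj n) (f' : ⨁ n, DGCategory.Hom K X.obj Y.obj n)
      (g : ⨁ n, DGCategory.Hom K Y.obj Z.obj n)
    exact compHom_add_left f f' g
  comp_add X Y Z := by
    intro (f : ⨁ n, DGCategory.Hom K X.obj Y.obj n) (g : ⨁ n, DGCategory.Hom K Y.obj Z.obj n)
      (g' : ⨁ n, DGCategory.Hom K Y.obj Z.obj n)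
    exact compHom_add_right f g g'

/-- A homogeneous morphism of degree `n`, regarded as a morphism of the total category. -/
noncomputable def homogeneous {X Y : C} {n : ℤ} (f : DGCategory.Hom K X Y n) :
    (of X : TotalCat K C) ⟶ of Y :=
  DirectSum.lof K ℤ (fun n => DGCategory.Hom K X Y n) n f

end TotalCat

/-! ### dg-functors and dg-natural transformations -/

/-- A dg-functor: a `K`-linear functor that preserves degrees and commutes with differentials. -/
structure DGFunctor (K : Type u) [CommRing K] (A : Type w) [DGCategory.{u, v} K A]
    (B : Type w') [DGCategory.{u, v'} K B] where
  obj : A → B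
  map {X Y : A} {n : ℤ} : DGCategory.Hom K X Y n →ₗ[K] DGCategory.Hom K (obj X) (obj Y) n
  map_id (X : A) : map (DGCategory.id (K := K) X) = DGCategory.id (obj X)
  map_comp {X Y Z : A} {p q n : ℤ} (h : p + q = n) (f : DGCategory.Hom K X Y p)
    (g : DGCategory.Hom K Y Z q) : map (comp h f g) = comp h (map f) (map g)
  map_d {X Y : A} (n m : ℤ) (h : n + 1 = m) (f : DGCategory.Hom K X Y n) :
    map (d n m h f) = d n m h (map f)

namespace DGFunctor

section

variable {K : Type u} [CommRing K] {A : Type w} [DGCategory.{u, v} K A]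
  {B : Type w'} [DGCategory.{u, v'} K B] {C : Type w''} [DGCategory.{u, v''} K C]

/-- The composite dg-functor `G ∘ F`. -/
protected def comp (F : DGFunctor K A B) (G : DGFunctor K B C) : DGFunctor K A C where
  obj X := G.obj (F.obj X)
  map := G.map ∘ₗ F.map
  map_id X := by simp [F.map_id, G.map_id]
  map_comp h f g := by simp [F.map_comp, G.map_comp]
  map_d n m h f := by simp [F.map_d, G.map_d]

/-- The functor `F₀ : A₀ ⥤ B₀` induced by a dg-functor on underlying categories. -/
def underlying (F : DGFunctor K A B) : Z0 K A ⥤ Z0 K B where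
  obj X := ⟨F.obj X.obj⟩
  map f := ⟨F.map f.1, by
    have hf : d 0 1 (zero_add 1) f.1 = 0 := f.2
    change d 0 1 (zero_add 1) (F.map f.1) = 0
    rw [← F.map_d, hf, map_zero]⟩
  map_id X := Subtype.ext (F.map_id X.obj)
  map_comp f g := Subtype.ext (F.map_comp (zero_add 0) f.1 g.1)

end

end DGFunctor

/-- The dg-natural transformations of degree `n` from `F` to `G`: families of morphisms
`η X : F X → G X` of degree `n` with `G f ∘ η X = (-1)^(n m) η Y ∘ F f` for each `f : X → Y` of
degree `m`. -/
def DGNat {K : Type u} [CommRing K] {A : Type w} [DGCategory.{u, v} K A] {B : Type w'}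
    [DGCategory.{u, v'} K B] (F G : DGFunctor K A B) (n : ℤ) :
    Submodule K (∀ X : A, DGCategory.Hom K (F.obj X) (G.obj X) n) where
  carrier := {η | ∀ (X Y : A) (m : ℤ) (f : DGCategory.Hom K X Y m),
    comp (rfl : n + m = n + m) (η X) (G.map f) =
      (n * m).negOnePow • comp (add_comm m n) (F.map f) (η Y)}
  add_mem' {η θ} hη hθ X Y m f := by
    simp only [Pi.add_apply, map_add, LinearMap.add_apply, hη X Y m f, hθ X Y m f, smul_add]
  zero_mem' X Y m f := by simp
  smul_mem' a η hη X Y m f := by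
    simp only [Pi.smul_apply, map_smul, LinearMap.smul_apply, hη X Y m f]
    rw [smul_comm]

namespace DGNat

variable {K : Type u} [CommRing K] {A : Type w} [DGCategory.{u, v} K A]
    {B : Type w'} [DGCategory.{u, v'} K B] {F G H : DGFunctor K A B}

theorem naturality {n : ℤ} (η : DGNat F G n) {X Y : A} {m l : ℤ} (f : DGCategory.Hom K X Y m)
    (h : n + m = l) :
    comp h (η.1 X) (G.map f) =
      (n * m).negOnePow • comp (show m + n = l by lia) (F.map f) (η.1 Y) := by
  subst h
  exact η.2 X Y m f

/-- The differential of a dg-natural transformation. -/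
def diff (n m : ℤ) (h : n + 1 = m) : DGNat F G n →ₗ[K] DGNat F G m where
  toFun η := ⟨fun X => d n m h (η.1 X), by
    intro X Y k f
    subst h
    have h1 := congrArg (d (K := K) (n + k) (n + 1 + k) (by lia)) (naturality η f rfl)
    rw [map_units_smul (K := K), d_comp rfl (n + 1) (k + 1) (n + 1 + k) rfl rfl (by lia),
      d_comp (add_comm k n) (k + 1) (n + 1) (n + 1 + k) rfl rfl (by lia),
      ← DGFunctor.map_d, ← DGFunctor.map_d, naturality η (d k (k + 1) rfl f) (by lia),
      smul_add, smul_smul, ← Int.negOnePow_add, mul_add, mul_one] at h1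
    have h2 := congrArg (fun x => k.negOnePow • x) (add_right_cancel ((add_comm _ _).trans h1))
    simp only [smul_smul, ← Int.negOnePow_add] at h2
    rw [Int.negOnePow_even (k + k) ⟨k, rfl⟩, one_smul] at h2
    rw [add_mul, one_mul, add_comm (n * k)]
    exact h2⟩
  map_add' η θ := Subtype.ext (funext fun X => map_add _ _ _)
  map_smul' a η := Subtype.ext (funext fun X => map_smul _ _ _)

/-- The vertical composition of dg-natural transformations. -/
def vcomp {p q n : ℤ} (h : p + q = n) : DGNat F G p →ₗ[K] DGNat G H q →ₗ[K] DGNat F H n :=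
  LinearMap.mk₂ K (fun η θ => ⟨fun X => comp h (η.1 X) (θ.1 X), by
      intro X Y m f
      subst h
      rw [DGCategory.assoc rfl rfl rfl, naturality θ f rfl, map_units_smul (K := K),
        ← DGCategory.assoc (rfl : p + m = p + m) (by lia) (by lia), naturality η f rfl,
        units_smul_map (K := K), DGCategory.assoc (n := p + q + m) (by lia) rfl (by lia),
        smul_smul, ← Int.negOnePow_add, add_mul, add_comm (p * m)]⟩)
    (fun _ _ _ => Subtype.ext (funext fun X => by simp))
    (fun _ _ _ => Subtype.ext (funext fun X => by simp))
    (fun _ _ _ => Subtype.ext (funext fun X => by simp))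
    (fun _ _ _ => Subtype.ext (funext fun X => by simp))

/-- The identity dg-natural transformation. -/
def idNat (F : DGFunctor K A B) : DGNat F F 0 := ⟨fun X => DGCategory.id (F.obj X), by
  intro X Y m f
  have h : ∀ (l : ℤ) (h : 0 + m = l), comp (K := K) h (DGCategory.id (F.obj X)) (F.map f) =
      comp (show m + 0 = l by lia) (F.map f) (DGCategory.id (F.obj Y)) := by
    intro l h
    obtain rfl : m = l := by lia
    rw [DGCategory.id_comp, DGCategory.comp_id]
  rw [zero_mul, Int.negOnePow_zero, one_smul, h]⟩

end DGNat

/-- The dg-category of dg-functors from `A` to `B`, with the dg-natural transformations as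
morphisms and the differential `(d η) X = d (η X)`. -/
instance DGFunctor.dgCategory {K : Type u} [CommRing K] {A : Type w} [DGCategory.{u, v} K A]
    {B : Type w'} [DGCategory.{u, v'} K B] :
    DGCategory.{u, max w v'} K (DGFunctor K A B) where
  Hom F G n := DGNat F G n
  d := DGNat.diff
  comp := DGNat.vcomp
  id := DGNat.idNat
  d_d n m l h h' η := Subtype.ext (funext fun X => d_d n m l h h' (η.1 X))
  d_comp h p' q' n' hp hq hn η θ := Subtype.ext (funext fun X =>
    d_comp h p' q' n' hp hq hn (η.1 X) (θ.1 X))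
  id_comp η := Subtype.ext (funext fun X => DGCategory.id_comp (η.1 X))
  comp_id η := Subtype.ext (funext fun X => DGCategory.comp_id (η.1 X))
  assoc hpq hqr hn η θ κ := Subtype.ext (funext fun X =>
    DGCategory.assoc hpq hqr hn (η.1 X) (θ.1 X) (κ.1 X))

/-! ### Full dg-subcategories, opposites, dg-modules over `K` -/

/-- The full dg-subcategory of `C` on a set of objects. -/
instance DGCategory.full {K : Type u} [CommRing K] {C : Type w} [DGCategory.{u, v} K C]
    (B : Set C) : DGCategory.{u, v} K B where
  Hom X Y n := DGCategory.Hom K X.1 Y.1 n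
  d n m h := d n m h
  comp h := comp h
  id X := DGCategory.id X.1
  d_d n m l h h' f := d_d n m l h h' f
  d_comp h p' q' n' hp hq hn f g := d_comp h p' q' n' hp hq hn f g
  id_comp f := DGCategory.id_comp f
  comp_id f := DGCategory.comp_id f
  assoc hpq hqr hn f g k := DGCategory.assoc hpq hqr hn f g k

/-- The inclusion `j : B ⥤ C` of a full dg-subcategory. -/
def DGFunctor.inclusion (K : Type u) [CommRing K] {C : Type w} [DGCategory.{u, v} K C]
    (B : Set C) : DGFunctor K B C where
  obj X := X.1
  map {X Y n} := (LinearMap.id : DGCategory.Hom K X.1 Y.1 n →ₗ[K] DGCategory.Hom K X.1 Y.1 n)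
  map_id _ := rfl
  map_comp _ _ _ := rfl
  map_d _ _ _ _ := rfl

/-- The composition in the opposite dg-category: "`fᵒᵖ` followed by `gᵒᵖ`" is
`(-1)^(|f| |g|) (f ∘ g)ᵒᵖ`. -/
def DGCategory.opComp {K : Type u} [CommRing K] {C : Type w} [DGCategory.{u, v} K C]
    {X Y Z : C} {p q n : ℤ} (h : p + q = n) :
    DGCategory.Hom K Y X p →ₗ[K] DGCategory.Hom K Z Y q →ₗ[K] DGCategory.Hom K Z X n :=
  LinearMap.mk₂ K (fun f g => (p * q).negOnePow • comp (show q + p = n by lia) g f)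
    (fun _ _ _ => by rw [map_add, smul_add])
    (fun _ _ _ => by rw [map_smul, smul_comm])
    (fun _ _ _ => by rw [map_add, LinearMap.add_apply, smul_add])
    (fun _ _ _ => by rw [map_smul, LinearMap.smul_apply, smul_comm])

theorem DGCategory.opComp_apply {K : Type u} [CommRing K] {C : Type w} [DGCategory.{u, v} K C]
    {X Y Z : C} {p q n : ℤ} (h : p + q = n) (f : DGCategory.Hom K Y X p)
    (g : DGCategory.Hom K Z Y q) :
    opComp h f g = (p * q).negOnePow • comp (show q + p = n by lia) g f := rfl

/-- The opposite dg-category. -/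
instance DGCategory.opposite {K : Type u} [CommRing K] {C : Type w} [DGCategory.{u, v} K C] :
    DGCategory.{u, v} K Cᵒᵖ where
  Hom X Y n := DGCategory.Hom K Y.unop X.unop n
  d n m h := d n m h
  comp h := opComp h
  id X := DGCategory.id X.unop
  d_d n m l h h' f := d_d n m l h h' f
  d_comp {X Y Z p q n} h p' q' n' hp hq hn f g := by
    subst hp hq hn
    simp only [opComp_apply, map_units_smul (K := K)]
    rw [d_comp (K := K) (show q + p = n by lia) (q + 1) (p + 1) (n + 1) rfl rfl rfl]
    simp only [smul_add, smul_smul, ← Int.negOnePow_add]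
    refine (add_comm _ _).trans (congrArg₂ _ ?_ ?_)
    · rw [mul_add, mul_one]
    · have hs : (q + (p + 1) * q).negOnePow = (p * q).negOnePow := by
        rw [show q + (p + 1) * q = p * q + (q + q) by ring, Int.negOnePow_add,
          Int.negOnePow_even (q + q) ⟨q, rfl⟩, mul_one]
      rw [hs]
  id_comp f := by
    rw [opComp_apply, zero_mul, Int.negOnePow_zero, one_smul, DGCategory.comp_id]
  comp_id f := by
    rw [opComp_apply, mul_zero, Int.negOnePow_zero, one_smul, DGCategory.id_comp]
  assoc {X Y Z W p q r pq qr n} hpq hqr hn f g k := by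
    subst hpq hqr hn
    rw [opComp_apply rfl f g, opComp_apply rfl g k, units_smul_map (K := K),
      map_units_smul (K := K), opComp_apply, opComp_apply, smul_smul, smul_smul,
      ← Int.negOnePow_add, ← Int.negOnePow_add,
      DGCategory.assoc (K := K) (show r + q = q + r by lia) (show q + p = p + q by lia)
      (show r + q + p = p + q + r by lia)]
    have hs : p * q + (p + q) * r = q * r + p * (q + r) := by ring
    rw [hs]

/-- The dg-functor between opposite dg-categories induced by a dg-functor. -/
def DGFunctor.op {K : Type u} [CommRing K] {A : Type w} [DGCategory.{u, v} K A]
    {B : Type w'} [DGCategory.{u, v'} K B] (F : DGFunctor K A B) : DGFunctor K Aᵒᵖ Bᵒᵖ where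
  obj X := Opposite.op (F.obj X.unop)
  map {X Y n} := F.map (X := Y.unop) (Y := X.unop) (n := n)
  map_id X := F.map_id X.unop
  map_comp {X Y Z p q n} h f g := by
    change F.map (opComp (X := X.unop) (Y := Y.unop) (Z := Z.unop) h f g) =
      opComp h (F.map (X := Y.unop) (Y := X.unop) f) (F.map (X := Z.unop) (Y := Y.unop) g)
    rw [opComp_apply, opComp_apply, map_units_smul, F.map_comp]
  map_d n m h f := F.map_d n m h f

/-- The dg-category `DgMod(K)` of dg `K`-modules, that is, of cochain complexes of `K`-modules;
the morphisms of degree `n` are the families of `K`-linear maps `M^p → N^(p+n)`, with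
differential `d α = d_N ∘ α - (-1)^n α ∘ d_M`. -/
noncomputable instance DGCategory.dgModK (K : Type u) [CommRing K] :
    DGCategory.{u, u} K (CochainComplex (ModuleCat.{u} K) ℤ) where
  Hom M N n := Cochain M N n
  d {M N} n m _ := δ_hom K M N n m
  comp h := LinearMap.mk₂ K (fun f g => Cochain.comp f g h)
    (fun _ _ _ => Cochain.add_comp _ _ _ _) (fun _ _ _ => Cochain.smul_comp _ _ _ _)
    (fun _ _ _ => Cochain.comp_add _ _ _ _) (fun _ _ _ => Cochain.comp_smul _ _ _ _)
  id M := Cochain.ofHom (𝟙 M)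
  d_d n m l _ _ f := δ_δ n m l f
  d_comp h p' q' n' hp hq hn f g := δ_comp f g h p' q' n' hn hp hq
  id_comp f := Cochain.id_comp f
  comp_id f := Cochain.comp_id f
  assoc hpq hqr hn f g k := Cochain.comp_assoc f g k hpq hqr hn

/-- The value in `N^q` of a morphism `α : M → N` of degree `n` in `DgMod(K)` at an element of
`M^p`, where `q = p + n`. -/
def DGCategory.evalK {K : Type u} [CommRing K] {M N : CochainComplex (ModuleCat.{u} K) ℤ} {n : ℤ}
    (α : DGCategory.Hom K M N n) {p q : ℤ} (h : p + n = q) (x : M.X p) : N.X q :=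
  (Cochain.v (show Cochain M N n from α) p q h).hom x

/-- The complex of `K`-modules of morphisms from `X` to `Y`. -/
def DGCategory.homComplex (K : Type u) [CommRing K] {C : Type w} [DGCategory.{u, u} K C]
    (X Y : C) : CochainComplex (ModuleCat.{u} K) ℤ where
  X n := ModuleCat.of K (DGCategory.Hom K X Y n)
  d i j := if h : i + 1 = j then ModuleCat.ofHom (d i j h) else 0
  shape i j h := dif_neg h
  d_comp_d' i j k hij hjk := by
    have hij' : i + 1 = j := hij
    have hjk' : j + 1 = k := hjk
    rw [dif_pos hij', dif_pos hjk']
    ext f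
    exact d_d i j k hij' hjk' f

theorem DGCategory.homComplex_d (K : Type u) [CommRing K] {C : Type w} [DGCategory.{u, u} K C]
    (X Y : C) (i j : ℤ) (h : i + 1 = j) :
    (homComplex K X Y).d i j = ModuleCat.ofHom (d i j h) := dif_pos h

/-- The representable dg-functor `Hom(X, -) : C → DgMod(K)`, with `Hom(X, f) j = f ∘ j`.
For an opposite dg-category this gives the contravariant `Hom(-, X)`, with its signs:
`Hom(fᵒᵖ, X) j = (-1)^(|f| |j|) j ∘ f`. -/
def DGFunctor.rep (K : Type u) [CommRing K] {C : Type w} [DGCategory.{u, u} K C] (X : C) :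
    DGFunctor K C (CochainComplex (ModuleCat.{u} K) ℤ) where
  obj Y := homComplex K X Y
  map {Y Z n} :=
    { toFun := fun f => (Cochain.mk fun p q h => ModuleCat.ofHom ((comp h).flip f) :
        Cochain (homComplex K X Y) (homComplex K X Z) n)
      map_add' := fun f g => by
        refine Cochain.ext _ _ fun p q h => ?_
        ext x
        exact map_add (comp h x) f g
      map_smul' := fun a f => by
        refine Cochain.ext _ _ fun p q h => ?_
        ext x
        exact map_smul (comp h x) a f }
  map_id Y := by
    refine Cochain.ext _ _ fun p q h => ?_
    obtain rfl : p = q := by lia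
    ext x
    change comp h x (DGCategory.id Y) =
      (Cochain.v (Cochain.ofHom (𝟙 (homComplex K X Y))) p p h).hom x
    rw [Cochain.ofHom_v]
    exact DGCategory.comp_id x
  map_comp {Y Z W p q n} h f g := by
    refine Cochain.ext _ _ fun i j hij => ?_
    change _ = (Cochain.comp _ _ h).v i j hij
    rw [Cochain.comp_v _ _ h i (i + p) j rfl (by lia)]
    ext x
    exact (DGCategory.assoc (n := j) rfl h (by lia) x f g).symm
  map_d {Y Z} n m h f := by
    refine Cochain.ext _ _ fun i j hij => ?_
    change _ = (δ n m _).v i j hij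
    rw [δ_v n m h _ i j hij (i + n) (i + 1) (by lia) rfl, homComplex_d K X Z _ _ (by lia),
      homComplex_d K X Y _ _ rfl]
    ext x
    have hd := d_comp (K := K) (rfl : i + n = i + n) (i + 1) m j rfl h (by lia) x f
    change comp hij x (d n m h f) = d (i + n) j (by lia) (comp rfl x f) +
      m.negOnePow • comp (by lia) (d i (i + 1) rfl x) f
    have hs : m.negOnePow = -n.negOnePow := by rw [← h, Int.negOnePow_succ]
    rw [hd, hs, Units.neg_smul, add_neg_cancel_right]

/-- The dg-category `DgMod(C)` of left dg `C`-modules. -/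
abbrev DgMod (K : Type u) [CommRing K] (C : Type w) [DGCategory.{u, v} K C] :=
  DGFunctor K C (CochainComplex (ModuleCat.{u} K) ℤ)

/-- The dg-functor `F_* : DgFun(C, D) → DgFun(A, D)`, `S ↦ S ∘ F`. -/
def DGFunctor.restrict {K : Type u} [CommRing K] {A : Type w} [DGCategory.{u, v} K A]
    {C : Type w'} [DGCategory.{u, v'} K C] (F : DGFunctor K A C) (D : Type w'')
    [DGCategory.{u, v''} K D] : DGFunctor K (DGFunctor K C D) (DGFunctor K A D) where
  obj S := F.comp S
  map {S T n} :=
    { toFun := fun (η : DGNat S T n) =>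
        (⟨fun X => η.1 (F.obj X), fun X Y m f => η.2 (F.obj X) (F.obj Y) m (F.map f)⟩ :
          DGNat (F.comp S) (F.comp T) n)
      map_add' := fun _ _ => rfl
      map_smul' := fun _ _ => rfl }
  map_id _ := rfl
  map_comp _ _ _ := rfl
  map_d _ _ _ _ := rfl

/-! ### Kan extensions -/

/-- `φ : G → S ∘ F` exhibits `S` as the (pointwise) left Kan extension of `G` along `F`: it is
closed of degree zero, and for all `c` and `b` the map
`Hom(S c, b) → DGNat(Hom(F -, c), Hom(G -, b))` sending `β` to `f ↦ β ∘ S f ∘ φ`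
is bijective in each degree. -/
structure IsLeftKanExtension {K : Type u} [CommRing K] {A : Type w} [DGCategory.{u, u} K A]
    {C : Type w'} [DGCategory.{u, u} K C] {B : Type w''} [DGCategory.{u, u} K B]
    (F : DGFunctor K A C) (G : DGFunctor K A B) (S : DGFunctor K C B)
    (φ : DGNat G (F.comp S) 0) : Prop where
  closed : DGNat.diff 0 1 (zero_add 1) φ = 0
  existsUnique (c : C) (b : B) (n : ℤ)
    (η : DGNat (F.op.comp (DGFunctor.rep K (Opposite.op c)))
      (G.op.comp (DGFunctor.rep K (Opposite.op b))) n) :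
    ∃! β : DGCategory.Hom K (S.obj c) b n,
      ∀ (a : A) (p q : ℤ) (h : p + n = q) (f : DGCategory.Hom K (F.obj a) c p),
        evalK (η.1 (Opposite.op a)) h f =
          DGCategory.comp h (DGCategory.comp (zero_add p) (φ.1 a) (S.map f)) β

/-- `ψ : T ∘ F → G` exhibits `T` as the (pointwise) right Kan extension of `G` along `F`: it is
closed of degree zero, and for all `c` and `b` the map
`Hom(b, T c) → DGNat(Hom(c, F -), Hom(b, G -))` sending `β` to
`f ↦ (-1)^(|β| |f|) ψ ∘ T f ∘ β` is bijective in each degree. -/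
structure IsRightKanExtension {K : Type u} [CommRing K] {A : Type w} [DGCategory.{u, u} K A]
    {C : Type w'} [DGCategory.{u, u} K C] {B : Type w''} [DGCategory.{u, u} K B]
    (F : DGFunctor K A C) (G : DGFunctor K A B) (T : DGFunctor K C B)
    (ψ : DGNat (F.comp T) G 0) : Prop where
  closed : DGNat.diff 0 1 (zero_add 1) ψ = 0
  existsUnique (c : C) (b : B) (n : ℤ)
    (η : DGNat (F.comp (DGFunctor.rep K c)) (G.comp (DGFunctor.rep K b)) n) :
    ∃! β : DGCategory.Hom K b (T.obj c) n,
      ∀ (a : A) (p q : ℤ) (h : p + n = q) (f : DGCategory.Hom K c (F.obj a) p),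
        evalK (η.1 a) h f =
          (n * p).negOnePow • DGCategory.comp (show n + p = q by lia) β
            (DGCategory.comp (add_zero p) (T.map f) (ψ.1 a))

/-- `L : DgMod(A) → DgMod(C)` is the dg-functor `𝕃an_F`: it sends `G` to a left Kan extension
`(L G, φ G)` of `G` along `F`, and `η : G → G'` to the morphism `L η` such that
`(L η ∘ F) ∘ φ G = φ G' ∘ η`. -/
def IsLan {K : Type u} [CommRing K] {A : Type w} [DGCategory.{u, u} K A]
    {C : Type w'} [DGCategory.{u, u} K C] (F : DGFunctor K A C)
    (L : DGFunctor K (DgMod K A) (DgMod K C)) : Prop :=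
  ∃ φ : ∀ G : DgMod K A, DGNat G (F.comp (L.obj G)) 0,
    (∀ G, IsLeftKanExtension F G (L.obj G) (φ G)) ∧
    ∀ (G G' : DgMod K A) (n : ℤ) (η : DGNat G G' n),
      DGNat.vcomp (zero_add n) (φ G) ((F.restrict _).map (L.map η)) =
        DGNat.vcomp (add_zero n) η (φ G')

/-- `R : DgMod(A) → DgMod(C)` is the dg-functor `ℝan_F`: it sends `G` to a right Kan extension
`(R G, ψ G)` of `G` along `F`, and `η : G → G'` to the morphism `R η` such that
`ψ G' ∘ (R η ∘ F) = η ∘ ψ G`. -/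
def IsRan {K : Type u} [CommRing K] {A : Type w} [DGCategory.{u, u} K A]
    {C : Type w'} [DGCategory.{u, u} K C] (F : DGFunctor K A C)
    (R : DGFunctor K (DgMod K A) (DgMod K C)) : Prop :=
  ∃ ψ : ∀ G : DgMod K A, DGNat (F.comp (R.obj G)) G 0,
    (∀ G, IsRightKanExtension F G (R.obj G) (ψ G)) ∧
    ∀ (G G' : DgMod K A) (n : ℤ) (η : DGNat G G' n),
      DGNat.vcomp (add_zero n) ((F.restrict _).map (R.map η)) (ψ G') =
        DGNat.vcomp (zero_add n) (ψ G) η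

/-! ### dg-ideals and quotients -/

/-- A dg-ideal: a graded submodule of each `Hom X Y`, stable under the differential and under
composition with arbitrary morphisms. -/
structure DGIdeal (K : Type u) [CommRing K] (C : Type w) [DGCategory.{u, v} K C] where
  carrier (X Y : C) (n : ℤ) : Submodule K (DGCategory.Hom K X Y n)
  d_mem {X Y : C} (n m : ℤ) (h : n + 1 = m) {f : DGCategory.Hom K X Y n}
    (hf : f ∈ carrier X Y n) : d n m h f ∈ carrier X Y m
  comp_mem_left {X Y Z : C} {p q n : ℤ} (h : p + q = n) {f : DGCategory.Hom K X Y p}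
    (hf : f ∈ carrier X Y p) (g : DGCategory.Hom K Y Z q) : comp h f g ∈ carrier X Z n
  comp_mem_right {X Y Z : C} {p q n : ℤ} (h : p + q = n) (f : DGCategory.Hom K X Y p)
    {g : DGCategory.Hom K Y Z q} (hg : g ∈ carrier Y Z q) : comp h f g ∈ carrier X Z n

/-- The quotient dg-category `C/I`: the objects of `C`, with morphisms `Hom X Y n ⧸ I X Y n`. -/
structure DGQuotient {K : Type u} [CommRing K] {C : Type w} [DGCategory.{u, v} K C]
    (I : DGIdeal K C) where
  of ::
  obj : C

namespace DGQuotient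

variable {K : Type u} [CommRing K] {C : Type w} [DGCategory.{u, v} K C] (I : DGIdeal K C)

/-- The composition of `C/I`, induced by that of `C`. -/
def compQ {X Y Z : C} {p q n : ℤ} (h : p + q = n) :
    (DGCategory.Hom K X Y p ⧸ I.carrier X Y p) →ₗ[K]
      (DGCategory.Hom K Y Z q ⧸ I.carrier Y Z q) →ₗ[K]
        (DGCategory.Hom K X Z n ⧸ I.carrier X Z n) :=
  Submodule.liftQ _
    (Submodule.liftQ _ (((comp h).compr₂ (I.carrier X Z n).mkQ).flip) (by
      intro g hg
      ext f
      exact (Submodule.Quotient.mk_eq_zero _).2 (I.comp_mem_right h f hg))).flip (by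
    intro f hf
    refine Submodule.linearMap_qext _ (LinearMap.ext fun g => ?_)
    exact (Submodule.Quotient.mk_eq_zero _).2 (I.comp_mem_left h hf g))

/-- The differential of `C/I`, induced by that of `C`. -/
def dQ {X Y : C} (n m : ℤ) (h : n + 1 = m) :
    (DGCategory.Hom K X Y n ⧸ I.carrier X Y n) →ₗ[K]
      (DGCategory.Hom K X Y m ⧸ I.carrier X Y m) :=
  Submodule.mapQ _ _ (d n m h) fun _ hf => I.d_mem n m h hf

instance : DGCategory.{u, v} K (DGQuotient I) where
  Hom X Y n := DGCategory.Hom K X.obj Y.obj n ⧸ I.carrier X.obj Y.obj n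
  d := dQ I
  comp := compQ I
  id X := Submodule.Quotient.mk (DGCategory.id X.obj)
  d_d n m l h h' f := by
    obtain ⟨f, rfl⟩ := Submodule.Quotient.mk_surjective _ f
    exact congrArg _ (d_d n m l h h' f)
  d_comp h p' q' n' hp hq hn f g := by
    obtain ⟨f, rfl⟩ := Submodule.Quotient.mk_surjective _ f
    obtain ⟨g, rfl⟩ := Submodule.Quotient.mk_surjective _ g
    have := congrArg (Submodule.mkQ (I.carrier _ _ n')) (d_comp h p' q' n' hp hq hn f g)
    rw [map_add, map_units_smul] at this
    exact this
  id_comp f := by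
    obtain ⟨f, rfl⟩ := Submodule.Quotient.mk_surjective _ f
    exact congrArg _ (DGCategory.id_comp f)
  comp_id f := by
    obtain ⟨f, rfl⟩ := Submodule.Quotient.mk_surjective _ f
    exact congrArg _ (DGCategory.comp_id f)
  assoc hpq hqr hn f g k := by
    obtain ⟨f, rfl⟩ := Submodule.Quotient.mk_surjective _ f
    obtain ⟨g, rfl⟩ := Submodule.Quotient.mk_surjective _ g
    obtain ⟨k, rfl⟩ := Submodule.Quotient.mk_surjective _ k
    exact congrArg _ (DGCategory.assoc hpq hqr hn f g k)

/-- The projection `π : C → C/I`. -/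
def proj : DGFunctor K C (DGQuotient I) where
  obj X := ⟨X⟩
  map {X Y n} := (I.carrier X Y n).mkQ
  map_id _ := rfl
  map_comp _ _ _ := rfl
  map_d _ _ _ _ := rfl

end DGQuotient

/-! ### The ideal of morphisms that factor through a full dg-subcategory -/

/-- The full dg-subcategory `B` of `C` is closed under finite coproducts: each finite family of
objects of `B` (also the empty one) has a coproduct in `C` that lies in `B`. -/
def ClosedUnderFiniteCoproducts (K : Type u) [CommRing K] {C : Type w} [DGCategory.{u, v} K C]
    (B : Set C) : Prop :=
  ∀ (m : ℕ) (X : Fin m → C), (∀ i, X i ∈ B) →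
    ∃ c : Cofan (fun i => (TotalCat.of (X i) : TotalCat K C)), c.pt.obj ∈ B ∧
      Nonempty (IsColimit c)

namespace FactorIdeal

open TotalCat

variable {K : Type u} [CommRing K] {C : Type w} [DGCategory.{u, v} K C]

theorem homogeneous_comp {X Y Z : C} {p q n : ℤ} (h : p + q = n) (f : DGCategory.Hom K X Y p)
    (g : DGCategory.Hom K Y Z q) :
    homogeneous f ≫ homogeneous g = homogeneous (comp h f g) :=
  compHom_lof h f g

theorem homogeneous_add {X Y : C} {n : ℤ} (f g : DGCategory.Hom K X Y n) :
    homogeneous (f + g) = homogeneous f + homogeneous g :=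
  map_add (DirectSum.lof K ℤ (fun n => DGCategory.Hom K X Y n) n) f g

theorem homogeneous_zero {X Y : C} {n : ℤ} :
    homogeneous (0 : DGCategory.Hom K X Y n) = 0 :=
  map_zero (DirectSum.lof K ℤ (fun n => DGCategory.Hom K X Y n) n)

/-- The homogeneous morphism `f` is a composite `h ∘ g` of (possibly inhomogeneous) morphisms
`g` to and `h` from an object of `B`. -/
def Factors (B : Set C) {X Y : C} {n : ℤ} (f : DGCategory.Hom K X Y n) : Prop :=
  ∃ Z ∈ B, ∃ (g : (of X : TotalCat K C) ⟶ of Z) (h : (of Z : TotalCat K C) ⟶ of Y),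
    homogeneous f = g ≫ h

variable {B : Set C}

theorem Factors.comp_left {X Y Z : C} {p q n : ℤ} (h : p + q = n) {f : DGCategory.Hom K X Y p}
    (hf : Factors B f) (g : DGCategory.Hom K Y Z q) : Factors B (comp h f g) := by
  obtain ⟨W, hW, a, b, e⟩ := hf
  exact ⟨W, hW, a, b ≫ homogeneous g, by rw [← homogeneous_comp h, e, Category.assoc]⟩

theorem Factors.comp_right {X Y Z : C} {p q n : ℤ} (h : p + q = n) (f : DGCategory.Hom K X Y p)
    {g : DGCategory.Hom K Y Z q} (hg : Factors B g) : Factors B (comp h f g) := by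
  obtain ⟨W, hW, a, b, e⟩ := hg
  exact ⟨W, hW, homogeneous f ≫ a, b, by rw [← homogeneous_comp h, e, Category.assoc]⟩

theorem factors_zero (hB : ClosedUnderFiniteCoproducts K B) {X Y : C} {n : ℤ} :
    Factors B (0 : DGCategory.Hom K X Y n) := by
  obtain ⟨c, hc, -⟩ := hB 0 (fun i => i.elim0) (fun i => i.elim0)
  exact ⟨c.pt.obj, hc, 0, 0, by rw [homogeneous_zero, zero_comp]⟩

theorem Factors.add (hB : ClosedUnderFiniteCoproducts K B) {X Y : C} {n : ℤ}
    {f f' : DGCategory.Hom K X Y n} (hf : Factors B f) (hf' : Factors B f') :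
    Factors B (f + f') := by
  obtain ⟨Z, hZ, g, h, e⟩ := hf
  obtain ⟨Z', hZ', g', h', e'⟩ := hf'
  obtain ⟨c, hc, ⟨hcol⟩⟩ := hB 2 ![Z, Z'] (by
    intro i
    fin_cases i
    · exact hZ
    · exact hZ')
  let t : Cofan (fun i => (TotalCat.of (![Z, Z'] i) : TotalCat K C)) :=
    Cofan.mk (of Y) (Fin.cons h (Fin.cons h' (fun i => i.elim0)))
  let i0 : (of Z : TotalCat K C) ⟶ c.pt := c.inj 0
  let i1 : (of Z' : TotalCat K C) ⟶ c.pt := c.inj 1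
  let k : c.pt ⟶ of Y := hcol.desc t
  have h0 : i0 ≫ k = h := hcol.fac t ⟨0⟩
  have h1 : i1 ≫ k = h' := hcol.fac t ⟨1⟩
  refine ⟨c.pt.obj, hc, g ≫ i0 + g' ≫ i1, k, ?_⟩
  have hk : (g ≫ i0 + g' ≫ i1) ≫ k = g ≫ h + g' ≫ h' := by
    rw [Preadditive.add_comp, Category.assoc, Category.assoc, h0, h1]
  rw [homogeneous_add, e, e']
  exact hk.symm

theorem Factors.smul {X Y : C} {n : ℤ} (a : K) {f : DGCategory.Hom K X Y n} (hf : Factors B f) :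
    Factors B (a • f) := by
  have := hf.comp_left (add_zero n) (a • DGCategory.id Y)
  rwa [map_smul, DGCategory.comp_id] at this

/-- The submodule of the morphisms of degree `n` that factor through an object of `B`. -/
def submodule (hB : ClosedUnderFiniteCoproducts K B) (X Y : C) (n : ℤ) :
    Submodule K (DGCategory.Hom K X Y n) where
  carrier := {f | Factors B f}
  add_mem' hf hf' := hf.add hB hf'
  zero_mem' := factors_zero hB
  smul_mem' a _ hf := hf.smul a

end FactorIdeal

theorem FactorIdeal.factors_comp {K : Type u} [CommRing K] {C : Type w} [DGCategory.{u, v} K C]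
    {B : Set C} {X Y Z : C} (hZ : Z ∈ B) {p q n : ℤ} (h : p + q = n)
    (f : DGCategory.Hom K X Z p) (g : DGCategory.Hom K Z Y q) : Factors B (comp h f g) :=
  ⟨Z, hZ, TotalCat.homogeneous f, TotalCat.homogeneous g, (homogeneous_comp h f g).symm⟩

theorem FactorIdeal.d_component {K : Type u} [CommRing K] {C : Type w} [DGCategory.{u, v} K C]
    {B : Set C} (hB : ClosedUnderFiniteCoproducts K B) {X Y Z : C} (hZ : Z ∈ B)
    (g : ⨁ n, DGCategory.Hom K X Z n) (k : ⨁ n, DGCategory.Hom K Z Y n) (n m : ℤ)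
    (h : n + 1 = m) :
    d n m h (DirectSum.component K ℤ (fun n => DGCategory.Hom K X Y n) n
      (TotalCat.compHom X Z Y g k)) ∈ submodule hB X Y m := by
  induction g using DirectSum.induction_on with
  | zero => simp
  | add g g' hg hg' =>
    rw [TotalCat.compHom_add_left, map_add, map_add]
    exact add_mem hg hg'
  | of p g =>
    induction k using DirectSum.induction_on with
    | zero => simp
    | add k k' hk hk' =>
      rw [TotalCat.compHom_add_right, map_add, map_add]
      exact add_mem hk hk'
    | of q k =>
      rw [← DirectSum.lof_eq_of K, ← DirectSum.lof_eq_of K, TotalCat.compHom_lof rfl g k]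
      by_cases hn : p + q = n
      · subst hn
        rw [DirectSum.component.lof_self,
          d_comp rfl (p + 1) (q + 1) m rfl rfl h g k]
        refine add_mem (factors_comp hZ _ _ _) ?_
        rw [units_smul_eq (K := K)]
        exact Submodule.smul_mem _ _ (factors_comp hZ _ _ _)
      · rw [DirectSum.component.of, dif_neg hn, map_zero]
        exact zero_mem _

/-- The dg-ideal `I_B` of the morphisms that factor through an object of `B`. -/
def factorIdeal {K : Type u} [CommRing K] {C : Type w} [DGCategory.{u, v} K C]
    (B : Set C) (hB : ClosedUnderFiniteCoproducts K B) : DGIdeal K C where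
  carrier := FactorIdeal.submodule hB
  d_mem {X Y} n m h f hf := by
    obtain ⟨Z, hZ, g, k, e⟩ := hf
    have := FactorIdeal.d_component hB hZ g k n m h
    rw [show TotalCat.compHom X Z Y g k =
      DirectSum.lof K ℤ (fun n => DGCategory.Hom K X Y n) n f from e.symm,
      DirectSum.component.lof_self] at this
    exact this
  comp_mem_left h _ hf g := FactorIdeal.Factors.comp_left h hf g
  comp_mem_right h f _ hg := FactorIdeal.Factors.comp_right h f hg

/-! ### Recollements of abelian categories -/

/-- The functors `iUp = i^*`, `iStar = i_* = i_!`, `iShriek = i^!`, `jLow = j_!`,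
`jStar = j^! = j^*`, `jRight = j_*` form a recollement of abelian categories
`𝓐 → 𝓑 → 𝓒`. -/
structure IsAbelianRecollement {𝓐 : Type w} [Category.{v} 𝓐] [Preadditive 𝓐]
    {𝓑 : Type w'} [Category.{v'} 𝓑] [Preadditive 𝓑]
    {𝓒 : Type w''} [Category.{v''} 𝓒] [Preadditive 𝓒]
    (iUp : 𝓑 ⥤ 𝓐) (iStar : 𝓐 ⥤ 𝓑) (iShriek : 𝓑 ⥤ 𝓐)
    (jLow : 𝓒 ⥤ 𝓑) (jStar : 𝓑 ⥤ 𝓒) (jRight : 𝓒 ⥤ 𝓑) : Prop where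
  abelian_left : ∃ a : Abelian 𝓐, a.toPreadditive = ‹Preadditive 𝓐›
  abelian_middle : ∃ a : Abelian 𝓑, a.toPreadditive = ‹Preadditive 𝓑›
  abelian_right : ∃ a : Abelian 𝓒, a.toPreadditive = ‹Preadditive 𝓒›
  additive_iUp : iUp.Additive
  additive_iStar : iStar.Additive
  additive_iShriek : iShriek.Additive
  additive_jLow : jLow.Additive
  additive_jStar : jStar.Additive
  additive_jRight : jRight.Additive
  adj_iUp : Nonempty (iUp ⊣ iStar)
  adj_iShriek : Nonempty (iStar ⊣ iShriek)
  adj_jLow : Nonempty (jLow ⊣ jStar)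
  adj_jRight : Nonempty (jStar ⊣ jRight)
  ker_eq_im (X : 𝓑) : IsZero (jStar.obj X) ↔ iStar.essImage X
  full_iStar : iStar.Full
  faithful_iStar : iStar.Faithful
  full_jLow : jLow.Full
  faithful_jLow : jLow.Faithful
  full_jRight : jRight.Full
  faithful_jRight : jRight.Faithful

/-! The theorem rests on three independent facts: categories of dg-modules are abelian, restriction
along any dg-functor `F` between small dg-categories has both adjoints, given by pointwise Kan
extensions, and the special shape of `π` and `j` turns these adjunctions into a recollement.

Kernels, cokernels and finite products of dg-modules are formed object by object and degree by
degree. A mono is therefore injective in each degree, hence the kernel of its cokernel, and dually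
for an epi; this gives `abelianDgMod`.

The left Kan extension of `G` along `F` is the coend `∫ᵃ Hom(F a, c) ⊗ G a`, and the right one is
the module of transformations `DGNat(Hom(c, F -), G)`. The pointwise universal property implies that
the unit, or counit, is a universal arrow for restriction in every degree (`isUniversalFrom`,
`isUniversalTo`). These arrows are closed, so the resulting bijections commute with the
differentials and restrict to closed morphisms of degree zero. This yields the adjunctions between
underlying categories. The argument uses only the universal property, so it applies to every choice
of the Kan extension functors.

Since `j` is fully faithful, the unit of `j_! ⊣ j^*` is invertible (`exists_inverse`), so `j_!` is
fully faithful, and then so is `j_*`, at the other end of an adjoint triple. The functor `π_*` is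
fully faithful because `π` is bijective on objects and surjective on morphisms.

Finally, `j^* M = 0` says that the identity of `M Z` is zero for each `Z` in `B`. Then `M` kills all
morphisms that factor through `B` and descends to the quotient. Conversely, the identities of the
objects of `B` lie in the ideal, so modules over the quotient vanish on `B`.

All computations are made with elements: `evalK` turns identities between cochains into identities
between their values, and Koszul signs are compared through the parity of exponents. -/

/-! ### Evaluation of cochains at elements -/

section EvalK

variable {K : Type u} [CommRing K] {M N L : CochainComplex (ModuleCat.{u} K) ℤ}

theorem evalK_add {n : ℤ} (α β : DGCategory.Hom K M N n) {p q : ℤ} (h : p + n = q) (x : M.X p) :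
    evalK (α + β) h x = evalK α h x + evalK β h x := rfl

theorem evalK_smul {n : ℤ} (a : K) (α : DGCategory.Hom K M N n) {p q : ℤ} (h : p + n = q)
    (x : M.X p) : evalK (a • α) h x = a • evalK α h x := rfl

theorem evalK_zero {n p q : ℤ} (h : p + n = q) (x : M.X p) :
    evalK (0 : DGCategory.Hom K M N n) h x = 0 := rfl

theorem evalK_units_smul {n : ℤ} (a : ℤˣ) (α : DGCategory.Hom K M N n) {p q : ℤ} (h : p + n = q)
    (x : M.X p) : evalK (a • α) h x = a • evalK α h x := by
  rw [units_smul_eq (K := K), units_smul_eq (K := K), evalK_smul]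

theorem evalK_apply_add {n : ℤ} (α : DGCategory.Hom K M N n) {p q : ℤ} (h : p + n = q)
    (x y : M.X p) : evalK α h (x + y) = evalK α h x + evalK α h y :=
  map_add (Cochain.v (show Cochain M N n from α) p q h).hom x y

theorem evalK_apply_smul {n : ℤ} (α : DGCategory.Hom K M N n) {p q : ℤ} (h : p + n = q)
    (a : K) (x : M.X p) : evalK α h (a • x) = a • evalK α h x :=
  map_smul (Cochain.v (show Cochain M N n from α) p q h).hom a x

theorem evalK_apply_units_smul {n : ℤ} (α : DGCategory.Hom K M N n) {p q : ℤ} (h : p + n = q)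
    (a : ℤˣ) (x : M.X p) : evalK α h (a • x) = a • evalK α h x := by
  rw [units_smul_eq (K := K), units_smul_eq (K := K), evalK_apply_smul]

theorem evalK_ext {n : ℤ} {α β : DGCategory.Hom K M N n}
    (H : ∀ (p q : ℤ) (h : p + n = q) (x : M.X p), evalK α h x = evalK β h x) : α = β := by
  refine Cochain.ext (show Cochain M N n from α) β fun p q h => ?_
  ext x
  exact H p q h x

/-- The morphism of degree `n` in `DgMod(K)` given by a family of linear maps. -/
noncomputable def cochainMk {n : ℤ} (e : ∀ p q : ℤ, p + n = q → (M.X p →ₗ[K] N.X q)) :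
    DGCategory.Hom K M N n :=
  (Cochain.mk fun p q h => ModuleCat.ofHom (e p q h) : Cochain M N n)

theorem evalK_cochainMk {n : ℤ} (e : ∀ p q : ℤ, p + n = q → (M.X p →ₗ[K] N.X q)) {p q : ℤ}
    (h : p + n = q) (x : M.X p) : evalK (cochainMk e) h x = e p q h x := rfl

theorem evalK_comp {p q n : ℤ} (h : p + q = n) (α : DGCategory.Hom K M N p)
    (β : DGCategory.Hom K N L q) {i j k : ℤ} (hi : i + p = j) (hj : j + q = k) (hk : i + n = k)
    (x : M.X i) : evalK (DGCategory.comp h α β) hk x = evalK β hj (evalK α hi x) := by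
  have := Cochain.comp_v (show Cochain M N p from α) (show Cochain N L q from β) h i j k hi hj
  exact congrArg (fun f : M.X i ⟶ L.X k => f.hom x) this

/-- The degree `j` equals `i` only propositionally, so the identity cochain appears as the transport
between the two components. -/
theorem evalK_id {i j : ℤ} (h : i + 0 = j) (x : M.X i) :
    evalK (DGCategory.id (K := K) M) h x = (M.XIsoOfEq (show i = j by lia)).hom.hom x := by
  obtain rfl : i = j := by lia
  change (Cochain.v (Cochain.ofHom (𝟙 M)) i i h).hom x = _
  rw [Cochain.ofHom_v]
  simp

theorem evalK_id' {i : ℤ} (h : i + 0 = i) (x : M.X i) :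
    evalK (DGCategory.id (K := K) M) h x = x := by
  rw [evalK_id]; simp

theorem evalK_d {n m : ℤ} (h : n + 1 = m) (α : DGCategory.Hom K M N n) {i i' j j' : ℤ}
    (hi : i + 1 = i') (hj : j + 1 = j') (hn : i + n = j) (x : M.X i) :
    evalK (DGCategory.d n m h α) (show i + m = j' by lia) x =
      (N.d j j').hom (evalK α hn x) +
        m.negOnePow • evalK α (show i' + n = j' by lia) ((M.d i i').hom x) := by
  have := δ_v n m h (show Cochain M N n from α) i j' (by lia) j i' (by lia) hi
  exact congrArg (fun f : M.X i ⟶ N.X j' => f.hom x) this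

/-- The formula for `d α` solved for the differential of a value; the sign changes from `(-1)^m` to
`(-1)^n` because `m = n + 1`. -/
theorem d_evalK {n m : ℤ} (h : n + 1 = m) (α : DGCategory.Hom K M N n) {i i' j j' : ℤ}
    (hi : i + 1 = i') (hj : j + 1 = j') (hn : i + n = j) (x : M.X i) :
    (N.d j j').hom (evalK α hn x) =
      evalK (DGCategory.d n m h α) (show i + m = j' by lia) x +
        n.negOnePow • evalK α (show i' + n = j' by lia) ((M.d i i').hom x) := by
  rw [evalK_d h α hi hj hn]
  have hs : m.negOnePow = -n.negOnePow := by rw [← h, Int.negOnePow_succ]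
  rw [hs, Units.neg_smul, neg_add_cancel_right]

end EvalK

/-! ### dg-modules in terms of elements -/

namespace DGFunctor

variable {K : Type u} [CommRing K] {A : Type w} [DGCategory.{u, v} K A]

/-- The component of degree `n` of the value at `a` of a dg-module. -/
abbrev X (M : DgMod K A) (a : A) (n : ℤ) : ModuleCat.{u} K := (M.obj a).X n

/-- The differential of the value at `a` of a dg-module. -/
abbrev δX (M : DgMod K A) (a : A) (n m : ℤ) : M.X a n →ₗ[K] M.X a m := ((M.obj a).d n m).hom

/-- The action of the morphisms of `A` on the elements of a dg-module. -/
noncomputable def act (M : DgMod K A) {a b : A} {p i j : ℤ} (h : i + p = j) :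
    DGCategory.Hom K a b p →ₗ[K] M.X a i →ₗ[K] M.X b j :=
  LinearMap.mk₂ K (fun f x => evalK (M.map f) h x)
    (fun f g x => by rw [map_add, evalK_add])
    (fun c f x => by rw [map_smul, evalK_smul])
    (fun f x y => evalK_apply_add _ _ _ _)
    (fun c f x => evalK_apply_smul _ _ _ _)

theorem evalK_map (M : DgMod K A) {a b : A} {p i j : ℤ} (h : i + p = j)
    (f : DGCategory.Hom K a b p) (x : M.X a i) : evalK (M.map f) h x = M.act h f x := rfl

theorem act_id (M : DgMod K A) (a : A) {i : ℤ} (x : M.X a i) :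
    M.act (add_zero i) (DGCategory.id a) x = x := by
  rw [← evalK_map, M.map_id, evalK_id']

theorem act_comp (M : DgMod K A) {a b c : A} {p q n i j k : ℤ} (h : p + q = n) (hi : i + p = j)
    (hj : j + q = k) (hk : i + n = k) (f : DGCategory.Hom K a b p) (g : DGCategory.Hom K b c q)
    (x : M.X a i) : M.act hk (DGCategory.comp h f g) x = M.act hj g (M.act hi f x) := by
  rw [← evalK_map, M.map_comp, evalK_comp h _ _ hi hj hk]; rfl

/-- On elements, the compatibility of a dg-functor with differentials is the Leibniz rule for the
action. -/
theorem δX_act (M : DgMod K A) {a b : A} {p p' i i' j j' : ℤ} (hp : p + 1 = p') (hi : i + 1 = i')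
    (hj : j + 1 = j') (h : i + p = j) (f : DGCategory.Hom K a b p) (x : M.X a i) :
    M.δX b j j' (M.act h f x) = M.act (show i + p' = j' by lia) (d p p' hp f) x +
      p.negOnePow • M.act (show i' + p = j' by lia) f (M.δX a i i' x) := by
  have := d_evalK hp (M.map f) hi hj h x
  rw [← M.map_d] at this
  exact this

theorem δX_δX (M : DgMod K A) (a : A) (n m l : ℤ) (x : M.X a n) :
    M.δX a m l (M.δX a n m x) = 0 :=
  congrArg (fun f : M.X a n ⟶ M.X a l => f.hom x) ((M.obj a).d_comp_d n m l)

end DGFunctor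

/-- A dg-module over `A` in terms of elements: graded `K`-modules with differentials on which the
morphisms of `A` act. -/
structure DGModuleData (K : Type u) [CommRing K] (A : Type w) [DGCategory.{u, v} K A] where
  X : A → ℤ → Type u
  [addCommGroup : ∀ a n, AddCommGroup (X a n)]
  [module : ∀ a n, Module K (X a n)]
  d {a : A} (n m : ℤ) (h : n + 1 = m) : X a n →ₗ[K] X a m
  act {a b : A} {p i j : ℤ} (h : i + p = j) : DGCategory.Hom K a b p →ₗ[K] X a i →ₗ[K] X b j
  d_d {a : A} (n m l : ℤ) (h : n + 1 = m) (h' : m + 1 = l) (x : X a n) : d m l h' (d n m h x) = 0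
  act_id {a : A} {i : ℤ} (x : X a i) : act (add_zero i) (DGCategory.id a) x = x
  act_comp {a b c : A} {p q n i j k : ℤ} (h : p + q = n) (hi : i + p = j)
    (hj : j + q = k) (hk : i + n = k) (f : DGCategory.Hom K a b p) (g : DGCategory.Hom K b c q)
    (x : X a i) : act hk (DGCategory.comp h f g) x = act hj g (act hi f x)
  d_act {a b : A} {p p' i i' j j' : ℤ} (hp : p + 1 = p') (hi : i + 1 = i')
    (hj : j + 1 = j') (h : i + p = j) (f : DGCategory.Hom K a b p) (x : X a i) :
    d j j' hj (act h f x) = act (show i + p' = j' by lia) (DGCategory.d p p' hp f) x +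
      p.negOnePow • act (show i' + p = j' by lia) f (d i i' hi x)

attribute [instance] DGModuleData.addCommGroup DGModuleData.module

namespace DGModuleData

variable {K : Type u} [CommRing K] {A : Type w} [DGCategory.{u, v} K A]

/-- The complex of `K`-modules at an object. -/
noncomputable def complex (D : DGModuleData K A) (a : A) : CochainComplex (ModuleCat.{u} K) ℤ where
  X n := ModuleCat.of K (D.X a n)
  d i j := if h : i + 1 = j then ModuleCat.ofHom (D.d i j h) else 0
  shape i j h := dif_neg h
  d_comp_d' i j k hij hjk := by
    have hij' : i + 1 = j := hij
    have hjk' : j + 1 = k := hjk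
    rw [dif_pos hij', dif_pos hjk']
    ext f
    exact D.d_d i j k hij' hjk' f

theorem complex_d (D : DGModuleData K A) (a : A) (i j : ℤ) (h : i + 1 = j) (x : D.X a i) :
    ((D.complex a).d i j).hom x = D.d i j h x := by
  have : (D.complex a).d i j = ModuleCat.ofHom (D.d i j h) := dif_pos h
  rw [this]; rfl

/-- The Leibniz rule solved for the action of `d f`, the shape that the differential of a cochain
takes in `toDgMod`. -/
theorem act_d (D : DGModuleData K A) {a b : A} {p p' i i' j j' : ℤ} (hp : p + 1 = p')
    (hi : i + 1 = i') (hj : j + 1 = j') (h : i + p = j) (f : DGCategory.Hom K a b p) (x : D.X a i) :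
    D.act (show i + p' = j' by lia) (DGCategory.d p p' hp f) x = D.d j j' hj (D.act h f x) +
      p'.negOnePow • D.act (show i' + p = j' by lia) f (D.d i i' hi x) := by
  have hs : p'.negOnePow = -p.negOnePow := by rw [← hp, Int.negOnePow_succ]
  rw [D.d_act hp hi hj h, hs, Units.neg_smul, add_neg_cancel_right]

/-- The dg-module given by its elements. -/
noncomputable def toDgMod (D : DGModuleData K A) : DgMod K A where
  obj := D.complex
  map {a b n} :=
    { toFun f := cochainMk (M := D.complex a) (N := D.complex b) fun p q h => D.act h f
      map_add' f g := evalK_ext fun p q h x =>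
        LinearMap.congr_fun (map_add (D.act h) f g) x
      map_smul' c f := evalK_ext fun p q h x =>
        LinearMap.congr_fun (map_smul (D.act h) c f) x }
  map_id a := evalK_ext fun p q h x => by
    obtain rfl : p = q := by lia
    rw [evalK_id']
    exact D.act_id x
  map_comp h f g := evalK_ext fun i k hk x => by
    rw [evalK_comp h _ _ (rfl : i + _ = _) (by lia)]
    exact D.act_comp h rfl _ hk f g x
  map_d n m h f := evalK_ext fun i j hj x => by
    have := evalK_d (M := D.complex _) (N := D.complex _) h
      (cochainMk fun p q h => D.act h f) (rfl : i + 1 = i + 1) (show i + n + 1 = j by lia) rfl x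
    refine Eq.trans ?_ this.symm
    have e := D.complex_d _ (i + n) j (by lia) (D.act rfl f x)
    have e' := congrArg (fun y => m.negOnePow • D.act (show i + 1 + n = j by lia) f y)
      (D.complex_d _ i (i + 1) rfl x)
    exact (D.act_d h rfl (by lia) rfl f x).trans (congrArg₂ (fun y z : D.X _ j => y + z) e e').symm

theorem toDgMod_δX (D : DGModuleData K A) (a : A) (i j : ℤ) (h : i + 1 = j) (x : D.X a i) :
    D.toDgMod.δX a i j x = D.d i j h x := D.complex_d a i j h x

end DGModuleData

/-! ### Closed morphisms of degree zero between dg-modules -/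

namespace DGNat

variable {K : Type u} [CommRing K] {A : Type w} [DGCategory.{u, v} K A]

theorem evalK_naturality {M N : DgMod K A} {n : ℤ} (η : DGNat M N n) {a b : A} {m i j k l : ℤ}
    (hi : i + n = j) (hj : j + m = k) (hl : i + m = l) (hk : l + n = k)
    (f : DGCategory.Hom K a b m) (x : M.X a i) :
    N.act hj f (evalK (η.1 a) hi x) =
      (n * m).negOnePow • evalK (η.1 b) hk (M.act hl f x) := by
  have := congrArg (fun α => evalK α (show i + (n + m) = k by lia) x) (naturality η f rfl)
  rw [evalK_units_smul, evalK_comp _ _ _ hi hj, evalK_comp _ _ _ hl hk] at this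
  exact this

end DGNat

namespace Z0

variable {K : Type u} [CommRing K] {A : Type w} [DGCategory.{u, v} K A] {M N L : Z0 K (DgMod K A)}

/-- The components of a closed morphism of degree zero between dg-modules. -/
noncomputable def app (f : M ⟶ N) (a : A) (n : ℤ) : M.obj.X a n →ₗ[K] N.obj.X a n :=
  (Cochain.v (show Cochain (M.obj.obj a) (N.obj.obj a) 0 from f.1.1 a) n n (add_zero n)).hom

theorem app_eq (f : M ⟶ N) (a : A) (n : ℤ) (x : M.obj.X a n) :
    app f a n x = evalK (f.1.1 a) (add_zero n) x := rfl

theorem app_act (f : M ⟶ N) {a b : A} {p i j : ℤ} (h : i + p = j) (g : DGCategory.Hom K a b p)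
    (x : M.obj.X a i) : app f b j (M.obj.act h g x) = N.obj.act h g (app f a i x) := by
  have := DGNat.evalK_naturality f.1 (add_zero i) h h (add_zero j) g x
  rw [zero_mul, Int.negOnePow_zero, one_smul] at this
  exact this.symm

theorem app_δX (f : M ⟶ N) (a : A) (n m : ℤ) (h : n + 1 = m) (x : M.obj.X a n) :
    app f a m (M.obj.δX a n m x) = N.obj.δX a n m (app f a n x) := by
  have hf : d 0 1 (zero_add 1) (f.1.1 a) = 0 := congrFun (congrArg Subtype.val f.2) a
  have := d_evalK (zero_add 1) (f.1.1 a) h h (add_zero n) x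
  rw [hf, evalK_zero, Int.negOnePow_zero, one_smul, zero_add] at this
  exact this.symm

/-- A cochain of degree zero has components only from a degree to itself, so `app` loses no
information. -/
theorem hom_ext {f g : M ⟶ N} (h : ∀ a n x, app f a n x = app g a n x) : f = g := by
  refine Subtype.ext (Subtype.ext (funext fun a => evalK_ext fun p q hpq x => ?_))
  obtain rfl : p = q := by lia
  exact h a p x

theorem app_comp (f : M ⟶ N) (g : N ⟶ L) (a : A) (n : ℤ) (x : M.obj.X a n) :
    app (f ≫ g) a n x = app g a n (app f a n x) :=
  evalK_comp (zero_add 0) (f.1.1 a) (g.1.1 a) (add_zero n) (add_zero n) (add_zero n) x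

theorem app_congr {N' : Z0 K (DgMod K A)} {f : M ⟶ N} {g : N ⟶ L} {f' : M ⟶ N'} {g' : N' ⟶ L}
    (h : f ≫ g = f' ≫ g') (a : A) (n : ℤ) (x : M.obj.X a n) :
    app g a n (app f a n x) = app g' a n (app f' a n x) :=
  (app_comp f g a n x).symm.trans
    ((congrArg (fun k => app k a n x) h).trans (app_comp f' g' a n x))

theorem app_eq_zero {f : M ⟶ N} {g : N ⟶ L} (h : f ≫ g = 0) (a : A) (n : ℤ)
    (x : M.obj.X a n) : app g a n (app f a n x) = 0 :=
  (app_comp f g a n x).symm.trans (congrArg (fun k => app k a n x) h)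

theorem app_id (a : A) (n : ℤ) (x : M.obj.X a n) : app (𝟙 M) a n x = x :=
  evalK_id' (add_zero n) x

/-- A closed morphism of degree zero given by its components. -/
noncomputable def homMk (e : ∀ a n, M.obj.X a n →ₗ[K] N.obj.X a n)
    (hd : ∀ a n m, n + 1 = m → ∀ x, e a m (M.obj.δX a n m x) = N.obj.δX a n m (e a n x))
    (hact : ∀ (a b : A) (p i j : ℤ) (h : i + p = j) (g : DGCategory.Hom K a b p)
      (x : M.obj.X a i), e b j (M.obj.act h g x) = N.obj.act h g (e a i x)) : M ⟶ N :=
  -- A cochain of degree zero needs a component for all `p + 0 = q`. The action of the identity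
  -- moves degree `p` to degree `q` without a cast, and it is trivial when `q` is `p`.
  ⟨⟨fun a => cochainMk fun p q h => (N.obj.act (show p + 0 = q from h) (DGCategory.id a)).comp
      (e a p), by
    intro a b m f
    refine evalK_ext fun i j hj x => ?_
    obtain rfl : j = i + m := by lia
    rw [evalK_units_smul, zero_mul, Int.negOnePow_zero, one_smul,
      evalK_comp _ _ _ (add_zero i) rfl, evalK_comp _ _ _ rfl (add_zero (i + m)),
      evalK_cochainMk, evalK_cochainMk]
    simp only [LinearMap.comp_apply, DGFunctor.act_id]
    exact (hact _ _ _ _ _ rfl f x).symm⟩, by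
    refine Subtype.ext (funext fun a => evalK_ext fun i j hj x => ?_)
    refine (evalK_d (zero_add 1) _ hj hj (add_zero i) x).trans ?_
    rw [evalK_cochainMk, evalK_cochainMk]
    simp only [LinearMap.comp_apply, DGFunctor.act_id]
    -- In degree zero the differential of a cochain is the commutator with the differentials, which
    -- `hd` makes zero.
    rw [hd a i j hj, Int.negOnePow_one, Units.neg_smul, one_smul, add_neg_cancel]
    rfl⟩

theorem app_homMk (e : ∀ a n, M.obj.X a n →ₗ[K] N.obj.X a n)
    (hd : ∀ a n m, n + 1 = m → ∀ x, e a m (M.obj.δX a n m x) = N.obj.δX a n m (e a n x))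
    (hact : ∀ (a b : A) (p i j : ℤ) (h : i + p = j) (g : DGCategory.Hom K a b p)
      (x : M.obj.X a i), e b j (M.obj.act h g x) = N.obj.act h g (e a i x)) (a : A) (n : ℤ)
    (x : M.obj.X a n) : app (homMk e hd hact) a n x = e a n x := by
  rw [app_eq]
  exact DGFunctor.act_id _ _ _

end Z0
/-! ### Submodules and quotients of dg-modules -/

/-- A dg-submodule of a dg-module. -/
structure DGSubmodule {K : Type u} [CommRing K] {A : Type w} [DGCategory.{u, v} K A]
    (M : DgMod K A) where
  carrier (a : A) (n : ℤ) : Submodule K (M.X a n)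
  d_mem {a : A} (n m : ℤ) (h : n + 1 = m) {x : M.X a n} (hx : x ∈ carrier a n) :
    M.δX a n m x ∈ carrier a m
  act_mem {a b : A} {p i j : ℤ} (h : i + p = j) (f : DGCategory.Hom K a b p) {x : M.X a i}
    (hx : x ∈ carrier a i) : M.act h f x ∈ carrier b j

namespace DGSubmodule

variable {K : Type u} [CommRing K] {A : Type w} [DGCategory.{u, v} K A] {M : DgMod K A}
  (P : DGSubmodule M)

/-- The elements of a dg-submodule, as a dg-module. -/
noncomputable def subData : DGModuleData K A where
  X a n := P.carrier a n
  d n m h := (M.δX _ n m).restrict fun _ hx => P.d_mem n m h hx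
  act h := LinearMap.mk₂ K (fun f x => ⟨M.act h f x.1, P.act_mem h f x.2⟩)
    (fun f g x => Subtype.ext (LinearMap.congr_fun (map_add (M.act h) f g) x.1))
    (fun c f x => Subtype.ext (LinearMap.congr_fun (map_smul (M.act h) c f) x.1))
    (fun f x y => Subtype.ext (map_add (M.act h f) x.1 y.1))
    (fun c f x => Subtype.ext (map_smul (M.act h f) c x.1))
  d_d n m l _ _ x := Subtype.ext (M.δX_δX _ n m l x.1)
  act_id x := Subtype.ext (M.act_id _ x.1)
  act_comp h hi hj hk f g x := Subtype.ext (M.act_comp h hi hj hk f g x.1)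
  d_act hp hi hj h f x := Subtype.ext (M.δX_act hp hi hj h f x.1)

/-- The quotient by a dg-submodule. -/
noncomputable def quotData : DGModuleData K A where
  X a n := M.X a n ⧸ P.carrier a n
  d {a} n m h := (P.carrier a n).mapQ (P.carrier a m) (M.δX a n m) fun _ hx => P.d_mem n m h hx
  act {a b p i j} h := LinearMap.mk₂ K
    (fun f x => (P.carrier a i).mapQ (P.carrier b j) (M.act h f) (fun _ hx => P.act_mem h f hx) x)
    (fun f g x => by
      obtain ⟨x, rfl⟩ := Submodule.Quotient.mk_surjective _ x
      exact congrArg (P.carrier b j).mkQ (LinearMap.congr_fun (map_add (M.act h) f g) x))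
    (fun c f x => by
      obtain ⟨x, rfl⟩ := Submodule.Quotient.mk_surjective _ x
      exact congrArg (P.carrier b j).mkQ (LinearMap.congr_fun (map_smul (M.act h) c f) x))
    (fun f x y => map_add _ x y)
    (fun c f x => map_smul _ c x)
  d_d {a} n m l _ _ x := by
    obtain ⟨x, rfl⟩ := Submodule.Quotient.mk_surjective _ x
    exact congrArg (P.carrier a l).mkQ (M.δX_δX _ n m l x)
  act_id {a i} x := by
    obtain ⟨x, rfl⟩ := Submodule.Quotient.mk_surjective _ x
    exact congrArg (P.carrier a i).mkQ (M.act_id _ x)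
  act_comp {a b c p q n i j k} h hi hj hk f g x := by
    obtain ⟨x, rfl⟩ := Submodule.Quotient.mk_surjective _ x
    exact congrArg (P.carrier c k).mkQ (M.act_comp h hi hj hk f g x)
  d_act {a b p p' i i' j j'} hp hi hj h f x := by
    obtain ⟨x, rfl⟩ := Submodule.Quotient.mk_surjective _ x
    have := congrArg (P.carrier b j').mkQ (M.δX_act hp hi hj h f x)
    rw [map_add, map_units_smul] at this
    exact this

/-- The inclusion of a dg-submodule. -/
noncomputable def ι : Z0.of (K := K) P.subData.toDgMod ⟶ Z0.of M :=
  Z0.homMk (fun a n => (P.carrier a n).subtype)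
    (fun a n m h x => (congrArg Subtype.val (P.subData.toDgMod_δX a n m h x) :))
    (fun _ _ _ _ _ _ _ _ => rfl)

theorem app_ι (a : A) (n : ℤ) (x : P.carrier a n) : Z0.app P.ι a n x = x.1 :=
  Z0.app_homMk _ _ _ _ _ _

/-- The projection to the quotient by a dg-submodule. -/
noncomputable def π : Z0.of (K := K) M ⟶ Z0.of P.quotData.toDgMod :=
  Z0.homMk (fun a n => (P.carrier a n).mkQ)
    (fun a n m h x => (P.quotData.toDgMod_δX a n m h ((P.carrier a n).mkQ x)).symm)
    (fun _ _ _ _ _ _ _ _ => rfl)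

theorem app_π (a : A) (n : ℤ) (x : M.X a n) : Z0.app P.π a n x = (P.carrier a n).mkQ x :=
  Z0.app_homMk _ _ _ _ _ _

variable {T : Z0 K (DgMod K A)}

/-- The factorization through a dg-submodule of a morphism with values in it. -/
noncomputable def lift (g : T ⟶ Z0.of M) (hg : ∀ a n x, Z0.app g a n x ∈ P.carrier a n) :
    T ⟶ Z0.of P.subData.toDgMod :=
  Z0.homMk (fun a n => (Z0.app g a n).codRestrict (P.carrier a n) (hg a n))
    (fun a n m h x => (Subtype.ext (Z0.app_δX g a n m h x)).trans
      (P.subData.toDgMod_δX a n m h ⟨Z0.app g a n x, hg a n x⟩).symm)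
    (fun _ _ _ _ _ h f x => Subtype.ext (Z0.app_act g h f x))

theorem lift_ι (g : T ⟶ Z0.of M) (hg : ∀ a n x, Z0.app g a n x ∈ P.carrier a n) :
    P.lift g hg ≫ P.ι = g := Z0.hom_ext fun a n x =>
  (Z0.app_comp _ _ _ _ _).trans ((congrArg (Z0.app P.ι a n) (Z0.app_homMk _ _ _ _ _ _)).trans
    (P.app_ι a n ⟨_, hg a n x⟩))

theorem hom_ext_ι {f g : T ⟶ Z0.of P.subData.toDgMod} (h : f ≫ P.ι = g ≫ P.ι) : f = g :=
  Z0.hom_ext fun a n x =>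
    Subtype.ext ((P.app_ι _ _ _).symm.trans ((Z0.app_congr h a n x).trans (P.app_ι _ _ _)))

/-- The factorization through the quotient by a dg-submodule of a morphism that kills it. -/
noncomputable def desc (g : Z0.of M ⟶ T) (hg : ∀ a n, ∀ x ∈ P.carrier a n, Z0.app g a n x = 0) :
    Z0.of P.quotData.toDgMod ⟶ T :=
  Z0.homMk (fun a n => (P.carrier a n).liftQ (Z0.app g a n) (hg a n))
    (fun a n m h x => by
      obtain ⟨x, rfl⟩ := Submodule.Quotient.mk_surjective _ x
      refine Eq.trans ?_ (Z0.app_δX g a n m h x)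
      exact congrArg ((P.carrier a m).liftQ (Z0.app g a m) (hg a m))
        (P.quotData.toDgMod_δX a n m h ((P.carrier a n).mkQ x)))
    (fun _ _ _ _ _ h f x => by
      obtain ⟨x, rfl⟩ := Submodule.Quotient.mk_surjective _ x
      exact Z0.app_act g h f x)

theorem π_desc (g : Z0.of M ⟶ T) (hg : ∀ a n, ∀ x ∈ P.carrier a n, Z0.app g a n x = 0) :
    P.π ≫ P.desc g hg = g := Z0.hom_ext fun a n x =>
  (Z0.app_comp _ _ _ _ _).trans ((congrArg (Z0.app (P.desc g hg) a n) (P.app_π a n x)).trans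
    (Z0.app_homMk _ _ _ _ _ _))

theorem hom_ext_π {f g : Z0.of P.quotData.toDgMod ⟶ T} (h : P.π ≫ f = P.π ≫ g) : f = g :=
  Z0.hom_ext fun a n x => by
    obtain ⟨x, rfl⟩ := Submodule.Quotient.mk_surjective _ x
    have e := P.app_π a n x
    exact (congrArg (Z0.app f a n) e).symm.trans
      ((Z0.app_congr h a n x).trans (congrArg (Z0.app g a n) e))

end DGSubmodule

/-! ### Categories of dg-modules are abelian -/

namespace Z0

variable {K : Type u} [CommRing K] {A : Type w} [DGCategory.{u, v} K A] {M N : Z0 K (DgMod K A)}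

/-- The kernel of a closed morphism of degree zero. -/
noncomputable def ker (f : M ⟶ N) : DGSubmodule M.obj where
  carrier a n := LinearMap.ker (app f a n)
  d_mem n m h x hx := by
    rw [LinearMap.mem_ker] at hx ⊢
    rw [app_δX f _ n m h, hx, map_zero]
  act_mem h g x hx := by
    rw [LinearMap.mem_ker] at hx ⊢
    rw [app_act f h, hx, map_zero]

/-- The range of a closed morphism of degree zero. -/
noncomputable def range (f : M ⟶ N) : DGSubmodule N.obj where
  carrier a n := LinearMap.range (app f a n)
  d_mem n m h := by
    rintro _ ⟨x, rfl⟩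
    exact ⟨_, app_δX f _ n m h x⟩
  act_mem h g := by
    rintro _ ⟨x, rfl⟩
    exact ⟨_, app_act f h g x⟩

theorem ι_ker_comp (f : M ⟶ N) : (ker f).ι ≫ f = 0 := hom_ext fun a n x =>
  (app_comp _ _ _ _ _).trans ((congrArg (app f a n) ((ker f).app_ι a n x)).trans x.2)

theorem comp_π_range (f : M ⟶ N) : f ≫ (range f).π = 0 := hom_ext fun a n x =>
  (app_comp _ _ _ _ _).trans <| ((range f).app_π a n _).trans
    ((Submodule.Quotient.mk_eq_zero _).2 ⟨x, rfl⟩)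

instance : HasKernels (Z0 K (DgMod K A)) where
  has_limit f := ⟨⟨⟨KernelFork.ofι _ (ι_ker_comp f), KernelFork.IsLimit.ofι _ _
    (fun g hg => (ker f).lift g fun a n x =>
      app_eq_zero hg a n x)
    (fun g _ => (ker f).lift_ι g _)
    (fun g _ _ hm => (ker f).hom_ext_ι (hm.trans ((ker f).lift_ι g _).symm))⟩⟩⟩

instance : HasCokernels (Z0 K (DgMod K A)) where
  has_colimit f := ⟨⟨⟨CokernelCofork.ofπ _ (comp_π_range f), CokernelCofork.IsColimit.ofπ _ _
    (fun g hg => (range f).desc g fun a n x hx => by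
      obtain ⟨x, rfl⟩ := hx
      exact app_eq_zero hg a n x)
    (fun g _ => (range f).π_desc g _)
    (fun g _ _ hm => (range f).hom_ext_π (hm.trans ((range f).π_desc g _).symm))⟩⟩⟩

/-- A mono cancels from its zero composite with the inclusion of the kernel, so this inclusion is
zero; evaluated at an element of the kernel, it says that the element is zero. -/
theorem injective_of_mono (f : M ⟶ N) [Mono f] (a : A) (n : ℤ) :
    Function.Injective (app f a n) := by
  rw [← LinearMap.ker_eq_bot, LinearMap.ker_eq_bot']
  intro x hx
  have h0 : (ker f).ι = 0 := zero_of_comp_mono f (ι_ker_comp f)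
  exact ((ker f).app_ι a n ⟨x, hx⟩).symm.trans (congrArg (fun k => app k a n _) h0)

/-- Dually, the projection to the quotient by the range is zero, so every element lies in the range.
-/
theorem surjective_of_epi (f : M ⟶ N) [Epi f] (a : A) (n : ℤ) :
    Function.Surjective (app f a n) := by
  intro y
  have h0 : (range f).π = 0 := zero_of_epi_comp f (comp_π_range f)
  have := ((range f).app_π a n y).symm.trans (congrArg (fun k => app k a n y) h0)
  exact (Submodule.Quotient.mk_eq_zero _).1 this

/-- A morphism `g` with values in the range of an injective `f` factors through `f`. -/
noncomputable def liftInjective {T : Z0 K (DgMod K A)} (f : M ⟶ N)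
    (hf : ∀ a n, Function.Injective (app f a n)) (g : T ⟶ N)
    (hg : ∀ a n x, app g a n x ∈ LinearMap.range (app f a n)) : T ⟶ M :=
  homMk (fun a n => (LinearEquiv.ofInjective _ (hf a n)).symm.toLinearMap ∘ₗ
      (app g a n).codRestrict _ (hg a n))
    -- Preimages are compared after applying the injective `f`, where both sides become values of
    -- `g`.
    (fun a n m h x => hf a m (by
      rw [app_δX f a n m h]
      have e (k : ℤ) (y : LinearMap.range (app f a k)) :
        app f a k ((LinearEquiv.ofInjective _ (hf a k)).symm y) = y.1 :=
          congrArg Subtype.val ((LinearEquiv.ofInjective _ (hf a k)).apply_symm_apply y)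
      exact (e m _).trans ((app_δX g a n m h x).trans (congrArg _ (e n ⟨_, hg a n x⟩).symm))))
    (fun a b p i j h u x => hf b j (by
      rw [app_act f h]
      have e (c : A) (k : ℤ) (y : LinearMap.range (app f c k)) :
        app f c k ((LinearEquiv.ofInjective _ (hf c k)).symm y) = y.1 :=
          congrArg Subtype.val ((LinearEquiv.ofInjective _ (hf c k)).apply_symm_apply y)
      exact (e b j _).trans ((app_act g h u x).trans (congrArg _ (e a i ⟨_, hg a i x⟩).symm))))

theorem liftInjective_comp {T : Z0 K (DgMod K A)} (f : M ⟶ N)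
    (hf : ∀ a n, Function.Injective (app f a n)) (g : T ⟶ N)
    (hg : ∀ a n x, app g a n x ∈ LinearMap.range (app f a n)) :
    liftInjective f hf g hg ≫ f = g := hom_ext fun _ _ _ =>
  (app_comp _ _ _ _ _).trans <| (congrArg (app f _ _) (app_homMk _ _ _ _ _ _)).trans <|
    congrArg Subtype.val ((LinearEquiv.ofInjective _ (hf _ _)).apply_symm_apply _)

/-- A morphism `g` that kills the kernel of a surjective `f` factors through `f`. -/
noncomputable def descSurjective {T : Z0 K (DgMod K A)} (f : M ⟶ N)
    (hf : ∀ a n, Function.Surjective (app f a n)) (g : M ⟶ T)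
    (hg : ∀ a n, LinearMap.ker (app f a n) ≤ LinearMap.ker (app g a n)) : N ⟶ T :=
  have e (a : A) (n : ℤ) (x : M.obj.X a n) :
      (LinearMap.ker (app f a n)).liftQ (app g a n) (hg a n)
        (((app f a n).quotKerEquivOfSurjective (hf a n)).symm
          (app f a n x)) = app g a n x := by
    have : ((app f a n).quotKerEquivOfSurjective (hf a n)).symm
        (app f a n x) = Submodule.Quotient.mk x := by
      rw [LinearEquiv.symm_apply_eq]; rfl
    rw [this]; rfl
  homMk (fun a n => (LinearMap.ker (app f a n)).liftQ (app g a n) (hg a n) ∘ₗ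
      ((app f a n).quotKerEquivOfSurjective (hf a n)).symm.toLinearMap)
    (fun a n m h x => by
      obtain ⟨x, rfl⟩ := hf a n x
      rw [← app_δX f a n m h]
      exact (e a m _).trans ((app_δX g a n m h x).trans (congrArg _ (e a n x).symm)))
    (fun a b p i j h u x => by
      obtain ⟨x, rfl⟩ := hf a i x
      rw [← app_act f h]
      exact (e b j _).trans ((app_act g h u x).trans (congrArg _ (e a i x).symm)))

theorem comp_descSurjective {T : Z0 K (DgMod K A)} (f : M ⟶ N)
    (hf : ∀ a n, Function.Surjective (app f a n)) (g : M ⟶ T)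
    (hg : ∀ a n, LinearMap.ker (app f a n) ≤ LinearMap.ker (app g a n)) :
    f ≫ descSurjective f hf g hg = g := hom_ext fun a n x => by
  rw [app_comp, descSurjective, app_homMk]
  have : ((app f a n).quotKerEquivOfSurjective (hf a n)).symm
      (app f a n x) = Submodule.Quotient.mk x := by
    rw [LinearEquiv.symm_apply_eq]; rfl
  rw [LinearMap.comp_apply]
  exact (congrArg _ this).trans rfl

/-- A mono is the kernel of the projection modulo its range: a morphism killed by this projection
takes values in the range, where the injective `f` can be inverted. -/
instance : IsNormalMonoCategory (Z0 K (DgMod K A)) where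
  normalMonoOfMono f _ := ⟨{
    Z := _
    g := (range f).π
    w := comp_π_range f
    isLimit := KernelFork.IsLimit.ofι _ _
      (fun g hg => liftInjective f (injective_of_mono f) g fun a n x =>
        (Submodule.Quotient.mk_eq_zero _).1
          (((range f).app_π a n _).symm.trans (app_eq_zero hg a n x)))
      (fun _ _ => liftInjective_comp _ _ _ _)
      (fun g _ _ hm => by rw [← cancel_mono f, hm, liftInjective_comp]) }⟩

/-- An epi is the cokernel of the inclusion of its kernel, since a morphism that vanishes on the
kernel descends along a surjection. -/
instance : IsNormalEpiCategory (Z0 K (DgMod K A)) where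
  normalEpiOfEpi f _ := ⟨{
    W := _
    g := (ker f).ι
    w := ι_ker_comp f
    isColimit := CokernelCofork.IsColimit.ofπ _ _
      (fun g hg => descSurjective f (surjective_of_epi f) g fun a n x hx =>
        (congrArg (app g a n) ((ker f).app_ι a n ⟨x, hx⟩).symm).trans
          (app_eq_zero hg a n (show (ker f).carrier a n from ⟨x, hx⟩)))
      (fun _ _ => comp_descSurjective _ _ _ _)
      (fun _ _ _ hm => (cancel_epi f).1 (hm.trans (comp_descSurjective _ _ _ _).symm)) }⟩

/-- The product of a family of dg-modules. -/
noncomputable def piData {ι : Type} (M : ι → Z0 K (DgMod K A)) : DGModuleData K A where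
  X a n := ∀ i, (M i).obj.X a n
  d n m _ := LinearMap.pi fun i => (M i).obj.δX _ n m ∘ₗ LinearMap.proj i
  act h := LinearMap.mk₂ K (fun f x i => (M i).obj.act h f (x i))
    (fun f g x => funext fun i => LinearMap.congr_fun (map_add ((M i).obj.act h) f g) (x i))
    (fun c f x => funext fun i => LinearMap.congr_fun (map_smul ((M i).obj.act h) c f) (x i))
    (fun f x y => funext fun i => map_add ((M i).obj.act h f) (x i) (y i))
    (fun c f x => funext fun i => map_smul ((M i).obj.act h f) c (x i))
  d_d n m l _ _ x := funext fun i => (M i).obj.δX_δX _ n m l (x i)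
  act_id x := funext fun i => (M i).obj.act_id _ (x i)
  act_comp h hi hj hk f g x := funext fun i => (M i).obj.act_comp h hi hj hk f g (x i)
  d_act hp hi hj h f x := funext fun i => (M i).obj.δX_act hp hi hj h f (x i)

/-- The projections of the product of a family of dg-modules. -/
noncomputable def piProj {ι : Type} (M : ι → Z0 K (DgMod K A)) (i : ι) :
    Z0.of (K := K) (piData M).toDgMod ⟶ M i :=
  homMk (fun a n => (LinearMap.proj i : (∀ i, (M i).obj.X a n) →ₗ[K] _))
    (fun a n m h x => (congrFun ((piData M).toDgMod_δX a n m h x) i :))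
    (fun _ _ _ _ _ _ _ _ => rfl)

theorem app_piProj {ι : Type} (M : ι → Z0 K (DgMod K A)) (i : ι) (a : A) (n : ℤ)
    (x : ∀ i, (M i).obj.X a n) : app (piProj M i) a n x = x i := app_homMk _ _ _ _ _ _

/-- The morphism to a product given by its components. -/
noncomputable def piLift {ι : Type} (M : ι → Z0 K (DgMod K A)) {T : Z0 K (DgMod K A)}
    (f : ∀ i, T ⟶ M i) : T ⟶ Z0.of (piData M).toDgMod :=
  homMk (fun a n => LinearMap.pi fun i => app (f i) a n)
    (fun a n m h x => (funext fun i => app_δX (f i) a n m h x).trans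
      ((piData M).toDgMod_δX a n m h fun i => app (f i) a n x).symm)
    (fun _ _ _ _ _ h u x => funext fun i => app_act (f i) h u x)

theorem piLift_piProj {ι : Type} (M : ι → Z0 K (DgMod K A)) {T : Z0 K (DgMod K A)}
    (f : ∀ i, T ⟶ M i) (i : ι) : piLift M f ≫ piProj M i = f i := hom_ext fun a n x =>
  (app_comp _ _ _ _ _).trans <| (congrArg (app (piProj M i) a n) (app_homMk _ _ _ _ _ _)).trans <|
    app_piProj M i a n fun i => app (f i) a n x

theorem hom_ext_piProj {ι : Type} (M : ι → Z0 K (DgMod K A)) {T : Z0 K (DgMod K A)}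
    {f g : T ⟶ Z0.of (piData M).toDgMod} (h : ∀ i, f ≫ piProj M i = g ≫ piProj M i) : f = g :=
  hom_ext fun a n x => funext fun i =>
    (app_piProj M i a n _).symm.trans ((app_congr (h i) a n x).trans (app_piProj M i a n _))

instance : HasFiniteProducts (Z0 K (DgMod K A)) where
  out k :=
    have (f : Fin k → Z0 K (DgMod K A)) : HasProduct f :=
      ⟨⟨⟨Fan.mk _ (piProj f), Fan.IsLimit.mk _ (fun s => piLift f s.proj)
        (fun s i => piLift_piProj f s.proj i)
        (fun s _ hm => hom_ext_piProj f fun i => (hm i).trans (piLift_piProj f s.proj i).symm)⟩⟩⟩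
    { has_limit := fun _ => hasLimit_of_iso Discrete.natIsoFunctor.symm }

/-- The category of dg-modules and closed morphisms of degree zero is abelian. -/
noncomputable instance abelianDgMod : Abelian (Z0 K (DgMod K A)) where

end Z0
/-! ### Universal arrows and dg-adjunctions -/

section UniversalArrow

variable {K : Type u} [CommRing K] {𝓒 : Type w} [DGCategory.{u, v} K 𝓒] {𝓓 : Type w'}
  [DGCategory.{u, v'} K 𝓓]

/-- The map `θ ↦ R θ ∘ φ`. -/
def postcompMap (R : DGFunctor K 𝓓 𝓒) {G : 𝓒} {S : 𝓓} (φ : DGCategory.Hom K G (R.obj S) 0)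
    (T : 𝓓)
    (n : ℤ) : DGCategory.Hom K S T n →ₗ[K] DGCategory.Hom K G (R.obj T) n :=
  DGCategory.comp (zero_add n) φ ∘ₗ R.map

/-- The map `θ ↦ ψ ∘ R θ`. -/
def precompMap (R : DGFunctor K 𝓓 𝓒) {G : 𝓒} {S : 𝓓} (ψ : DGCategory.Hom K (R.obj S) G 0)
    (T : 𝓓)
    (n : ℤ) : DGCategory.Hom K T S n →ₗ[K] DGCategory.Hom K (R.obj T) G n :=
  (DGCategory.comp (add_zero n)).flip ψ ∘ₗ R.map

theorem postcompMap_apply (R : DGFunctor K 𝓓 𝓒) {G : 𝓒} {S : 𝓓}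
    (φ : DGCategory.Hom K G (R.obj S) 0) (T : 𝓓) (n : ℤ) (θ : DGCategory.Hom K S T n) :
    postcompMap R φ T n θ = DGCategory.comp (zero_add n) φ (R.map θ) := rfl

theorem precompMap_apply (R : DGFunctor K 𝓓 𝓒) {G : 𝓒} {S : 𝓓}
    (ψ : DGCategory.Hom K (R.obj S) G 0) (T : 𝓓) (n : ℤ) (θ : DGCategory.Hom K T S n) :
    precompMap R ψ T n θ = DGCategory.comp (add_zero n) (R.map θ) ψ := rfl

/-- The closed morphism `φ : G → R S` is universal from `G` to the dg-functor `R`. -/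
structure IsUniversalFrom (R : DGFunctor K 𝓓 𝓒) {G : 𝓒} {S : 𝓓}
    (φ : DGCategory.Hom K G (R.obj S) 0) : Prop where
  closed : d 0 1 (zero_add 1) φ = 0
  bijective (T : 𝓓) (n : ℤ) : Function.Bijective (postcompMap R φ T n)

/-- The closed morphism `ψ : R S → G` is universal from the dg-functor `R` to `G`. -/
structure IsUniversalTo (R : DGFunctor K 𝓓 𝓒) {G : 𝓒} {S : 𝓓}
    (ψ : DGCategory.Hom K (R.obj S) G 0) : Prop where
  closed : d 0 1 (zero_add 1) ψ = 0
  bijective (T : 𝓓) (n : ℤ) : Function.Bijective (precompMap R ψ T n)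

variable {R : DGFunctor K 𝓓 𝓒}

/-- Naturality of the universal bijection in the target. It reduces functoriality of the adjoint to
associativity. -/
theorem postcompMap_comp {G : 𝓒} {S T U : 𝓓} (φ : DGCategory.Hom K G (R.obj S) 0) {p q n : ℤ}
    (h : p + q = n) (θ : DGCategory.Hom K S T p) (κ : DGCategory.Hom K T U q) :
    postcompMap R φ U n (DGCategory.comp h θ κ) =
      DGCategory.comp h (postcompMap R φ T p θ) (R.map κ) := by
  rw [postcompMap_apply, postcompMap_apply, R.map_comp,
    DGCategory.assoc (zero_add p) h (by lia)]

theorem precompMap_comp {G : 𝓒} {S T U : 𝓓} (ψ : DGCategory.Hom K (R.obj S) G 0) {p q n : ℤ}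
    (h : p + q = n) (θ : DGCategory.Hom K U T p) (κ : DGCategory.Hom K T S q) :
    precompMap R ψ U n (DGCategory.comp h θ κ) =
      DGCategory.comp h (R.map θ) (precompMap R ψ T q κ) := by
  rw [precompMap_apply, precompMap_apply, R.map_comp,
    DGCategory.assoc h (add_zero q) (by lia)]

theorem postcompMap_id {G : 𝓒} {S : 𝓓} (φ : DGCategory.Hom K G (R.obj S) 0) :
    postcompMap R φ S 0 (DGCategory.id S) = φ := by
  rw [postcompMap_apply, R.map_id, DGCategory.comp_id]

theorem precompMap_id {G : 𝓒} {S : 𝓓} (ψ : DGCategory.Hom K (R.obj S) G 0) :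
    precompMap R ψ S 0 (DGCategory.id S) = ψ := by
  rw [precompMap_apply, R.map_id, DGCategory.id_comp]

namespace IsUniversalFrom

/-- Since `φ` is closed and `R` commutes with differentials, `θ ↦ R θ ∘ φ` is a map of complexes. -/
theorem d_postcompMap {G : 𝓒} {S : 𝓓} {φ : DGCategory.Hom K G (R.obj S) 0}
    (hφ : IsUniversalFrom R φ) {T : 𝓓} {n m : ℤ} (h : n + 1 = m) (θ : DGCategory.Hom K S T n) :
    d n m h (postcompMap R φ T n θ) = postcompMap R φ T m (d n m h θ) := by
  rw [postcompMap_apply, postcompMap_apply,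
    d_comp (zero_add n) 1 m m (zero_add 1) h h, hφ.closed, R.map_d]
  simp

/-- Bijectivity in degree zero does not suffice here: it is injectivity in degree one that detects
whether `d θ` vanishes. -/
theorem closed_iff {G : 𝓒} {S : 𝓓} {φ : DGCategory.Hom K G (R.obj S) 0}
    (hφ : IsUniversalFrom R φ) {T : 𝓓} (θ : DGCategory.Hom K S T 0) :
    d 0 1 (zero_add 1) (postcompMap R φ T 0 θ) = 0 ↔ d 0 1 (zero_add 1) θ = 0 := by
  rw [hφ.d_postcompMap]
  exact map_eq_zero_iff (postcompMap R φ T 1) (hφ.bijective T 1).1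

variable {S : 𝓒 → 𝓓} {φ : ∀ G, DGCategory.Hom K G (R.obj (S G)) 0}
  (hφ : ∀ G, IsUniversalFrom R (φ G))

/-- Composition with a universal arrow, as a linear equivalence. -/
noncomputable def equiv (G : 𝓒) (T : 𝓓) (n : ℤ) :
    DGCategory.Hom K (S G) T n ≃ₗ[K] DGCategory.Hom K G (R.obj T) n :=
  LinearEquiv.ofBijective (postcompMap R (φ G) T n) ((hφ G).bijective T n)

/-- The left dg-adjoint given by universal arrows. -/
noncomputable def leftAdjoint : DGFunctor K 𝓒 𝓓 where
  obj := S
  -- The value at `f` is the unique morphism `θ` with `R θ ∘ φ G = φ G' ∘ f`; every axiom below is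
  -- checked after composition with `φ`.
  map {G G' n} := (equiv hφ G (S G') n).symm.toLinearMap ∘ₗ
    (DGCategory.comp (add_zero n)).flip (φ G')
  map_id G := by
    refine (equiv hφ G (S G) 0).symm_apply_eq.2 ?_
    exact (DGCategory.id_comp _).trans (postcompMap_id (φ G)).symm
  map_comp {G G' G'' p q n} h f g := by
    have e {G G' : 𝓒} {n : ℤ} (f : DGCategory.Hom K G G' n) :
        postcompMap R (φ G) (S G') n ((equiv hφ G (S G') n).symm
          (DGCategory.comp (add_zero n) f (φ G'))) = DGCategory.comp (add_zero n) f (φ G') :=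
      (equiv hφ G (S G') n).apply_symm_apply _
    refine (equiv hφ G (S G'') n).symm_apply_eq.2 ?_
    refine Eq.trans ?_ (postcompMap_comp (φ G) h _ _).symm
    simp only [LinearMap.comp_apply, LinearMap.flip_apply, LinearEquiv.coe_coe]
    rw [e f, DGCategory.assoc (add_zero p) (zero_add q) (by lia), ← postcompMap_apply, e g,
      DGCategory.assoc h (add_zero q) (by lia)]
  map_d {G G'} n m h f := by
    refine (equiv hφ G (S G') m).symm_apply_eq.2 ?_
    refine Eq.trans ?_ ((hφ G).d_postcompMap h _)
    have e : postcompMap R (φ G) (S G') n ((equiv hφ G (S G') n).symm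
          (DGCategory.comp (add_zero n) f (φ G'))) = DGCategory.comp (add_zero n) f (φ G') :=
      (equiv hφ G (S G') n).apply_symm_apply _
    simp only [LinearMap.comp_apply, LinearMap.flip_apply, LinearEquiv.coe_coe]
    rw [e, d_comp (add_zero n) m 1 m h (zero_add 1) h, (hφ G').closed, Int.negOnePow_zero,
      one_smul, map_zero, zero_add]

theorem comp_leftAdjoint_map {G G' : 𝓒} {n : ℤ} (f : DGCategory.Hom K G G' n) :
    DGCategory.comp (zero_add n) (φ G) (R.map ((leftAdjoint hφ).map f)) =
      DGCategory.comp (add_zero n) f (φ G') :=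
  (equiv hφ G (S G') n).apply_symm_apply _

/-- A dg-functor that is natural with respect to universal arrows is a left adjoint. -/
theorem exists_adjunction {L : DGFunctor K 𝓒 𝓓} {φ : ∀ G, DGCategory.Hom K G (R.obj (L.obj G)) 0}
    (hφ : ∀ G, IsUniversalFrom R (φ G))
    (hL : ∀ (G G' : 𝓒) (η : DGCategory.Hom K G G' 0),
      DGCategory.comp (zero_add 0) (φ G) (R.map (L.map η)) =
        DGCategory.comp (add_zero 0) η (φ G')) :
    ∃ adj : L.underlying ⊣ R.underlying, ∀ G, (adj.unit.app G).1 = φ G.obj := by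
  -- The bijection of degree zero restricts to closed morphisms, that is, to the morphisms of the
  -- underlying categories.
  let e (X : Z0 K 𝓒) (Y : Z0 K 𝓓) :
      (L.underlying.obj X ⟶ Y) ≃ (X ⟶ R.underlying.obj Y) :=
    Equiv.ofBijective
      (fun θ => ⟨postcompMap R (φ X.obj) Y.obj 0 θ.1, ((hφ X.obj).closed_iff θ.1).2 θ.2⟩)
      ⟨fun θ θ' h => Subtype.ext (((hφ X.obj).bijective Y.obj 0).1 (congrArg Subtype.val h)),
        fun σ => by
          obtain ⟨θ, hθ⟩ := ((hφ X.obj).bijective Y.obj 0).2 σ.1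
          exact ⟨⟨θ, ((hφ X.obj).closed_iff θ).1 ((congrArg _ hθ).trans σ.2)⟩, Subtype.ext hθ⟩⟩
  have he (X : Z0 K 𝓒) (Y : Z0 K 𝓓) (θ : L.underlying.obj X ⟶ Y) :
    (e X Y θ).1 = postcompMap R (φ X.obj) Y.obj 0 θ.1 := rfl
  refine ⟨Adjunction.mkOfHomEquiv
    { homEquiv := e
      homEquiv_naturality_left_symm := fun {X' X Y} f g => ?_
      homEquiv_naturality_right := fun {X Y Y'} f g =>
        Subtype.ext (postcompMap_comp (φ X.obj) (zero_add 0) f.1 g.1) }, fun G => ?_⟩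
  · rw [Equiv.symm_apply_eq]
    refine Subtype.ext ?_
    have h1 : postcompMap R (φ X.obj) Y.obj 0 ((e X Y).symm g).1 = g.1 :=
      congrArg Subtype.val ((e X Y).apply_symm_apply g)
    refine Eq.trans ?_ (postcompMap_comp (φ X'.obj) (zero_add 0) (L.map f.1) _).symm
    -- Naturality in the source is the point where the values of `L` on morphisms matter: `hL` moves
    -- `φ` past `f`.
    refine Eq.trans ?_ (congrArg (fun k => DGCategory.comp (zero_add 0) k
      (R.map ((e X Y).symm g).1)) (hL _ _ f.1)).symm
    refine Eq.trans ?_ (DGCategory.assoc (add_zero 0) (zero_add 0) (by lia) _ _ _).symm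
    exact (congrArg (DGCategory.comp (zero_add 0) f.1) h1).symm
  · rw [Adjunction.mkOfHomEquiv_unit_app]
    exact postcompMap_id (φ G.obj)

end IsUniversalFrom

namespace IsUniversalTo

theorem d_precompMap {G : 𝓒} {S : 𝓓} {ψ : DGCategory.Hom K (R.obj S) G 0}
    (hψ : IsUniversalTo R ψ) {T : 𝓓} {n m : ℤ} (h : n + 1 = m) (θ : DGCategory.Hom K T S n) :
    d n m h (precompMap R ψ T n θ) = precompMap R ψ T m (d n m h θ) := by
  rw [precompMap_apply, precompMap_apply,
    d_comp (add_zero n) m 1 m h (zero_add 1) h, hψ.closed, R.map_d]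
  simp

theorem closed_iff {G : 𝓒} {S : 𝓓} {ψ : DGCategory.Hom K (R.obj S) G 0}
    (hψ : IsUniversalTo R ψ) {T : 𝓓} (θ : DGCategory.Hom K T S 0) :
    d 0 1 (zero_add 1) (precompMap R ψ T 0 θ) = 0 ↔ d 0 1 (zero_add 1) θ = 0 := by
  rw [hψ.d_precompMap]
  exact map_eq_zero_iff (precompMap R ψ T 1) (hψ.bijective T 1).1

variable {S : 𝓒 → 𝓓} {ψ : ∀ G, DGCategory.Hom K (R.obj (S G)) G 0}
  (hψ : ∀ G, IsUniversalTo R (ψ G))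

/-- Composition with a universal arrow, as a linear equivalence. -/
noncomputable def equiv (G : 𝓒) (T : 𝓓) (n : ℤ) :
    DGCategory.Hom K T (S G) n ≃ₗ[K] DGCategory.Hom K (R.obj T) G n :=
  LinearEquiv.ofBijective (precompMap R (ψ G) T n) ((hψ G).bijective T n)

/-- The right dg-adjoint given by universal arrows. -/
noncomputable def rightAdjoint : DGFunctor K 𝓒 𝓓 where
  obj := S
  map {G G' n} := (equiv hψ G' (S G) n).symm.toLinearMap ∘ₗ
    DGCategory.comp (zero_add n) (ψ G)
  map_id G := by
    refine (equiv hψ G (S G) 0).symm_apply_eq.2 ?_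
    exact (DGCategory.comp_id _).trans (precompMap_id (ψ G)).symm
  map_comp {G G' G'' p q n} h f g := by
    have e {G G' : 𝓒} {n : ℤ} (f : DGCategory.Hom K G G' n) :
        precompMap R (ψ G') (S G) n ((equiv hψ G' (S G) n).symm
          (DGCategory.comp (zero_add n) (ψ G) f)) = DGCategory.comp (zero_add n) (ψ G) f :=
      (equiv hψ G' (S G) n).apply_symm_apply _
    refine (equiv hψ G'' (S G) n).symm_apply_eq.2 ?_
    refine Eq.trans ?_ (precompMap_comp (ψ G'') h _ _).symm
    simp only [LinearMap.comp_apply, LinearEquiv.coe_coe]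
    rw [e g, ← DGCategory.assoc (add_zero p) (zero_add q) (by lia), ← precompMap_apply, e f,
      DGCategory.assoc (zero_add p) h (by lia)]
  map_d {G G'} n m h f := by
    refine (equiv hψ G' (S G) m).symm_apply_eq.2 ?_
    refine Eq.trans ?_ ((hψ G').d_precompMap h _)
    have e : precompMap R (ψ G') (S G) n ((equiv hψ G' (S G) n).symm
          (DGCategory.comp (zero_add n) (ψ G) f)) = DGCategory.comp (zero_add n) (ψ G) f :=
      (equiv hψ G' (S G) n).apply_symm_apply _
    simp only [LinearMap.comp_apply, LinearEquiv.coe_coe]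
    rw [e, d_comp (zero_add n) 1 m m (zero_add 1) h h, (hψ G).closed, map_zero,
      LinearMap.zero_apply, smul_zero, add_zero]

theorem rightAdjoint_map_comp {G G' : 𝓒} {n : ℤ} (f : DGCategory.Hom K G G' n) :
    DGCategory.comp (add_zero n) (R.map ((rightAdjoint hψ).map f)) (ψ G') =
      DGCategory.comp (zero_add n) (ψ G) f :=
  (equiv hψ G' (S G) n).apply_symm_apply _

/-- A dg-functor that is natural with respect to universal arrows is a right adjoint. -/
theorem nonempty_adjunction {L : DGFunctor K 𝓒 𝓓}
    {ψ : ∀ G, DGCategory.Hom K (R.obj (L.obj G)) G 0} (hψ : ∀ G, IsUniversalTo R (ψ G))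
    (hL : ∀ (G G' : 𝓒) (η : DGCategory.Hom K G G' 0),
      DGCategory.comp (add_zero 0) (R.map (L.map η)) (ψ G') =
        DGCategory.comp (zero_add 0) (ψ G) η) :
    Nonempty (R.underlying ⊣ L.underlying) := by
  let e (X : Z0 K 𝓓) (Y : Z0 K 𝓒) :
      (X ⟶ L.underlying.obj Y) ≃ (R.underlying.obj X ⟶ Y) :=
    Equiv.ofBijective
      (fun θ => ⟨precompMap R (ψ Y.obj) X.obj 0 θ.1, ((hψ Y.obj).closed_iff θ.1).2 θ.2⟩)
      ⟨fun θ θ' h => Subtype.ext (((hψ Y.obj).bijective X.obj 0).1 (congrArg Subtype.val h)),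
        fun σ => by
          obtain ⟨θ, hθ⟩ := ((hψ Y.obj).bijective X.obj 0).2 σ.1
          exact ⟨⟨θ, ((hψ Y.obj).closed_iff θ).1 ((congrArg _ hθ).trans σ.2)⟩, Subtype.ext hθ⟩⟩
  -- The adjunction asks for the bijection from morphisms out of `R X` to morphisms into `L Y`, the
  -- inverse of composition with `ψ`. Accordingly `hL` now enters through naturality in the target.
  refine ⟨Adjunction.mkOfHomEquiv
    { homEquiv := fun X Y => (e X Y).symm
      homEquiv_naturality_left_symm := fun {X' X Y} f g =>
        Subtype.ext (precompMap_comp (ψ Y.obj) (zero_add 0) f.1 g.1)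
      homEquiv_naturality_right := fun {X Y Y'} f g => ?_ }⟩
  rw [Equiv.symm_apply_eq]
  refine Subtype.ext ?_
  have h1 : precompMap R (ψ Y.obj) X.obj 0 ((e X Y).symm f).1 = f.1 :=
    congrArg Subtype.val ((e X Y).apply_symm_apply f)
  refine Eq.trans ?_ (precompMap_comp (ψ Y'.obj) (zero_add 0) _ (L.map g.1)).symm
  refine Eq.trans ?_ (congrArg (DGCategory.comp (zero_add 0) (R.map ((e X Y).symm f).1))
    (hL _ _ g.1)).symm
  refine Eq.trans ?_ (DGCategory.assoc (add_zero 0) (zero_add 0) (by lia) _ _ _)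
  exact (congrArg (fun k => DGCategory.comp (zero_add 0) k g.1) h1).symm

end IsUniversalTo

end UniversalArrow

/-! ### The universal property of Kan extensions -/

theorem negOnePow_add_add_self (a b : ℤ) : (a + (b + a)).negOnePow = b.negOnePow := by
  rw [add_left_comm, Int.negOnePow_add, Int.negOnePow_even (a + a) ⟨a, rfl⟩, mul_one]

section KanExtension

variable {K : Type u} [CommRing K] {A : Type w} [DGCategory.{u, u} K A]
    {C : Type w'} [DGCategory.{u, u} K C] {B : Type w''} [DGCategory.{u, u} K B]

/-- The components of a dg-natural transformation `G → T ∘ F`. -/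
def DGNat.toComp {F : DGFunctor K A C} {G : DGFunctor K A B} {T : DGFunctor K C B} {n : ℤ}
    (σ : DGNat G (F.comp T) n) (a : A) : DGCategory.Hom K (G.obj a) (T.obj (F.obj a)) n := σ.1 a

/-- The components of a dg-natural transformation `T ∘ F → G`. -/
def DGNat.ofComp {F : DGFunctor K A C} {G : DGFunctor K A B} {T : DGFunctor K C B} {n : ℤ}
    (σ : DGNat (F.comp T) G n) (a : A) : DGCategory.Hom K (T.obj (F.obj a)) (G.obj a) n := σ.1 a

theorem DGNat.toComp_naturality {F : DGFunctor K A C} {G : DGFunctor K A B} {T : DGFunctor K C B}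
    {n : ℤ} (σ : DGNat G (F.comp T) n) {a a' : A} {m l : ℤ} (x : DGCategory.Hom K a a' m)
    (h : n + m = l) : DGCategory.comp h (DGNat.toComp σ a) (T.map (F.map x)) =
      (n * m).negOnePow • DGCategory.comp (show m + n = l by lia) (G.map x) (DGNat.toComp σ a') :=
  DGNat.naturality σ x h

theorem DGNat.ofComp_naturality {F : DGFunctor K A C} {G : DGFunctor K A B} {T : DGFunctor K C B}
    {n : ℤ} (σ : DGNat (F.comp T) G n) {a a' : A} {m l : ℤ} (x : DGCategory.Hom K a a' m)
    (h : n + m = l) : DGCategory.comp h (DGNat.ofComp σ a) (G.map x) =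
      (n * m).negOnePow •
        DGCategory.comp (show m + n = l by lia) (T.map (F.map x)) (DGNat.ofComp σ a') :=
  DGNat.naturality σ x h

/-- A dg-natural transformation `Hom(F -, c) → Hom(G -, b)` given by its components. -/
noncomputable def contraNatMk (F : DGFunctor K A C) (G : DGFunctor K A B) (c : C) (b : B) (n : ℤ)
    (e : ∀ (a : A) (p q : ℤ), p + n = q →
      (DGCategory.Hom K (F.obj a) c p →ₗ[K] DGCategory.Hom K (G.obj a) b q))
    (he : ∀ (a a' : A) (m p q p' q' : ℤ) (h : p + n = q) (h' : p' + n = q') (hp : m + p = p')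
      (x : DGCategory.Hom K a' a m) (f : DGCategory.Hom K (F.obj a) c p),
      e a' p' q' h' (DGCategory.comp hp (F.map x) f) =
        DGCategory.comp (show m + q = q' by lia) (G.map x) (e a p q h f)) :
    DGNat (F.op.comp (DGFunctor.rep K (Opposite.op c)))
      (G.op.comp (DGFunctor.rep K (Opposite.op b))) n :=
  ⟨fun a => cochainMk (M := homComplex K (Opposite.op c) (F.op.obj a))
    (N := homComplex K (Opposite.op b) (G.op.obj a)) fun p q h => e a.unop p q h, by
    intro X Y m x
    refine evalK_ext fun i k hk f => ?_
    -- The two compositions in opposite categories carry the exponents `(i + n) m` and `i m`. Their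
    -- difference `n m` is the sign of naturality in degree `n`, which is why `he` has no sign.
    have key (f : DGCategory.Hom K (F.obj X.unop) c i) :
        opComp (X := b) (Y := G.obj X.unop) (Z := G.obj Y.unop)
          (show i + n + m = k by lia) (e X.unop i (i + n) rfl f) (G.map x) =
        (n * m).negOnePow • e Y.unop (i + m) k (by lia) (opComp (X := c) (Y := F.obj X.unop)
          (Z := F.obj Y.unop) rfl f (F.map x)) := by
      rw [opComp_apply, opComp_apply, map_units_smul (K := K), smul_smul, ← Int.negOnePow_add,
        he X.unop Y.unop m i (i + n) (i + m) k rfl (by lia) (by lia), add_mul, add_comm (n * m)]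
    refine (evalK_comp _ _ _ (rfl : i + n = i + n) (by lia) hk f).trans ((key f).trans ?_)
    refine Eq.symm ((evalK_units_smul _ _ hk f).trans (congrArg _ ?_))
    exact evalK_comp _ _ _ (rfl : i + m = i + m) (by lia) hk f⟩

namespace IsLeftKanExtension

variable {F : DGFunctor K A C} {G : DGFunctor K A B} {S : DGFunctor K C B}
  {φ : DGNat G (F.comp S) 0}

/-- The zero transformation is represented by zero, and by nothing else. Hence the morphisms `S f ∘
φ` into `S c` are jointly epimorphic. -/
theorem eq_zero (hφ : IsLeftKanExtension F G S φ) {c : C} {b : B} {n : ℤ}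
    (β : DGCategory.Hom K (S.obj c) b n)
    (h : ∀ (a : A) (p q : ℤ) (h : p + n = q) (f : DGCategory.Hom K (F.obj a) c p),
      DGCategory.comp h (DGCategory.comp (zero_add p) (DGNat.toComp φ a) (S.map f)) β = 0) : β = 0 :=
  (hφ.existsUnique c b n 0).unique (fun a p q hpq f => (h a p q hpq f).symm)
    (fun a p q hpq f => by rw [map_zero]; rfl)

theorem hom_ext (hφ : IsLeftKanExtension F G S φ) {c : C} {b : B} {n : ℤ}
    {β β' : DGCategory.Hom K (S.obj c) b n}
    (h : ∀ (a : A) (p q : ℤ) (h : p + n = q) (f : DGCategory.Hom K (F.obj a) c p),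
      DGCategory.comp h (DGCategory.comp (zero_add p) (DGNat.toComp φ a) (S.map f)) β =
        DGCategory.comp h (DGCategory.comp (zero_add p) (DGNat.toComp φ a) (S.map f)) β') : β = β' :=
  sub_eq_zero.1 (hφ.eq_zero _ fun a p q hpq f => by rw [map_sub, h, sub_self])

theorem φ_naturality {a a' : A} {m : ℤ} (x : DGCategory.Hom K a a' m) :
    DGCategory.comp (zero_add m) (DGNat.toComp φ a) (S.map (F.map x)) =
      DGCategory.comp (add_zero m) (G.map x) (DGNat.toComp φ a') := by
  have := DGNat.toComp_naturality φ x (zero_add m)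
  rwa [zero_mul, Int.negOnePow_zero, one_smul] at this

/-- A transformation `θ` extending `σ` must satisfy `θ ∘ S f ∘ φ = ± T f ∘ σ` by naturality. The
right-hand side, with its Koszul sign, is natural in `a`, so the pointwise universal property
supplies the component of `θ` at `c`. -/
theorem exists_component (hφ : IsLeftKanExtension F G S φ) (T : DGFunctor K C B) {n : ℤ}
    (σ : DGNat G (F.comp T) n) (c : C) :
    ∃ β : DGCategory.Hom K (S.obj c) (T.obj c) n, ∀ (a : A) (p q : ℤ) (h : p + n = q)
      (f : DGCategory.Hom K (F.obj a) c p),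
        DGCategory.comp h (DGCategory.comp (zero_add p) (DGNat.toComp φ a) (S.map f)) β =
          (n * p).negOnePow • DGCategory.comp (show n + p = q by lia) (DGNat.toComp σ a) (T.map f) := by
  let e (a : A) (p q : ℤ) (h : p + n = q) :
      DGCategory.Hom K (F.obj a) c p →ₗ[K] DGCategory.Hom K (G.obj a) (T.obj c) q :=
    (((n * p).negOnePow : ℤ) : K) •
      (DGCategory.comp (show n + p = q by lia) (DGNat.toComp σ a) ∘ₗ T.map)
  have he_apply (a : A) (p q : ℤ) (h : p + n = q) (f : DGCategory.Hom K (F.obj a) c p) :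
      e a p q h f = (n * p).negOnePow •
        DGCategory.comp (show n + p = q by lia) (DGNat.toComp σ a) (T.map f) :=
    (units_smul_eq (K := K) _ _).symm
  have he (a a' : A) (m p q p' q' : ℤ) (h : p + n = q) (h' : p' + n = q') (hp : m + p = p')
      (x : DGCategory.Hom K a' a m) (f : DGCategory.Hom K (F.obj a) c p) :
      e a' p' q' h' (DGCategory.comp hp (F.map x) f) =
        DGCategory.comp (show m + q = q' by lia) (G.map x) (e a p q h f) := by
    rw [he_apply a' p' q' h', he_apply a p q h, map_units_smul (K := K)]
    have hσ := DGNat.toComp_naturality σ x (rfl : n + m = n + m)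
    have e' : DGCategory.comp (show n + p' = q' by lia) (DGNat.toComp σ a')
        (T.map (DGCategory.comp hp (F.map x) f)) = (n * m).negOnePow •
          DGCategory.comp (show m + q = q' by lia) (G.map x)
            (DGCategory.comp (show n + p = q by lia) (DGNat.toComp σ a) (T.map f)) := by
      rw [T.map_comp, ← DGCategory.assoc (rfl : n + m = n + m) hp (by lia)]
      refine (congrArg (fun k => DGCategory.comp (show n + m + p = q' by lia) k (T.map f))
        hσ).trans ?_
      rw [units_smul_map (K := K),
        DGCategory.assoc (show m + n = n + m by lia) (show n + p = q by lia) (by lia)]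
    -- With `p' = m + p`, the exponent `n m` that comes from moving `x` past `σ` occurs twice and
    -- cancels.
    have hs : (n * p' + n * m).negOnePow = (n * p).negOnePow := by
      rw [← hp, mul_add, add_comm, add_comm (n * m) (n * p), negOnePow_add_add_self]
    rw [e', smul_smul, ← Int.negOnePow_add, hs]
  obtain ⟨β, hβ, -⟩ := hφ.existsUnique c (T.obj c) n (contraNatMk F G c (T.obj c) n e he)
  exact ⟨β, fun a p q h f => (hβ a p q h f).symm.trans (he_apply a p q h f)⟩

/-- The pointwise property implies the global one. For injectivity, naturality expresses `θ ∘ S f ∘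
φ` through `θ ∘ φ`, and the morphisms `S f ∘ φ` are jointly epimorphic. For surjectivity, the
components chosen separately at each object are automatically natural, again tested on `S f ∘ φ`,
and `f = id` recovers `σ`. -/
theorem isUniversalFrom (hφ : IsLeftKanExtension F G S φ) :
    IsUniversalFrom (F.restrict B) (G := G) (S := S) φ where
  closed := hφ.closed
  bijective T n := by
    constructor
    · intro θ θ' h
      refine Subtype.ext (funext fun c => hφ.hom_ext fun a p q hpq f => ?_)
      have h1 (θ : DGNat S T n) :
          DGCategory.comp hpq (DGCategory.comp (zero_add p) (DGNat.toComp φ a) (S.map f)) (θ.1 c) =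
            (n * p).negOnePow • DGCategory.comp (show n + p = q by lia)
              (DGCategory.comp (zero_add n) (DGNat.toComp φ a) (θ.1 (F.obj a))) (T.map f) := by
        rw [DGCategory.assoc (zero_add p) hpq (by lia),
          DGCategory.assoc (zero_add n) (show n + p = q by lia) (show 0 + n + p = q by lia),
          DGNat.naturality θ f (show n + p = q by lia), map_units_smul (K := K), smul_smul,
          ← Int.negOnePow_add, Int.negOnePow_even (n * p + n * p) ⟨_, rfl⟩, one_smul]
      refine (h1 θ).trans (Eq.trans ?_ (h1 θ').symm)
      have h2 : DGCategory.comp (zero_add n) (DGNat.toComp φ a) (θ.1 (F.obj a)) =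
        DGCategory.comp (zero_add n) (DGNat.toComp φ a) (θ'.1 (F.obj a)) :=
          congrFun (congrArg Subtype.val h) a
      rw [h2]
    · intro (σ : DGNat G (F.comp T) n)
      choose β hβ using hφ.exists_component T σ
      refine ⟨⟨β, fun c c' m g => hφ.hom_ext fun a p q hpq f => ?_⟩,
        Subtype.ext (funext fun a => ?_)⟩
      -- Tested on `f`, both sides become `T (g ∘ f) ∘ σ` up to sign: one by `hβ` for `f`, the other
      -- by `hβ` for `g ∘ f`.
      · rw [← DGCategory.assoc (rfl : p + n = p + n) rfl (show p + n + m = q by lia), hβ,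
          units_smul_map (K := K),
          map_units_smul (K := K), ← DGCategory.assoc (rfl : p + m = p + m) (by lia) (by lia),
          DGCategory.assoc (zero_add p) rfl (by lia), ← S.map_comp, hβ,
          DGCategory.assoc (show n + p = p + n by lia) (rfl : p + m = p + m) (by lia),
          ← T.map_comp, smul_smul, ← Int.negOnePow_add, mul_add, negOnePow_add_add_self]
      · have := hβ (F.obj a) a 0 n (zero_add n) (DGCategory.id (F.obj a))
        rw [S.map_id, DGCategory.comp_id, T.map_id, DGCategory.comp_id, mul_zero,
          Int.negOnePow_zero, one_smul] at this
        exact this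

end IsLeftKanExtension

/-- A dg-natural transformation `Hom(c, F -) → Hom(b, G -)` given by its components. -/
noncomputable def coNatMk (F : DGFunctor K A C) (G : DGFunctor K A B) (c : C) (b : B) (n : ℤ)
    (e : ∀ (a : A) (p q : ℤ), p + n = q →
      (DGCategory.Hom K c (F.obj a) p →ₗ[K] DGCategory.Hom K b (G.obj a) q))
    (he : ∀ (a a' : A) (m p q p' q' : ℤ) (h : p + n = q) (h' : p' + n = q') (hp : p + m = p')
      (x : DGCategory.Hom K a a' m) (f : DGCategory.Hom K c (F.obj a) p),
      e a' p' q' h' (DGCategory.comp hp f (F.map x)) = (n * m).negOnePow •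
        DGCategory.comp (show q + m = q' by lia) (e a p q h f) (G.map x)) :
    DGNat (F.comp (DGFunctor.rep K c)) (G.comp (DGFunctor.rep K b)) n :=
  ⟨fun a => cochainMk (M := homComplex K c (F.obj a)) (N := homComplex K b (G.obj a))
      fun p q h => e a p q h, by
    intro X Y m x
    refine evalK_ext fun i k hk f => ?_
    have key (f : DGCategory.Hom K c (F.obj X) i) :
        DGCategory.comp (show i + n + m = k by lia) (e X i (i + n) rfl f) (G.map x) =
        (n * m).negOnePow • e Y (i + m) k (by lia) (DGCategory.comp rfl f (F.map x)) := by
      rw [he X Y m i (i + n) (i + m) k rfl (by lia) rfl, smul_smul, ← Int.negOnePow_add,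
        Int.negOnePow_even (n * m + n * m) ⟨_, rfl⟩, one_smul]
    refine (evalK_comp _ _ _ (rfl : i + n = i + n) (by lia) hk f).trans ((key f).trans ?_)
    refine Eq.symm ((evalK_units_smul _ _ hk f).trans (congrArg _ ?_))
    exact evalK_comp _ _ _ (rfl : i + m = i + m) (by lia) hk f⟩

namespace IsRightKanExtension

variable {F : DGFunctor K A C} {G : DGFunctor K A B} {T : DGFunctor K C B}
  {ψ : DGNat (F.comp T) G 0}

/-- Uniqueness of the morphism representing zero shows that the morphisms `ψ ∘ T f` out of `T c` are
jointly monomorphic. -/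
theorem hom_ext (hψ : IsRightKanExtension F G T ψ) {c : C} {b : B} {n : ℤ}
    {β β' : DGCategory.Hom K b (T.obj c) n}
    (h : ∀ (a : A) (p q : ℤ) (h : n + p = q) (f : DGCategory.Hom K c (F.obj a) p),
      DGCategory.comp h β (DGCategory.comp (add_zero p) (T.map f) (DGNat.ofComp ψ a)) =
        DGCategory.comp h β' (DGCategory.comp (add_zero p) (T.map f) (DGNat.ofComp ψ a))) :
    β = β' := by
  refine sub_eq_zero.1 ((hψ.existsUnique c b n 0).unique (fun a p q hpq f => ?_)
    (fun a p q hpq f => ?_))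
  · have : DGCategory.comp (show n + p = q by lia) (β - β')
        (DGCategory.comp (add_zero p) (T.map f) (DGNat.ofComp ψ a)) = 0 := by
      rw [map_sub, LinearMap.sub_apply, h, sub_self]
    exact ((congrArg _ this).trans (smul_zero _)).symm
  · rw [map_zero, LinearMap.zero_apply, smul_zero]
    rfl

/-- The family `f ↦ σ ∘ S f` is graded natural without a correcting sign; the sign `(-1)^(n p)` sits
in the definition of a right Kan extension instead. -/
theorem exists_component (hψ : IsRightKanExtension F G T ψ) (S : DGFunctor K C B) {n : ℤ}
    (σ : DGNat (F.comp S) G n) (c : C) :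
    ∃ β : DGCategory.Hom K (S.obj c) (T.obj c) n, ∀ (a : A) (p q : ℤ) (h : n + p = q)
      (f : DGCategory.Hom K c (F.obj a) p),
        DGCategory.comp h β (DGCategory.comp (add_zero p) (T.map f) (DGNat.ofComp ψ a)) =
          (n * p).negOnePow •
            DGCategory.comp (show p + n = q by lia) (S.map f) (DGNat.ofComp σ a) := by
  let e (a : A) (p q : ℤ) (h : p + n = q) :
      DGCategory.Hom K c (F.obj a) p →ₗ[K] DGCategory.Hom K (S.obj c) (G.obj a) q :=
    (DGCategory.comp h).flip (DGNat.ofComp σ a) ∘ₗ S.map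
  have he_apply (a : A) (p q : ℤ) (h : p + n = q) (f : DGCategory.Hom K c (F.obj a) p) :
      e a p q h f = DGCategory.comp h (S.map f) (DGNat.ofComp σ a) := rfl
  have he (a a' : A) (m p q p' q' : ℤ) (h : p + n = q) (h' : p' + n = q') (hp : p + m = p')
      (x : DGCategory.Hom K a a' m) (f : DGCategory.Hom K c (F.obj a) p) :
      e a' p' q' h' (DGCategory.comp hp f (F.map x)) = (n * m).negOnePow •
        DGCategory.comp (show q + m = q' by lia) (e a p q h f) (G.map x) := by
    rw [he_apply a' p' q' h', he_apply a p q h, S.map_comp,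
      DGCategory.assoc hp (show m + n = n + m by lia) (by lia),
      DGCategory.assoc h rfl (by lia), DGNat.ofComp_naturality σ x rfl,
      map_units_smul (K := K), smul_smul, ← Int.negOnePow_add,
      Int.negOnePow_even (n * m + n * m) ⟨_, rfl⟩, one_smul]
  obtain ⟨β, hβ, -⟩ := hψ.existsUnique c (S.obj c) n (coNatMk F G c (S.obj c) n e he)
  refine ⟨β, fun a p q h f => ?_⟩
  have := (he_apply a p q (by lia) f).symm.trans (hβ a p q (by lia) f)
  rw [this, smul_smul, ← Int.negOnePow_add, Int.negOnePow_even (n * p + n * p) ⟨_, rfl⟩, one_smul]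
  rfl

/-- The argument for left Kan extensions with arrows reversed: everything is tested after
composition with `ψ ∘ T f`. -/
theorem isUniversalTo (hψ : IsRightKanExtension F G T ψ) :
    IsUniversalTo (F.restrict B) (G := G) (S := T) ψ where
  closed := hψ.closed
  bijective S n := by
    constructor
    · intro θ θ' h
      refine Subtype.ext (funext fun c => hψ.hom_ext fun a p q hpq f => ?_)
      have h1 (θ : DGNat S T n) :
          DGCategory.comp hpq (θ.1 c)
              (DGCategory.comp (add_zero p) (T.map f) (DGNat.ofComp ψ a)) =
            (n * p).negOnePow • DGCategory.comp (show p + n = q by lia) (S.map f)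
              (DGCategory.comp (add_zero n) (θ.1 (F.obj a)) (DGNat.ofComp ψ a)) := by
        rw [← DGCategory.assoc hpq (add_zero p) (by lia), DGNat.naturality θ f hpq,
          units_smul_map (K := K), DGCategory.assoc _ (add_zero n) (show p + n + 0 = q by lia)]
      refine (h1 θ).trans (Eq.trans ?_ (h1 θ').symm)
      have h2 : DGCategory.comp (add_zero n) (θ.1 (F.obj a)) (DGNat.ofComp ψ a) =
        DGCategory.comp (add_zero n) (θ'.1 (F.obj a)) (DGNat.ofComp ψ a) :=
          congrFun (congrArg Subtype.val h) a
      rw [h2]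
    · intro (σ : DGNat (F.comp S) G n)
      choose β hβ using hψ.exists_component S σ
      refine ⟨⟨β, fun c c' m g => hψ.hom_ext fun a p q hpq f => ?_⟩,
        Subtype.ext (funext fun a => ?_)⟩
      · rw [DGCategory.assoc (rfl : n + m = n + m) (rfl : m + p = m + p) (by lia),
          ← DGCategory.assoc (rfl : m + p = m + p) (add_zero p) (by lia), ← T.map_comp, hβ,
          units_smul_map (K := K), DGCategory.assoc _ (rfl : n + p = n + p) (by lia), hβ,
          S.map_comp, DGCategory.assoc rfl (show p + n = n + p by lia) (by lia),
          map_units_smul (K := K), smul_smul, ← Int.negOnePow_add, mul_add]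
      · have := hβ (F.obj a) a 0 n (add_zero n) (DGCategory.id (F.obj a))
        rw [S.map_id, DGCategory.id_comp, T.map_id, DGCategory.id_comp, mul_zero,
          Int.negOnePow_zero, one_smul] at this
        exact this

end IsRightKanExtension

end KanExtension
/-! ### Existence of left Kan extensions of dg-modules -/

namespace LeftKan

variable {K : Type u} [CommRing K] {A : Type u} [DGCategory.{u, u} K A]
  {C : Type w} [DGCategory.{u, u} K C] (F : DGFunctor K A C) (G : DgMod K A)

/-- The generators `f ⊗ x` of degree `n` of the coend `∫ᵃ Hom(F a, c) ⊗ G a`. -/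
structure Gen (c : C) (n : ℤ) : Type u where
  a : A
  p : ℤ
  i : ℤ
  h : i + p = n
  f : DGCategory.Hom K (F.obj a) c p
  x : G.X a i

/-- The relations between the generators of the coend `∫ᵃ Hom(F a, c) ⊗ G a`. -/
inductive Rel (c : C) (n : ℤ) : (Gen F G c n →₀ K) → Prop
  | add_left (a : A) (p i : ℤ) (h : i + p = n) (f f' : DGCategory.Hom K (F.obj a) c p)
      (x : G.X a i) : Rel c n (Finsupp.single ⟨a, p, i, h, f + f', x⟩ 1 -
        (Finsupp.single ⟨a, p, i, h, f, x⟩ 1 + Finsupp.single ⟨a, p, i, h, f', x⟩ 1))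
  | smul_left (a : A) (p i : ℤ) (h : i + p = n) (k : K) (f : DGCategory.Hom K (F.obj a) c p)
      (x : G.X a i) : Rel c n (Finsupp.single ⟨a, p, i, h, k • f, x⟩ 1 -
        k • Finsupp.single ⟨a, p, i, h, f, x⟩ 1)
  | add_right (a : A) (p i : ℤ) (h : i + p = n) (f : DGCategory.Hom K (F.obj a) c p)
      (x x' : G.X a i) : Rel c n (Finsupp.single ⟨a, p, i, h, f, x + x'⟩ 1 -
        (Finsupp.single ⟨a, p, i, h, f, x⟩ 1 + Finsupp.single ⟨a, p, i, h, f, x'⟩ 1))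
  | smul_right (a : A) (p i : ℤ) (h : i + p = n) (k : K) (f : DGCategory.Hom K (F.obj a) c p)
      (x : G.X a i) : Rel c n (Finsupp.single ⟨a, p, i, h, f, k • x⟩ 1 -
        k • Finsupp.single ⟨a, p, i, h, f, x⟩ 1)
  | balanced (a a' : A) (m p p' i j : ℤ) (hp : m + p = p') (hi : i + m = j) (h : i + p' = n)
      (h' : j + p = n) (t : DGCategory.Hom K a a' m) (f : DGCategory.Hom K (F.obj a') c p)
      (x : G.X a i) : Rel c n (Finsupp.single ⟨a, p', i, h, DGCategory.comp hp (F.map t) f, x⟩ 1 -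
        Finsupp.single ⟨a', p, j, h', f, G.act hi t x⟩ 1)

/-- The component of degree `n` of the coend `∫ᵃ Hom(F a, c) ⊗ G a`. -/
abbrev Coend (c : C) (n : ℤ) : Type u :=
  (Gen F G c n →₀ K) ⧸ Submodule.span K {z | Rel F G c n z}

variable {F G} {c : C} {n : ℤ}

theorem mk_eq_mk {z z' : Gen F G c n →₀ K} (h : Rel F G c n (z - z')) :
    (Submodule.Quotient.mk z : Coend F G c n) = Submodule.Quotient.mk z' :=
  (Submodule.Quotient.eq _).2 (Submodule.subset_span h)

variable (F G) in
/-- The element `f ⊗ x` of the coend. -/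
noncomputable def tmul {a : A} {p i : ℤ} (h : i + p = n) :
    DGCategory.Hom K (F.obj a) c p →ₗ[K] G.X a i →ₗ[K] Coend F G c n :=
  LinearMap.mk₂ K (fun f x => Submodule.Quotient.mk (Finsupp.single ⟨a, p, i, h, f, x⟩ 1))
    (fun f f' x => mk_eq_mk (Rel.add_left a p i h f f' x))
    (fun k f x => mk_eq_mk (Rel.smul_left a p i h k f x))
    (fun f x x' => mk_eq_mk (Rel.add_right a p i h f x x'))
    (fun k f x => mk_eq_mk (Rel.smul_right a p i h k f x))

theorem tmul_balanced {a a' : A} {m p p' i j : ℤ} (hp : m + p = p') (hi : i + m = j)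
    (h : i + p' = n) (h' : j + p = n) (t : DGCategory.Hom K a a' m)
    (f : DGCategory.Hom K (F.obj a') c p) (x : G.X a i) :
    tmul F G h (DGCategory.comp hp (F.map t) f) x = tmul F G h' f (G.act hi t x) :=
  mk_eq_mk (Rel.balanced a a' m p p' i j hp hi h h' t f x)

/-- A scalar can be absorbed into `x`, so the elements `f ⊗ x` generate the coend additively. -/
theorem Coend.induction {P : Coend F G c n → Prop} (zero : P 0)
    (add : ∀ z z', P z → P z' → P (z + z'))
    (tmul : ∀ (a : A) (p i : ℤ) (h : i + p = n) (f : DGCategory.Hom K (F.obj a) c p)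
      (x : G.X a i), P (tmul F G h f x)) (z : Coend F G c n) : P z := by
  obtain ⟨z, rfl⟩ := Submodule.Quotient.mk_surjective _ z
  induction z using Finsupp.induction_linear with
  | zero => exact zero
  | add z z' hz hz' => exact add _ _ hz hz'
  | single g k =>
    have e : (Finsupp.single g k : Gen F G c n →₀ K) = k • Finsupp.single g 1 := by
      rw [Finsupp.smul_single, smul_eq_mul, mul_one]
    rw [e]
    have := tmul g.a g.p g.i g.h g.f (k • g.x)
    rwa [map_smul] at this

theorem Coend.hom_ext {N : Type v} [AddCommGroup N] [Module K N] {α β : Coend F G c n →ₗ[K] N}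
    (H : ∀ (a : A) (p i : ℤ) (h : i + p = n) (f : DGCategory.Hom K (F.obj a) c p) (x : G.X a i),
      α (tmul F G h f x) = β (tmul F G h f x)) : α = β :=
  LinearMap.ext fun z => Coend.induction (P := fun z => α z = β z) (by rw [map_zero, map_zero])
    (fun z z' hz hz' => by rw [map_add, map_add, hz, hz']) H z

/-- A linear map out of the coend given by a balanced family of bilinear maps. -/
noncomputable def Coend.lift {N : Type v} [AddCommGroup N] [Module K N]
    (e : ∀ (a : A) (p i : ℤ), i + p = n →
      (DGCategory.Hom K (F.obj a) c p →ₗ[K] G.X a i →ₗ[K] N))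
    (he : ∀ (a a' : A) (m p p' i j : ℤ) (hp : m + p = p') (hi : i + m = j) (h : i + p' = n)
      (h' : j + p = n) (t : DGCategory.Hom K a a' m) (f : DGCategory.Hom K (F.obj a') c p)
      (x : G.X a i),
      e a p' i h (DGCategory.comp hp (F.map t) f) x = e a' p j h' f (G.act hi t x)) :
    Coend F G c n →ₗ[K] N :=
  Submodule.liftQ _ (Finsupp.linearCombination K fun g : Gen F G c n => e g.a g.p g.i g.h g.f g.x)
    (Submodule.span_le.2 fun z hz => by
      rw [SetLike.mem_coe, LinearMap.mem_ker]
      cases hz with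
      | add_left a p i h f f' x => simp
      | smul_left a p i h k f x => simp
      | add_right a p i h f x x' => simp
      | smul_right a p i h k f x => simp
      | balanced a a' m p p' i j hp hi h h' t f x => simp [he a a' m p p' i j hp hi h h' t f x])

theorem Coend.lift_tmul {N : Type v} [AddCommGroup N] [Module K N]
    (e : ∀ (a : A) (p i : ℤ), i + p = n →
      (DGCategory.Hom K (F.obj a) c p →ₗ[K] G.X a i →ₗ[K] N))
    (he : ∀ (a a' : A) (m p p' i j : ℤ) (hp : m + p = p') (hi : i + m = j) (h : i + p' = n)
      (h' : j + p = n) (t : DGCategory.Hom K a a' m) (f : DGCategory.Hom K (F.obj a') c p)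
      (x : G.X a i),
      e a p' i h (DGCategory.comp hp (F.map t) f) x = e a' p j h' f (G.act hi t x))
    {a : A} {p i : ℤ} (h : i + p = n) (f : DGCategory.Hom K (F.obj a) c p) (x : G.X a i) :
    Coend.lift e he (tmul F G h f x) = e a p i h f x := by
  refine (Finsupp.linearCombination_single K 1 _).trans ?_
  rw [one_smul]

variable (F G c) in
/-- The differential of the coend. -/
noncomputable def Coend.d (n m : ℤ) (hn : n + 1 = m) : Coend F G c n →ₗ[K] Coend F G c m :=
  -- An element `f ⊗ x` behaves like `x` followed by `f`, hence the sign `(-1)^p` in front of `f ⊗ d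
  -- x`.
  Coend.lift (fun a p i h => tmul F G (show i + (p + 1) = m by lia) ∘ₗ DGCategory.d p (p + 1) rfl +
      ((p.negOnePow : ℤ) : K) •
        (tmul F G (show i + 1 + p = m by lia)).compl₂ (G.δX a i (i + 1)))
    (by
      -- By the Leibniz rules for `f ∘ F t` and for `t x`, both sides expand into `d f ⊗ t x`, `f ⊗
      -- (d t) x` and `f ⊗ t (d x)` with the same signs.
      intro a a' k p p' i j hp hi h h' t f x
      have hs : p'.negOnePow = (p + k).negOnePow := by rw [← hp, add_comm]
      simp only [LinearMap.add_apply, LinearMap.smul_apply, LinearMap.comp_apply,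
        LinearMap.compl₂_apply, hs, ← units_smul_eq (K := K)]
      rw [DGCategory.d_comp hp (k + 1) (p + 1) (p' + 1) rfl rfl rfl, map_add, LinearMap.add_apply,
        units_smul_map (K := K), ← F.map_d,
        tmul_balanced _ hi _ (show j + (p + 1) = m by lia),
        tmul_balanced _ (show i + (k + 1) = j + 1 by lia) _ (show j + 1 + p = m by lia),
        tmul_balanced _ (show i + 1 + k = j + 1 by lia) _ (show j + 1 + p = m by lia),
        G.δX_act rfl rfl rfl, map_add, smul_add, add_assoc, map_units_smul (K := K), smul_smul,
        ← Int.negOnePow_add])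

theorem Coend.d_tmul {m : ℤ} (hn : n + 1 = m) {a : A} {p p' i i' : ℤ} (h : i + p = n)
    (hp : p + 1 = p') (hi : i + 1 = i') (f : DGCategory.Hom K (F.obj a) c p) (x : G.X a i) :
    Coend.d F G c n m hn (tmul F G h f x) =
      tmul F G (show i + p' = m by lia) (DGCategory.d p p' hp f) x +
        p.negOnePow • tmul F G (show i' + p = m by lia) f (G.δX a i i' x) := by
  subst hp hi
  rw [Coend.d, Coend.lift_tmul, LinearMap.add_apply, LinearMap.smul_apply, LinearMap.add_apply,
    LinearMap.smul_apply, ← units_smul_eq (K := K)]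
  rfl

/-- Composition with a morphism `g : c → c'` as a map of coends. -/
noncomputable def Coend.map {c' : C} {q m : ℤ} (h : n + q = m) (g : DGCategory.Hom K c c' q) :
    Coend F G c n →ₗ[K] Coend F G c' m :=
  Coend.lift (fun a p i hi =>
      tmul F G (show i + (p + q) = m by lia) ∘ₗ (DGCategory.comp rfl).flip g) (by
    intro a a' k p p' i j hp hi h h' t f x
    simp only [LinearMap.comp_apply, LinearMap.flip_apply]
    rw [DGCategory.assoc hp (rfl : p + q = p + q) (by lia), tmul_balanced _ hi])

theorem Coend.map_tmul {c' : C} {q m : ℤ} (h : n + q = m) (g : DGCategory.Hom K c c' q) {a : A}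
    {p i r : ℤ} (hi : i + p = n) (hr : p + q = r) (f : DGCategory.Hom K (F.obj a) c p)
    (x : G.X a i) : Coend.map h g (tmul F G hi f x) =
      tmul F G (show i + r = m by lia) (DGCategory.comp hr f g) x := by
  subst hr
  exact Coend.lift_tmul _ _ _ _ _

theorem Coend.map_id (z : Coend F G c n) : Coend.map (add_zero n) (DGCategory.id c) z = z := by
  induction z using Coend.induction with
  | zero => rw [LinearMap.map_zero]
  | add z z' hz hz' => rw [LinearMap.map_add, hz, hz']
  | tmul a p i hi f x => rw [Coend.map_tmul _ _ hi (add_zero p) f x, DGCategory.comp_id]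

theorem Coend.map_comp {c' c'' : C} {p q r j k : ℤ} (h : p + q = r) (hi : n + p = j)
    (hj : j + q = k) (hk : n + r = k) (g : DGCategory.Hom K c c' p) (g' : DGCategory.Hom K c' c'' q)
    (z : Coend F G c n) :
    Coend.map hk (DGCategory.comp h g g') z = Coend.map hj g' (Coend.map hi g z) := by
  induction z using Coend.induction with
  | zero => rw [LinearMap.map_zero, LinearMap.map_zero, LinearMap.map_zero]
  | add z z' hz hz' => rw [LinearMap.map_add, hz, hz', LinearMap.map_add, LinearMap.map_add]
  | tmul a s t hs f x =>
    rw [Coend.map_tmul _ _ hs rfl, Coend.map_tmul _ _ hs rfl,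
      Coend.map_tmul hj g' _ (show s + p + q = s + r by lia), DGCategory.assoc rfl h (by lia)]

/-- The mixed term `d f ⊗ d x` occurs twice, with the opposite signs `(-1)^(p+1)` and `(-1)^p`. -/
theorem Coend.d_d {m l : ℤ} (h : n + 1 = m) (h' : m + 1 = l) (z : Coend F G c n) :
    Coend.d F G c m l h' (Coend.d F G c n m h z) = 0 := by
  induction z using Coend.induction with
  | zero => rw [LinearMap.map_zero, LinearMap.map_zero]
  | add z z' hz hz' => rw [LinearMap.map_add, LinearMap.map_add, hz, hz', add_zero]
  | tmul a p i hi f x =>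
    rw [Coend.d_tmul h hi rfl rfl, LinearMap.map_add, map_units_smul (K := K),
      Coend.d_tmul h' _ rfl rfl, Coend.d_tmul h' _ rfl rfl, DGCategory.d_d, G.δX_δX,
      LinearMap.map_zero, LinearMap.map_zero, LinearMap.zero_apply, smul_zero, add_zero, zero_add,
      Int.negOnePow_succ, Units.neg_smul, neg_add_cancel]

/-- On a generator `f ⊗ x` this is the Leibniz rule for `g ∘ f` in `C`. -/
theorem Coend.d_map {c' : C} {p p' i' j j' : ℤ} (hp : p + 1 = p') (hi : n + 1 = i')
    (hj : j + 1 = j') (h : n + p = j) (g : DGCategory.Hom K c c' p) (z : Coend F G c n) :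
    Coend.d F G c' j j' hj (Coend.map h g z) =
      Coend.map (show n + p' = j' by lia) (DGCategory.d p p' hp g) z +
        p.negOnePow • Coend.map (show i' + p = j' by lia) g (Coend.d F G c n i' hi z) := by
  induction z using Coend.induction with
  | zero => simp only [LinearMap.map_zero, smul_zero, add_zero]
  | add z z' hz hz' =>
    simp only [LinearMap.map_add, hz, hz', smul_add]
    abel
  | tmul a r s hs f x =>
    have hpr : (p + r).negOnePow = (r + p).negOnePow := by rw [add_comm]
    rw [Coend.map_tmul h g hs rfl, Coend.d_tmul hj _ rfl rfl,
      DGCategory.d_comp rfl (r + 1) p' (r + p + 1) rfl hp rfl, Coend.d_tmul hi hs rfl rfl,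
      LinearMap.map_add, LinearMap.map_add, map_units_smul (Coend.map _ g),
      Coend.map_tmul _ _ hs (show r + p' = r + p + 1 by lia),
      Coend.map_tmul _ g _ (show r + 1 + p = r + p + 1 by lia),
      Coend.map_tmul _ g _ (rfl : r + p = r + p),
      LinearMap.add_apply, units_smul_map (K := K), smul_add, smul_smul,
      ← Int.negOnePow_add, hpr, add_assoc]

variable (F G) in
/-- The action of the morphisms of `C` on the coends. -/
noncomputable def Coend.act {c c' : C} {n q m : ℤ} (h : n + q = m) :
    DGCategory.Hom K c c' q →ₗ[K] Coend F G c n →ₗ[K] Coend F G c' m where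
  toFun g := Coend.map h g
  map_add' g g' := Coend.hom_ext fun a p i hi f x => by
    simp only [LinearMap.add_apply, Coend.map_tmul h _ hi rfl, map_add]
  map_smul' k g := Coend.hom_ext fun a p i hi f x => by
    simp only [LinearMap.smul_apply, Coend.map_tmul h _ hi rfl, map_smul, RingHom.id_apply]

variable (F G) in
/-- The coends `∫ᵃ Hom(F a, c) ⊗ G a`, as a dg-module. -/
noncomputable def data : DGModuleData K C where
  X c n := Coend F G c n
  d n m h := Coend.d F G _ n m h
  act h := Coend.act F G h
  d_d _ _ _ h h' z := Coend.d_d h h' z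
  act_id z := Coend.map_id z
  act_comp h hi hj hk g g' z := Coend.map_comp h hi hj hk g g' z
  d_act hp hi hj h g z := Coend.d_map hp hi hj h g z

/-- The unit of the left Kan extension. -/
noncomputable def unit : Z0.of (K := K) G ⟶ Z0.of (F.comp (data F G).toDgMod) :=
  Z0.homMk (fun a i => tmul F G (add_zero i) (DGCategory.id (F.obj a)))
    (fun a n m h x => by
      refine Eq.trans ?_ ((data F G).toDgMod_δX _ n m h _).symm
      refine Eq.trans ?_ (Coend.d_tmul h (add_zero n) (zero_add 1) h _ _).symm
      rw [DGCategory.d_id, map_zero, LinearMap.zero_apply, zero_add, Int.negOnePow_zero, one_smul]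
      rfl)
    (fun a b p i j h t x => by
      refine Eq.trans ?_ (Coend.map_tmul h (F.map t) (add_zero i) (zero_add p) _ x).symm
      rw [DGCategory.id_comp]
      -- The balancing relation at the identity moves `F t` across the tensor sign: `F t ⊗ x = id ⊗
      -- t x`.
      have := tmul_balanced (n := j) (add_zero p) h h (add_zero j) t (DGCategory.id (F.obj b)) x
      rw [DGCategory.comp_id] at this
      exact this.symm)

theorem evalK_unit (a : A) {i : ℤ} (x : G.X a i) :
    evalK ((unit (F := F) (G := G)).1.1 a) (add_zero i) x =
      tmul F G (add_zero i) (DGCategory.id (F.obj a)) x :=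
  Z0.app_homMk _ _ _ a i x

/-- Naturality over the opposite category involves the exponents `q m` and `p m` from opposite
composition and `n m` from the degree of `η`. As `q = p + n`, they cancel and `η` is balanced
without any sign. -/
theorem contraNat_balanced {b : CochainComplex (ModuleCat.{u} K) ℤ}
    (η : DGNat (F.op.comp (DGFunctor.rep K (Opposite.op c)))
      (G.op.comp (DGFunctor.rep K (Opposite.op b))) n)
    {a a' : A} {m p p' q q' : ℤ} (hp : m + p = p') (h : p + n = q) (h' : p' + n = q')
    (t : DGCategory.Hom K a a' m) (f : DGCategory.Hom K (F.obj a') c p) :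
    (show DGCategory.Hom K (G.obj a) b q' from
      evalK (η.1 (Opposite.op a)) h' (DGCategory.comp hp (F.map t) f)) =
    DGCategory.comp (show m + q = q' by lia) (G.map t)
      (show DGCategory.Hom K (G.obj a') b q from evalK (η.1 (Opposite.op a')) h f) := by
  have := DGNat.evalK_naturality η (a := Opposite.op a') (b := Opposite.op a) (m := m)
    (k := q') (l := p') h (by lia) (by lia) h' t f
  have hs : (q * m).negOnePow = (n * m).negOnePow * (p * m).negOnePow := by
    rw [← Int.negOnePow_add, ← h, add_mul, add_comm (n * m)]
  have key (y z : DGCategory.Hom K (G.obj a) b q')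
      (e : (q * m).negOnePow • y = (n * m).negOnePow • (p * m).negOnePow • z) : z = y := by
    rw [smul_smul, hs] at e
    exact (smul_left_cancel _ e).symm
  exact key _ _ (this.trans (congrArg _ (evalK_apply_units_smul (η.1 (Opposite.op a)) h' _ _)))

variable (F G) in
-- A map out of the coend is a balanced family, so `η` yields `f ⊗ x ↦ η(f)(x)`. Uniqueness holds
-- because the condition prescribes `β` on all generators.
theorem isLeftKanExtension :
    IsLeftKanExtension F G (data F G).toDgMod (unit (F := F) (G := G)).1 where
  closed := (unit (F := F) (G := G)).2
  existsUnique c b n η := by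
    let ev (a : A) (p q : ℤ) (h : p + n = q) :
        DGCategory.Hom K (F.obj a) c p →ₗ[K] DGCategory.Hom K (G.obj a) b q :=
      (Cochain.v (show Cochain (homComplex K (Opposite.op c) (Opposite.op (F.obj a)))
        (homComplex K (Opposite.op b) (Opposite.op (G.obj a))) n from η.1 (Opposite.op a)) p q h).hom
    let e (i j : ℤ) (h : i + n = j) (a : A) (p k : ℤ) (hk : k + p = i) :
        DGCategory.Hom K (F.obj a) c p →ₗ[K] G.X a k →ₗ[K] b.X j :=
      LinearMap.mk₂ K (fun f x => evalK (ev a p (p + n) rfl f) (show k + (p + n) = j by lia) x)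
        (fun f f' x => by rw [map_add, evalK_add])
        (fun k f x => by rw [map_smul, evalK_smul])
        (fun f x x' => evalK_apply_add _ _ _ _)
        (fun k f x => evalK_apply_smul _ _ _ _)
    have he (i j : ℤ) (h : i + n = j) (a a' : A) (m p p' k l : ℤ) (hp : m + p = p')
        (hk : k + m = l) (h' : k + p' = i) (h'' : l + p = i) (t : DGCategory.Hom K a a' m)
        (f : DGCategory.Hom K (F.obj a') c p) (x : G.X a k) :
        e i j h a p' k h' (DGCategory.comp hp (F.map t) f) x =
          e i j h a' p l h'' f (G.act hk t x) := by
      have := congrArg (fun y => evalK (M := G.obj a) (N := b) y (show k + (p' + n) = j by lia) x)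
        (contraNat_balanced η hp rfl rfl t f)
      exact this.trans (evalK_comp _ _ _ hk (by lia) _ _)
    have key (i j : ℤ) (h : i + n = j) (a : A) (p k : ℤ) (hk : k + p = i)
        (f : DGCategory.Hom K (F.obj a) c p) (x : G.X a k) (q : ℤ) (hq : p + n = q) :
        e i j h a p k hk f x = evalK (ev a p q hq f) (show k + q = j by lia) x := by
      subst hq; rfl
    let β : DGCategory.Hom K ((data F G).toDgMod.obj c) b n :=
      cochainMk (M := (data F G).complex c) fun i j h => Coend.lift (e i j h) (he i j h)
    -- Applying `φ` and then the action of `f` to `x` gives `f ⊗ x`, so the condition on `β`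
    -- concerns exactly its values on generators.
    have hβ (a : A) (p k i j q : ℤ) (h : i + n = j) (hk : k + p = i) (hq : p + n = q)
        (β : DGCategory.Hom K ((data F G).toDgMod.obj c) b n)
        (f : DGCategory.Hom K (F.obj a) c p) (x : G.X a k) :
        evalK (DGCategory.comp hq (DGCategory.comp (zero_add p)
          ((unit (F := F) (G := G)).1.1 a) ((data F G).toDgMod.map f)) β)
            (show k + q = j by lia) x = evalK β h (tmul F G hk f x) := by
      refine (evalK_comp hq _ _ hk h _ x).trans (congrArg (evalK β h) ?_)
      refine (evalK_comp (zero_add p) _ _ (add_zero k) hk hk x).trans ?_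
      refine (congrArg (evalK ((data F G).toDgMod.map f) hk) (evalK_unit a x)).trans ?_
      refine (Coend.map_tmul hk f (add_zero k) (zero_add p) _ x).trans ?_
      rw [DGCategory.id_comp]
    refine ⟨β, fun a p q h f => evalK_ext fun k j hj x => ?_, fun β' hβ' =>
      evalK_ext fun i j h => LinearMap.congr_fun (Coend.hom_ext
        (α := (Cochain.v (show Cochain ((data F G).complex c) b n from β') i j h).hom)
        (β := (Cochain.v (show Cochain ((data F G).complex c) b n from β) i j h).hom)
        fun a p k hk f x => ?_)⟩
    · refine Eq.trans ?_ (hβ a p k (k + p) j q (by lia) rfl h β f x).symm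
      refine Eq.trans ?_ (Coend.lift_tmul (e (k + p) j (by lia))
        (he (k + p) j (by lia)) rfl f x).symm
      exact (key (k + p) j (by lia) a p k rfl f x q h).symm
    · refine Eq.trans ?_ (Coend.lift_tmul (e i j h) (he i j h) hk f x).symm
      refine (hβ a p k i j (p + n) h hk rfl β' f x).symm.trans ?_
      exact congrArg (fun y => evalK (M := G.obj a) (N := b) y (show k + (p + n) = j by lia) x)
        (hβ' a p (p + n) rfl f).symm

end LeftKan

/-- Smallness of `A` matters: the generators of the coend range over all its objects, and the coend
must remain in the universe of `K`. -/
theorem IsLan.exists {K : Type u} [CommRing K] {A : Type u} [DGCategory.{u, u} K A] {C : Type u}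
    [DGCategory.{u, u} K C] (F : DGFunctor K A C) : ∃ L, IsLan F L :=
  have hφ (G : DgMod K A) := (LeftKan.isLeftKanExtension F G).isUniversalFrom
  ⟨IsUniversalFrom.leftAdjoint (R := F.restrict _) (S := fun G => (LeftKan.data F G).toDgMod) hφ,
    fun G => (LeftKan.unit (F := F) (G := G)).1, LeftKan.isLeftKanExtension F,
    fun _ _ _ η => IsUniversalFrom.comp_leftAdjoint_map (R := F.restrict _)
      (S := fun G => (LeftKan.data F G).toDgMod) hφ η⟩
/-! ### Existence of right Kan extensions of dg-modules -/

namespace DGFunctor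

variable {K : Type u} [CommRing K] {C : Type w} [DGCategory.{u, u} K C]

/-- The dg-natural transformation `Hom(c', -) → Hom(c, -)` given by precomposition with `g`, up to
sign. -/
noncomputable def coyonedaMap {c c' : C} {m : ℤ} (g : DGCategory.Hom K c c' m) :
    DGNat (rep K c') (rep K c) m :=
  -- The Koszul sign for moving `g` past `f`; plain precomposition is not graded natural in `X`.
  ⟨fun X => cochainMk (M := homComplex K c' X) (N := homComplex K c X) fun p q h =>
      (((p * m).negOnePow : ℤ) : K) • DGCategory.comp (show m + p = q by lia) g, by
    intro X Y k t
    refine evalK_ext fun p q hq f => ?_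
    have key (f : DGCategory.Hom K c' X p) :
        DGCategory.comp (show p + m + k = q by lia) ((((p * m).negOnePow : ℤ) : K) •
          DGCategory.comp (show m + p = p + m by lia) g f) t =
        (m * k).negOnePow • (((((p + k) * m).negOnePow : ℤ) : K) •
          DGCategory.comp (show m + (p + k) = q by lia) g (DGCategory.comp rfl f t)) := by
      have hs : (m * k + (p + k) * m).negOnePow = (p * m).negOnePow := by
        rw [add_mul, mul_comm m k, negOnePow_add_add_self]
      rw [← units_smul_eq, ← units_smul_eq, units_smul_map (K := K), smul_smul,
        ← Int.negOnePow_add, hs, DGCategory.assoc (show m + p = p + m by lia) rfl (by lia)]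
    refine (evalK_comp _ _ _ (rfl : p + m = p + m) (by lia) hq f).trans ((key f).trans ?_)
    refine Eq.symm ((evalK_units_smul _ _ hq f).trans (congrArg _ ?_))
    exact evalK_comp _ _ _ (rfl : p + k = p + k) (by lia) hq f⟩

theorem evalK_coyonedaMap {c c' : C} {m : ℤ} (g : DGCategory.Hom K c c' m) (X : C) {p q : ℤ}
    (h : p + m = q) (f : DGCategory.Hom K c' X p) :
    evalK ((coyonedaMap g).1 X) h f =
      (p * m).negOnePow • DGCategory.comp (show m + p = q by lia) g f :=
  (units_smul_eq (K := K) (p * m).negOnePow (DGCategory.comp (show m + p = q by lia) g f)).symm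

variable (K C) in
/-- The dg-functor `c ↦ Hom(c, -)`. -/
noncomputable def coyoneda : DGFunctor K C (DgMod K C)ᵒᵖ where
  obj c := Opposite.op (rep K c)
  map {c c' m} :=
    { toFun g := coyonedaMap g
      map_add' g g' := Subtype.ext (funext fun X => evalK_ext fun p q h f => by
        have key (f : DGCategory.Hom K c' X p) : (p * m).negOnePow •
            DGCategory.comp (show m + p = q by lia) (g + g') f =
              (p * m).negOnePow • DGCategory.comp (show m + p = q by lia) g f +
                (p * m).negOnePow • DGCategory.comp (show m + p = q by lia) g' f := by
          rw [map_add, LinearMap.add_apply, smul_add]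
        refine (evalK_coyonedaMap (g + g') X h f).trans ((key f).trans ?_)
        exact (congrArg₂ (fun y z : DGCategory.Hom K c X q => y + z)
          (evalK_coyonedaMap g X h f) (evalK_coyonedaMap g' X h f)).symm)
      map_smul' k g := Subtype.ext (funext fun X => evalK_ext fun p q h f => by
        have key (f : DGCategory.Hom K c' X p) : (p * m).negOnePow •
            DGCategory.comp (show m + p = q by lia) (k • g) f =
              k • (p * m).negOnePow • DGCategory.comp (show m + p = q by lia) g f := by
          rw [map_smul, LinearMap.smul_apply, smul_comm]
        refine (evalK_coyonedaMap (k • g) X h f).trans ((key f).trans ?_)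
        exact (congrArg (fun y : DGCategory.Hom K c X q => k • y)
          (evalK_coyonedaMap g X h f)).symm) }
  map_id c := Subtype.ext (funext fun X => evalK_ext fun p q h f => by
    obtain rfl : p = q := by lia
    have key (f : DGCategory.Hom K c X p) :
        (p * 0).negOnePow • DGCategory.comp (zero_add p) (DGCategory.id c) f = f := by
      rw [mul_zero, Int.negOnePow_zero, one_smul, DGCategory.id_comp]
    exact (evalK_coyonedaMap (DGCategory.id c) X h f).trans ((key f).trans (evalK_id' h f).symm))
  map_comp {c c' c'' p q n} h g g' := Subtype.ext (funext fun X => evalK_ext fun i j hj f => by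
    refine (evalK_coyonedaMap (DGCategory.comp h g g') X hj f).trans ?_
    have key (f : DGCategory.Hom K c'' X i) :
        (i * n).negOnePow • DGCategory.comp (show n + i = j by lia) (DGCategory.comp h g g') f =
        (p * q).negOnePow • (((i + q) * p).negOnePow •
          DGCategory.comp (show p + (i + q) = j by lia) g ((i * q).negOnePow •
            DGCategory.comp (show q + i = i + q by lia) g' f)) := by
      -- The exponents differ by `2 p q`: one `p q` comes from composition in the opposite category,
      -- the other from the shifted degree `i + q` of the intermediate value.
      have hs : (p * q + (i + q) * p + i * q).negOnePow = (i * n).negOnePow :=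
        (Int.negOnePow_eq_iff _ _).2 ⟨p * q, by rw [← h]; ring⟩
      rw [map_units_smul (K := K), smul_smul, smul_smul, ← Int.negOnePow_add,
        ← Int.negOnePow_add, hs, DGCategory.assoc h (show q + i = i + q by lia) (by lia)]
    refine (key f).trans ?_
    refine Eq.symm ((evalK_units_smul _ _ hj f).trans (congrArg _ ?_))
    refine (evalK_comp _ _ _ (rfl : i + q = i + q) (by lia) hj f).trans ?_
    refine (evalK_coyonedaMap g X (by lia) _).trans ?_
    exact congrArg (fun y => ((i + q) * p).negOnePow •
      DGCategory.comp (show p + (i + q) = j by lia) g y) (evalK_coyonedaMap g' X rfl f))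
  map_d {c c'} n m h g := Subtype.ext (funext fun X => evalK_ext fun i j hj f => by
    refine (evalK_coyonedaMap (d n m h g) X hj f).trans ?_
    refine Eq.trans ?_ (evalK_d h ((coyonedaMap g).1 X) (rfl : i + 1 = i + 1)
      (show i + n + 1 = j by lia) rfl f).symm
    have e1 : ((homComplex K c X).d (i + n) j).hom (evalK ((coyonedaMap g).1 X) rfl f) =
      d (i + n) j (by lia) ((i * n).negOnePow •
        DGCategory.comp (show n + i = i + n by lia) g f) := by
      rw [homComplex_d K c X (i + n) j (by lia)]
      exact congrArg (d (K := K) (i + n) j (by lia)) (evalK_coyonedaMap g X rfl f)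
    have e2 : evalK ((coyonedaMap g).1 X) (show i + 1 + n = j by lia)
        (((homComplex K c' X).d i (i + 1)).hom f) = ((i + 1) * n).negOnePow •
          DGCategory.comp (show n + (i + 1) = j by lia) g (d i (i + 1) rfl f) := by
      rw [homComplex_d K c' X i (i + 1) rfl]
      exact evalK_coyonedaMap g X _ (d i (i + 1) rfl f)
    have key (f : DGCategory.Hom K c' X i) :
        (i * m).negOnePow • DGCategory.comp (show m + i = j by lia) (d n m h g) f =
        d (i + n) j (by lia) ((i * n).negOnePow •
          DGCategory.comp (show n + i = i + n by lia) g f) +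
        m.negOnePow • (((i + 1) * n).negOnePow •
          DGCategory.comp (show n + (i + 1) = j by lia) g (d i (i + 1) rfl f)) := by
      -- As `m = n + 1`, the exponent is `i n + 1` up to `2 n`. So the two terms where the
      -- differential falls on `f` cancel and only `d g` remains.
      have hs : (m + (i + 1) * n).negOnePow = - (i * n).negOnePow := by
        rw [← Int.negOnePow_succ]
        exact (Int.negOnePow_eq_iff _ _).2 ⟨n, by rw [← h]; ring⟩
      have hs' : (i * n + i).negOnePow = (i * m).negOnePow := by rw [← h, mul_add, mul_one]
      rw [map_units_smul (K := K), DGCategory.d_comp (show n + i = i + n by lia) m (i + 1) j h rfl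
        (by lia), smul_add, smul_smul, smul_smul, ← Int.negOnePow_add, ← Int.negOnePow_add, hs, hs',
        Units.neg_smul, add_right_comm, add_neg_cancel, zero_add]
    exact (key f).trans (congrArg₂ (fun y z : DGCategory.Hom K c X j => y + m.negOnePow • z)
      e1.symm e2.symm))

end DGFunctor

namespace RightKan

variable {K : Type u} [CommRing K] {A : Type u} [DGCategory.{u, u} K A]
  {C : Type w} [DGCategory.{u, u} K C] (F : DGFunctor K A C) (G : DgMod K A)

/-- The dg-module `c ↦ DGNat(Hom(c, F -), G)`. -/
noncomputable def ext : DgMod K C :=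
  ((DGFunctor.coyoneda K C).comp (F.restrict (CochainComplex (ModuleCat.{u} K) ℤ)).op).comp
    (DGFunctor.rep K (Opposite.op G))

variable {F G}

/-- An element of the right Kan extension, as a dg-natural transformation. -/
def toNat {c : C} {n : ℤ} (σ : (ext F G).X c n) : DGNat (F.comp (DGFunctor.rep K c)) G n := σ

/-- The evaluation of an element of the right Kan extension at a morphism `c → F a`. -/
noncomputable def ev {c : C} {n : ℤ} (σ : (ext F G).X c n) (a : A) {p q : ℤ} (h : p + n = q) :
    DGCategory.Hom K c (F.obj a) p →ₗ[K] G.X a q :=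
  (Cochain.v (show Cochain (homComplex K c (F.obj a)) (G.obj a) n from (toNat σ).1 a) p q h).hom

theorem ev_ext {c : C} {n : ℤ} {σ σ' : (ext F G).X c n}
    (H : ∀ (a : A) (p q : ℤ) (h : p + n = q) (f : DGCategory.Hom K c (F.obj a) p),
      ev σ a h f = ev σ' a h f) : σ = σ' :=
  Subtype.ext (funext fun a => evalK_ext fun p q h f => H a p q h f)

theorem act_ev {c : C} {n : ℤ} (σ : (ext F G).X c n) {a a' : A} {p q k r s : ℤ} (h : p + n = q)
    (hr : p + k = r) (hs : q + k = s) (f : DGCategory.Hom K c (F.obj a) p)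
    (t : DGCategory.Hom K a a' k) :
    G.act hs t (ev σ a h f) = (n * k).negOnePow •
      ev σ a' (show r + n = s by lia) (DGCategory.comp hr f (F.map t)) :=
  DGNat.evalK_naturality (toNat σ) h hs hr (show r + n = s by lia) t f

theorem δX_ev {c : C} {n n' p p' q q' : ℤ} (hn : n + 1 = n') (hp : p + 1 = p') (hq : q + 1 = q')
    (σ : (ext F G).X c n) (a : A) (h : p + n = q) (f : DGCategory.Hom K c (F.obj a) p) :
    G.δX a q q' (ev σ a h f) = ev ((ext F G).δX c n n' σ) a (show p + n' = q' by lia) f +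
      n.negOnePow • ev σ a (show p' + n = q' by lia) (DGCategory.d p p' hp f) := by
  have e1 : (ext F G).δX c n n' σ = DGNat.diff n n' hn (toNat σ) :=
    congrArg (fun g => g.hom σ) (homComplex_d K (Opposite.op G)
      (Opposite.op (F.comp (DGFunctor.rep K c)) : (DgMod K A)ᵒᵖ) n n' hn)
  have e2 : ((homComplex K c (F.obj a)).d p p').hom f = DGCategory.d p p' hp f :=
    congrArg (fun g => g.hom f) (homComplex_d K c (F.obj a) p p' hp)
  refine (d_evalK (M := homComplex K c (F.obj a)) hn ((toNat σ).1 a) hp hq h f).trans ?_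
  exact congrArg₂ (fun y z => y + n.negOnePow • z)
    (congrArg (fun τ => ev (F := F) (G := G) τ a (show p + n' = q' by lia) f) e1.symm)
    (congrArg (ev σ a (show p' + n = q' by lia)) e2)

/-- The action is precomposition, `f ↦ σ(f ∘ g)`. The exponent `i m` comes from composition in the
opposite category, and `p m` from `coyonedaMap`. -/
theorem ev_act {c c' : C} {m i j : ℤ} (h : i + m = j) (g : DGCategory.Hom K c c' m)
    (σ : (ext F G).X c i) (a : A) {p q r : ℤ} (hr : p + j = r) (hq : m + p = q)
    (f : DGCategory.Hom K c' (F.obj a) p) :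
    ev ((ext F G).act h g σ) a hr f = (i * m + p * m).negOnePow •
      ev σ a (show q + i = r by lia) (DGCategory.comp hq g f) := by
  refine (evalK_units_smul (M := homComplex K c' (F.obj a)) (i * m).negOnePow _ hr f).trans ?_
  rw [Int.negOnePow_add, ← smul_smul]
  refine congrArg _ ?_
  refine (evalK_comp (M := homComplex K c' (F.obj a)) (N := homComplex K c (F.obj a)) _
    ((DGFunctor.coyonedaMap g).1 (F.obj a)) ((toNat σ).1 a) (show p + m = q by lia) (by lia)
    hr f).trans ?_
  refine (congrArg (ev σ a (show q + i = r by lia))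
    (DGFunctor.evalK_coyonedaMap g (F.obj a) (by lia) f)).trans ?_
  exact map_units_smul (ev σ a (show q + i = r by lia)) _ _

variable (F G) in
/-- The counit of the right Kan extension. -/
noncomputable def counit : Z0.of (K := K) (F.comp (ext F G)) ⟶ Z0.of G :=
  Z0.homMk
    (fun a n =>
      { toFun := fun σ : (ext F G).X (F.obj a) n => ev σ a (zero_add n) (DGCategory.id (F.obj a))
        map_add' := fun _ _ => rfl
        map_smul' := fun _ _ => rfl })
    (fun a n m h σ => by
      have := δX_ev h (zero_add 1) h σ a (zero_add n) (DGCategory.id (F.obj a))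
      rw [DGCategory.d_id, map_zero, smul_zero, add_zero] at this
      exact this.symm)
    (fun a b p i j h t σ => by
      -- Acting by `F t` and evaluating at the identity, or evaluating first and then acting by `t`,
      -- both give `(-1)^(i p) σ(F t)`.
      have e1 := ev_act h (F.map t) σ b (zero_add j) (add_zero p) (DGCategory.id (F.obj b))
      have e2 := act_ev σ (zero_add i) (zero_add p) h (DGCategory.id (F.obj a)) t
      rw [DGCategory.comp_id, zero_mul, add_zero] at e1
      rw [DGCategory.id_comp] at e2
      exact e1.trans e2.symm)

theorem evalK_counit (a : A) {n : ℤ} (σ : (ext F G).X (F.obj a) n) :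
    evalK ((counit F G).1.1 a) (add_zero n) σ =
      ev σ a (zero_add n) (DGCategory.id (F.obj a)) :=
  Z0.app_homMk (M := Z0.of (F.comp (ext F G))) (N := Z0.of G) _ _ _ a n σ

/-- The counit evaluates at the identity and `f` acts by precomposition, so together they evaluate
at `f` up to sign, as in the Yoneda lemma. -/
theorem evalK_comp_counit {c : C} {b : CochainComplex (ModuleCat.{u} K) ℤ} {n p q i j r : ℤ}
    (β : DGCategory.Hom K b ((ext F G).obj c) n) (a : A) (f : DGCategory.Hom K c (F.obj a) p)
    (hq : n + p = q) (hj : i + n = j) (hr : i + q = r) (y : b.X i) :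
    evalK (DGCategory.comp hq β (DGCategory.comp (add_zero p) ((ext F G).map f)
      ((counit F G).1.1 a))) hr y =
        (j * p).negOnePow • ev (evalK β hj y) a (show p + j = r by lia) f := by
  refine (evalK_comp hq β _ hj (show j + p = r by lia) hr y).trans ?_
  refine (evalK_comp (add_zero p) _ _ (show j + p = r by lia) (add_zero r) _ _).trans ?_
  refine (evalK_counit a _).trans ?_
  refine (ev_act (show j + p = r by lia) f (evalK β hj y) a (zero_add r) (add_zero p)
    (DGCategory.id (F.obj a))).trans ?_
  rw [DGCategory.comp_id, zero_mul, add_zero]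

section Transpose

variable {c : C} {b : CochainComplex (ModuleCat.{u} K) ℤ} {n : ℤ}
  (η : DGNat (F.comp (DGFunctor.rep K c)) (G.comp (DGFunctor.rep K b)) n)

/-- The values of a dg-natural transformation `Hom(c, F -) → Hom(b, G -)`. -/
noncomputable def val (a : A) (p q : ℤ) (h : p + n = q) :
    DGCategory.Hom K c (F.obj a) p →ₗ[K] DGCategory.Hom K b (G.obj a) q :=
  (Cochain.v (show Cochain (homComplex K c (F.obj a)) (homComplex K b (G.obj a)) n
    from η.1 a) p q h).hom

theorem val_naturality {a a' : A} {p q k r s : ℤ} (h : p + n = q) (hr : p + k = r)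
    (hs : r + n = s) (f : DGCategory.Hom K c (F.obj a) p) (t : DGCategory.Hom K a a' k) :
    DGCategory.comp (show q + k = s by lia) (val η a p q h f) (G.map t) =
      (n * k).negOnePow • val η a' r s hs (DGCategory.comp hr f (F.map t)) :=
  DGNat.evalK_naturality η h (show q + k = s by lia) hr hs t f

/-- The values of a dg-natural transformation `Hom(c, F -) → Hom(b, G -)` at an element of `b`. -/
noncomputable def valAt {i : ℤ} (y : b.X i) (a : A) (p q r : ℤ) (hq : p + n = q)
    (hr : i + q = r) : DGCategory.Hom K c (F.obj a) p →ₗ[K] G.X a r where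
  toFun f := evalK (val η a p q hq f) hr y
  map_add' f f' :=
    (congrArg (fun z => evalK (M := b) (N := G.obj a) z hr y)
      (map_add (val η a p q hq) f f')).trans (evalK_add _ _ hr y)
  map_smul' k f :=
    (congrArg (fun z => evalK (M := b) (N := G.obj a) z hr y)
      (map_smul (val η a p q hq) k f)).trans (evalK_smul k _ hr y)

/-- This makes `f ↦ (-1)^(i p) η(f)(y)` a transformation of degree `j = i + n`; the sign accounts
for exchanging `f` and `y`. -/
theorem act_valAt {i j : ℤ} (hj : i + n = j) (y : b.X i) {a a' : A} {k p r s : ℤ}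
    (hr : p + j = r) (hs : r + k = s) (f : DGCategory.Hom K c (F.obj a) p)
    (t : DGCategory.Hom K a a' k) :
    G.act hs t ((i * p).negOnePow • valAt η y a p (p + n) r rfl (by lia) f) =
      (j * k).negOnePow • (i * (p + k)).negOnePow • valAt η y a' (p + k) (p + k + n) s rfl
        (by lia) (DGCategory.comp rfl f (F.map t)) := by
  have h1 : G.act hs t (valAt η y a p (p + n) r rfl (by lia) f) =
      (n * k).negOnePow • valAt η y a' (p + k) (p + k + n) s rfl (by lia)
        (DGCategory.comp rfl f (F.map t)) :=
    (evalK_comp (show p + n + k = p + k + n by lia) (val η a p (p + n) rfl f) (G.map t)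
      (show i + (p + n) = r by lia) hs (show i + (p + k + n) = s by lia) y).symm.trans
    ((congrArg (fun z => evalK (M := b) (N := G.obj a') z
        (show i + (p + k + n) = s by lia) y) (val_naturality η rfl rfl rfl f t)).trans
    (evalK_units_smul _ _ _ y))
  -- After `j = i + n` is inserted, the exponents differ by `2 i k`.
  have hsgn : (i * p + n * k).negOnePow = (j * k + i * (p + k)).negOnePow :=
    (Int.negOnePow_eq_iff _ _).2 ⟨-(i * k), by rw [← hj]; ring⟩
  rw [map_units_smul (K := K), h1, smul_smul, smul_smul, ← Int.negOnePow_add,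
    ← Int.negOnePow_add, hsgn]

/-- The element of the right Kan extension that corresponds to an element of `b`. -/
noncomputable def transposeElt {i j : ℤ} (hj : i + n = j) (y : b.X i) : (ext F G).X c j :=
  show DGNat (F.comp (DGFunctor.rep K c)) G j from
  ⟨fun a => cochainMk (M := homComplex K c (F.obj a)) (N := G.obj a) fun p r hr =>
    (((i * p).negOnePow : ℤ) : K) • valAt η y a p (p + n) r rfl (by lia), by
    intro a a' k t
    refine evalK_ext fun p s hs f => ?_
    refine (evalK_comp _ _ _ (rfl : p + j = p + j) (by lia) hs f).trans ?_
    refine Eq.trans ?_ ((act_valAt η hj y (rfl : p + j = p + j) (by lia) f t).trans ?_)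
    · exact congrArg (G.act (show p + j + k = s by lia) t)
        (units_smul_eq (K := K) (i * p).negOnePow _).symm
    · refine Eq.symm ((evalK_units_smul _ _ hs f).trans (congrArg _ ?_))
      refine (evalK_comp _ _ _ (rfl : p + k = p + k) (by lia) hs f).trans ?_
      exact (units_smul_eq (K := K) (i * (p + k)).negOnePow _).symm⟩

theorem ev_transposeElt {i j : ℤ} (hj : i + n = j) (y : b.X i) (a : A) {p q r : ℤ}
    (hq : p + n = q) (hr : i + q = r) (f : DGCategory.Hom K c (F.obj a) p) :
    ev (transposeElt η hj y) a (show p + j = r by lia) f =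
      (i * p).negOnePow • evalK (val η a p q hq f) hr y := by
  subst hq
  exact (units_smul_eq (K := K) (i * p).negOnePow (valAt η y a p (p + n) r rfl hr f)).symm

/-- The morphism to the right Kan extension that corresponds to `η`. -/
noncomputable def transpose : DGCategory.Hom K b ((ext F G).obj c) n :=
  cochainMk (N := (ext F G).obj c) fun i j hj =>
    { toFun := fun y => transposeElt η hj y
      map_add' := fun y y' => ev_ext fun a p r hr f => by
        have h := ev_transposeElt η hj (y + y') a rfl (show i + (p + n) = r by lia) f
        rw [evalK_apply_add, smul_add, ← ev_transposeElt η hj y a rfl,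
          ← ev_transposeElt η hj y' a rfl] at h
        exact h
      map_smul' := fun k y => ev_ext fun a p r hr f => by
        have h := ev_transposeElt η hj (k • y) a rfl (show i + (p + n) = r by lia) f
        rw [evalK_apply_smul, smul_comm, ← ev_transposeElt η hj y a rfl] at h
        exact h }

theorem ev_transpose {i j : ℤ} (hj : i + n = j) (y : b.X i) (a : A) {p q r : ℤ}
    (hq : p + n = q) (hr : i + q = r) (f : DGCategory.Hom K c (F.obj a) p) :
    ev (evalK (transpose η) hj y) a (show p + j = r by lia) f =
      (i * p).negOnePow • evalK (val η a p q hq f) hr y :=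
  ev_transposeElt η hj y a hq hr f

/-- Evaluated at `y`, the Kan extension condition reads `β(y)(f) = (-1)^(i p) η(f)(y)`. This formula
both constructs `β` and determines it. -/
theorem transpose_iff (β : DGCategory.Hom K b ((ext F G).obj c) n) :
    (∀ (a : A) (p q : ℤ) (h : p + n = q) (f : DGCategory.Hom K c (F.obj a) p),
      val η a p q h f = (n * p).negOnePow • DGCategory.comp (show n + p = q by lia) β
        (DGCategory.comp (add_zero p) ((ext F G).map f) ((counit F G).1.1 a))) ↔
    ∀ (i j : ℤ) (hj : i + n = j) (y : b.X i) (a : A) (p q r : ℤ) (hq : p + n = q)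
      (hr : i + q = r) (f : DGCategory.Hom K c (F.obj a) p),
      ev (evalK β hj y) a (show p + j = r by lia) f =
        (i * p).negOnePow • evalK (val η a p q hq f) hr y := by
  have e (i j : ℤ) (hj : i + n = j) (y : b.X i) (a : A) (p q r : ℤ) (hq : p + n = q)
      (hr : i + q = r) (f : DGCategory.Hom K c (F.obj a) p) :
      evalK ((n * p).negOnePow • DGCategory.comp (show n + p = q by lia) β
        (DGCategory.comp (add_zero p) ((ext F G).map f) ((counit F G).1.1 a))) hr y =
      (i * p).negOnePow • ev (evalK β hj y) a (show p + j = r by lia) f := by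
    rw [evalK_units_smul]
    refine (congrArg _ (evalK_comp_counit β a f (show n + p = q by lia) hj hr y)).trans ?_
    have hs : (n * p + j * p).negOnePow = (i * p).negOnePow :=
      (Int.negOnePow_eq_iff _ _).2 ⟨n * p, by rw [← hj]; ring⟩
    rw [smul_smul, ← Int.negOnePow_add, hs]
  constructor
  · intro H i j hj y a p q r hq hr f
    have h1 : evalK (val η a p q hq f) hr y = _ :=
      (congrArg (fun z => evalK (M := b) (N := G.obj a) z hr y) (H a p q hq f)).trans
        (e i j hj y a p q r hq hr f)
    rw [h1, smul_smul, ← Int.negOnePow_add, Int.negOnePow_even (i * p + i * p) ⟨_, rfl⟩,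
      one_smul]
  · intro H a p q hq f
    refine evalK_ext (M := b) (N := G.obj a) fun i r hr y => ?_
    refine Eq.trans ?_ (e i (i + n) rfl y a p q r hq hr f).symm
    rw [H i (i + n) rfl y a p q r hq hr f, smul_smul, ← Int.negOnePow_add,
      Int.negOnePow_even (i * p + i * p) ⟨_, rfl⟩, one_smul]

end Transpose

variable (F G) in
theorem isRightKanExtension : IsRightKanExtension F G (ext F G) (counit F G).1 where
  closed := (counit F G).2
  existsUnique c b n η := by
    refine ⟨transpose η, (transpose_iff η _).2 fun i j hj y a p q r hq hr f =>
      ev_transpose η hj y a hq hr f, fun β' hβ' => evalK_ext fun i j hj y =>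
      ev_ext fun a p r hr f => ?_⟩
    refine ((transpose_iff η β').1 hβ' i j hj y a p (p + n) r rfl (by lia) f).trans ?_
    exact (ev_transpose η hj y a rfl (by lia) f).symm

end RightKan

/-- Smallness of `A` keeps the transformations `DGNat(Hom(c, F -), G)` in the universe of `K`. -/
theorem IsRan.exists {K : Type u} [CommRing K] {A : Type u} [DGCategory.{u, u} K A] {C : Type u}
    [DGCategory.{u, u} K C] (F : DGFunctor K A C) : ∃ R, IsRan F R :=
  have hψ (G : DgMod K A) := (RightKan.isRightKanExtension F G).isUniversalTo
  ⟨IsUniversalTo.rightAdjoint (R := F.restrict _) (S := fun G => RightKan.ext F G) hψ,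
    fun G => (RightKan.counit F G).1, RightKan.isRightKanExtension F,
    fun _ _ _ η => IsUniversalTo.rightAdjoint_map_comp (R := F.restrict _)
      (S := fun G => RightKan.ext F G) hψ η⟩
-- Adjunctions between underlying categories; full faithfulness of Kan extensions
theorem DGFunctor.additive_underlying {K : Type u} [CommRing K] {A : Type w}
    [DGCategory.{u, v} K A] {B : Type w'} [DGCategory.{u, v'} K B] (F : DGFunctor K A B) :
    F.underlying.Additive where
  map_add {_ _ f g} := Subtype.ext (map_add F.map f.1 g.1)

section

variable {K : Type u} [CommRing K] {A : Type w} [DGCategory.{u, u} K A]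
    {C : Type w'} [DGCategory.{u, u} K C] {F : DGFunctor K A C}

/-- The unit is recorded with the adjunction because the full faithfulness of `L` is read off from
it. -/
theorem IsLan.exists_adjunction {L : DGFunctor K (DgMod K A) (DgMod K C)} (hL : IsLan F L) :
    ∃ (φ : ∀ G : DgMod K A, DGNat G (F.comp (L.obj G)) 0)
      (adj : L.underlying ⊣ (F.restrict (CochainComplex (ModuleCat.{u} K) ℤ)).underlying),
      (∀ G, IsLeftKanExtension F G (L.obj G) (φ G)) ∧
        ∀ G, (adj.unit.app G).1 = φ G.obj := by
  obtain ⟨φ, hφ, hn⟩ := hL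
  obtain ⟨adj, h⟩ := IsUniversalFrom.exists_adjunction (R := F.restrict _) (L := L) (φ := φ)
    (fun G => (hφ G).isUniversalFrom) (fun G G' η => hn G G' 0 η)
  exact ⟨φ, adj, hφ, h⟩

theorem IsRan.nonempty_adjunction {R : DGFunctor K (DgMod K A) (DgMod K C)} (hR : IsRan F R) :
    Nonempty ((F.restrict (CochainComplex (ModuleCat.{u} K) ℤ)).underlying ⊣ R.underlying) := by
  obtain ⟨ψ, hψ, hn⟩ := hR
  exact IsUniversalTo.nonempty_adjunction (R := F.restrict _) (L := R) (ψ := ψ)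
    (fun G => (hψ G).isUniversalTo) (fun G G' η => hn G G' 0 η)

end

theorem Z0.isIso_of_bijective {K : Type u} [CommRing K] {A : Type w} [DGCategory.{u, u} K A]
    {M N : Z0 K (DgMod K A)} (f : M ⟶ N) (hf : ∀ a n, Function.Bijective (app f a n)) :
    IsIso f := by
  let e (a : A) (n : ℤ) : M.obj.X a n ≃ₗ[K] N.obj.X a n := LinearEquiv.ofBijective _ (hf a n)
  have he (a : A) (n : ℤ) (y : N.obj.X a n) : app f a n ((e a n).symm y) = y :=
    (e a n).apply_symm_apply y
  let g : N ⟶ M := homMk (fun a n => (e a n).symm.toLinearMap)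
    (fun a n m h y => (hf a m).1 <| by
      rw [app_δX f a n m h, LinearEquiv.coe_coe, LinearEquiv.coe_coe, he, he])
    (fun a b p i j h t y => (hf b j).1 <| by
      rw [app_act f, LinearEquiv.coe_coe, LinearEquiv.coe_coe, he, he])
  have hg (a : A) (n : ℤ) (y : N.obj.X a n) : app g a n y = (e a n).symm y :=
    app_homMk _ _ _ a n y
  refine ⟨g, hom_ext fun a n x => ?_, hom_ext fun a n x => ?_⟩
  · rw [app_comp, app_id, hg]
    exact (e a n).symm_apply_apply x
  · rw [app_comp, app_id, hg, he]

namespace IsLeftKanExtension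

variable {K : Type u} [CommRing K] {A : Type w} [DGCategory.{u, u} K A]
    {C : Type w'} [DGCategory.{u, u} K C] {B : Type w''} [DGCategory.{u, u} K B]
    {F : DGFunctor K A C} {G : DGFunctor K A B} {S : DGFunctor K C B}
    {φ : DGNat G (F.comp S) 0}

/-- If `F` is fully faithful, `f ↦ G (F⁻¹ f)` is a natural transformation `Hom(F -, F a) → Hom(G -,
G a)`, and the `β` representing it satisfies `β ∘ S (F x) ∘ φ = G x`. Taking `x = id` gives one
inverse law; the other is tested on all `S (F x) ∘ φ`, where naturality of `φ` gives it. -/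
theorem exists_inverse (hφ : IsLeftKanExtension F G S φ)
    (hF : ∀ (a a' : A) (n : ℤ), Function.Bijective (F.map (X := a) (Y := a') (n := n))) (a : A) :
    ∃ β : DGCategory.Hom K (S.obj (F.obj a)) (G.obj a) 0,
      DGCategory.comp (zero_add 0) (DGNat.toComp φ a) β = DGCategory.id (G.obj a) ∧
        DGCategory.comp (zero_add 0) β (DGNat.toComp φ a) =
          DGCategory.id (S.obj (F.obj a)) := by
  let inv (a' : A) (p : ℤ) : DGCategory.Hom K (F.obj a') (F.obj a) p ≃ₗ[K]
      DGCategory.Hom K a' a p := (LinearEquiv.ofBijective F.map (hF a' a p)).symm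
  have map_inv (a' : A) (p : ℤ) (f : DGCategory.Hom K (F.obj a') (F.obj a) p) :
      F.map (inv a' p f) = f := (LinearEquiv.ofBijective F.map (hF a' a p)).apply_symm_apply f
  have inv_map (a' : A) (p : ℤ) (x : DGCategory.Hom K a' a p) :
      inv a' p (F.map x) = x := (LinearEquiv.ofBijective F.map (hF a' a p)).symm_apply_apply x
  obtain ⟨β, hβ, -⟩ := hφ.existsUnique (F.obj a) (G.obj a) 0
    (contraNatMk F G (F.obj a) (G.obj a) 0
      (fun a' p q h => (DGCategory.comp h).flip (DGCategory.id (G.obj a)) ∘ₗ G.map ∘ₗ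
        (inv a' p).toLinearMap) (by
      intro a₁ a₂ m p q p' q' h h' hp x f
      have e : inv a₂ p' (DGCategory.comp hp (F.map x) f) = DGCategory.comp hp x (inv a₁ p f) := by
        refine (hF a₂ a p').1 ?_
        rw [map_inv, F.map_comp, map_inv]
      simp only [LinearMap.comp_apply, LinearEquiv.coe_coe, LinearMap.flip_apply]
      rw [e, G.map_comp]
      exact DGCategory.assoc hp h (by lia) _ _ _))
  have key (a' : A) (p : ℤ) (x : DGCategory.Hom K a' a p) :
      DGCategory.comp (add_zero p)
        (DGCategory.comp (zero_add p) (DGNat.toComp φ a') (S.map (F.map x))) β = G.map x := by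
    refine (hβ a' p p (add_zero p) (F.map x)).symm.trans ?_
    refine Eq.trans (?_ : _ = DGCategory.comp (add_zero p) (G.map (inv a' p (F.map x)))
      (DGCategory.id (G.obj a))) ?_
    · rfl
    · rw [inv_map, DGCategory.comp_id]
  have h1 : DGCategory.comp (zero_add 0) (DGNat.toComp φ a) β = DGCategory.id (G.obj a) := by
    have := key a 0 (DGCategory.id a)
    rwa [F.map_id, S.map_id, DGCategory.comp_id, G.map_id] at this
  refine ⟨β, h1, hφ.hom_ext fun a' p q h f => ?_⟩
  obtain rfl : p = q := by lia
  obtain ⟨x, rfl⟩ := (hF a' a p).2 f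
  rw [DGCategory.comp_id, ← DGCategory.assoc (add_zero p) (zero_add 0) (by lia), key,
    ← φ_naturality]

end IsLeftKanExtension

/-- Invertibility can be tested by bijectivity in each degree, so naturality of the inverses in `a`
need not be checked. -/
theorem IsLeftKanExtension.isIso_unit {K : Type u} [CommRing K] {A : Type w}
    [DGCategory.{u, u} K A] {C : Type w'} [DGCategory.{u, u} K C] {F : DGFunctor K A C}
    {G : DgMod K A} {S : DgMod K C} {φ : DGNat G (F.comp S) 0}
    (hφ : IsLeftKanExtension F G S φ)
    (hF : ∀ (a a' : A) (n : ℤ), Function.Bijective (F.map (X := a) (Y := a') (n := n)))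
    (f : Z0.of (K := K) G ⟶ Z0.of (F.comp S)) (hf : f.1 = φ) : IsIso f := by
  refine Z0.isIso_of_bijective f fun a n => ?_
  obtain ⟨β, h1, h2⟩ := hφ.exists_inverse hF a
  subst hf
  refine Function.bijective_iff_has_inverse.2 ⟨fun y => evalK β (add_zero n) y, fun x => ?_,
    fun y => ?_⟩
  · refine (evalK_comp (zero_add 0) (DGNat.toComp f.1 a) β (add_zero n) (add_zero n) (add_zero n)
      x).symm.trans ?_
    exact (congrArg (fun z => evalK z (add_zero n) x) h1).trans (evalK_id' _ _)
  · refine (evalK_comp (zero_add 0) β (DGNat.toComp f.1 a) (add_zero n) (add_zero n) (add_zero n)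
      y).symm.trans ?_
    exact (congrArg (fun z => evalK z (add_zero n) y) h2).trans (evalK_id' _ _)

/-- A left adjoint with invertible unit is fully faithful. -/
theorem IsLan.nonempty_fullyFaithful {K : Type u} [CommRing K] {A : Type w}
    [DGCategory.{u, u} K A] {C : Type w'} [DGCategory.{u, u} K C] {F : DGFunctor K A C}
    {L : DGFunctor K (DgMod K A) (DgMod K C)} (hL : IsLan F L)
    (hF : ∀ (a a' : A) (n : ℤ), Function.Bijective (F.map (X := a) (Y := a') (n := n))) :
    Nonempty L.underlying.FullyFaithful := by
  obtain ⟨φ, adj, hφ, h⟩ := hL.exists_adjunction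
  have : ∀ G, IsIso (adj.unit.app G) := fun G => (hφ G.obj).isIso_unit hF _ (h G)
  have : IsIso adj.unit := NatIso.isIso_of_isIso_app _
  exact ⟨adj.fullyFaithfulLOfIsIsoUnit⟩

/-- The outer functors of an adjoint triple are fully faithful simultaneously, so the left Kan
extension settles the right one. -/
theorem IsRan.nonempty_fullyFaithful {K : Type u} [CommRing K] {A : Type u}
    [DGCategory.{u, u} K A] {C : Type u} [DGCategory.{u, u} K C] {F : DGFunctor K A C}
    {L R : DGFunctor K (DgMod K A) (DgMod K C)} (hL : IsLan F L) (hR : IsRan F R)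
    (hF : ∀ (a a' : A) (n : ℤ), Function.Bijective (F.map (X := a) (Y := a') (n := n))) :
    Nonempty R.underlying.FullyFaithful := by
  obtain ⟨φ, adj, -, -⟩ := hL.exists_adjunction
  obtain ⟨adj'⟩ := hR.nonempty_adjunction
  obtain ⟨ff⟩ := hL.nonempty_fullyFaithful hF
  exact ⟨(Adjunction.Triple.mk adj adj').fullyFaithfulEquiv ff⟩

/-! ### Modules over the quotient dg-category -/

namespace DGQuotient

variable {K : Type u} [CommRing K] {C : Type w} [DGCategory.{u, v} K C] {I : DGIdeal K C}
  {D : Type w'} [DGCategory.{u, v'} K D]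

variable (I D) in
-- Each object and each morphism of the quotient comes from `C`, so a family natural over `C` is
-- already natural over the quotient.
theorem full_restrict_proj : ((proj I).restrict D).underlying.Full where
  map_surjective {M N} f := by
    refine ⟨⟨⟨fun a => f.1.1 a.obj, fun X Y m g => ?_⟩, ?_⟩, rfl⟩
    · obtain ⟨g, rfl⟩ := Submodule.Quotient.mk_surjective _ g
      exact f.1.2 X.obj Y.obj m g
    · exact Subtype.ext (funext fun a => congrFun (congrArg Subtype.val f.2) a.obj)

variable (I D) in
theorem faithful_restrict_proj : ((proj I).restrict D).underlying.Faithful where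
  map_injective {_ _} _ _ h := Subtype.ext (Subtype.ext (funext fun a =>
    congrFun (congrArg (fun k => k.1.1) h) a.obj))

/-- The dg-functor on the quotient induced by a dg-functor that vanishes on the dg-ideal. -/
def lift (F : DGFunctor K C D)
    (hF : ∀ {X Y : C} {n : ℤ} (f : DGCategory.Hom K X Y n), f ∈ I.carrier X Y n → F.map f = 0) :
    DGFunctor K (DGQuotient I) D where
  obj X := F.obj X.obj
  map {X Y n} := (I.carrier X.obj Y.obj n).liftQ F.map fun f hf => hF f hf
  map_id X := F.map_id X.obj
  map_comp h f g := by
    obtain ⟨f, rfl⟩ := Submodule.Quotient.mk_surjective _ f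
    obtain ⟨g, rfl⟩ := Submodule.Quotient.mk_surjective _ g
    exact F.map_comp h f g
  map_d n m h f := by
    obtain ⟨f, rfl⟩ := Submodule.Quotient.mk_surjective _ f
    exact F.map_d n m h f

end DGQuotient

/-! ### Modules vanishing on `B` are the modules over the quotient -/

section FactorIdeal

variable {K : Type u} [CommRing K] {C : Type w} [DGCategory.{u, v} K C] {B : Set C}
  (hB : ClosedUnderFiniteCoproducts K B) {D : Type w'} [DGCategory.{u, v'} K D]

theorem DGFunctor.map_comp_eq_zero (F : DGFunctor K C D) {X Y Z : C}
    (hZ : DGCategory.id (K := K) (F.obj Z) = 0) {p q n : ℤ} (h : p + q = n)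
    (f : DGCategory.Hom K X Z p) (g : DGCategory.Hom K Z Y q) :
    F.map (DGCategory.comp h f g) = 0 := by
  rw [F.map_comp, ← DGCategory.comp_id (F.map f), hZ, map_zero, map_zero, LinearMap.zero_apply]

/-- The ideal admits inhomogeneous factors. The component of degree `n` of such a composite is a sum
of composites of homogeneous pieces with `p + q = n`, and each of them passes through `Z`. -/
theorem DGFunctor.map_component_eq_zero (F : DGFunctor K C D) {X Y Z : C}
    (hZ : DGCategory.id (K := K) (F.obj Z) = 0) (g : ⨁ n, DGCategory.Hom K X Z n)
    (k : ⨁ n, DGCategory.Hom K Z Y n) (n : ℤ) :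
    F.map (DirectSum.component K ℤ (fun n => DGCategory.Hom K X Y n) n
      (TotalCat.compHom X Z Y g k)) = 0 := by
  induction g using DirectSum.induction_on with
  | zero => simp
  | add g g' hg hg' => rw [TotalCat.compHom_add_left, map_add, map_add, hg, hg', add_zero]
  | of p g =>
    induction k using DirectSum.induction_on with
    | zero => simp
    | add k k' hk hk' => rw [TotalCat.compHom_add_right, map_add, map_add, hk, hk', add_zero]
    | of q k =>
      rw [← DirectSum.lof_eq_of K, ← DirectSum.lof_eq_of K, TotalCat.compHom_lof rfl g k]
      by_cases hn : p + q = n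
      · subst hn
        rw [DirectSum.component.lof_self, F.map_comp_eq_zero hZ]
      · rw [DirectSum.component.of, dif_neg hn, map_zero]

theorem DGFunctor.map_eq_zero_of_mem_factorIdeal (F : DGFunctor K C D)
    (hF : ∀ Z ∈ B, DGCategory.id (K := K) (F.obj Z) = 0) {X Y : C} {n : ℤ}
    (f : DGCategory.Hom K X Y n) (hf : f ∈ (factorIdeal B hB).carrier X Y n) : F.map f = 0 := by
  obtain ⟨Z, hZ, g, k, e⟩ := hf
  have := F.map_component_eq_zero (hF Z hZ) g k n
  rwa [show TotalCat.compHom X Z Y g k =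
    DirectSum.lof K ℤ (fun n => DGCategory.Hom K X Y n) n f from e.symm,
    DirectSum.component.lof_self] at this

theorem id_mem_factorIdeal {Z : C} (hZ : Z ∈ B) :
    DGCategory.id Z ∈ (factorIdeal B hB).carrier Z Z 0 := by
  have := FactorIdeal.factors_comp (B := B) hZ (zero_add 0) (DGCategory.id (K := K) Z)
    (DGCategory.id Z)
  rwa [DGCategory.id_comp] at this

/-- An object is zero when its identity is, and the identity of a restricted functor consists of the
identities of its values on `B`. -/
theorem isZero_restrict_inclusion_iff (M : Z0 K (DGFunctor K C D)) :
    IsZero (((DGFunctor.inclusion K B).restrict D).underlying.obj M) ↔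
      ∀ Z ∈ B, DGCategory.id (K := K) (M.obj.obj Z) = 0 := by
  rw [IsZero.iff_id_eq_zero]
  refine ⟨fun h Z hZ => congrFun (congrArg (fun k => k.1.1) h) ⟨Z, hZ⟩, fun h => ?_⟩
  exact Subtype.ext (Subtype.ext (funext fun Z => h Z.1 Z.2))

/-- A module that vanishes on `B` kills the ideal and descends. Conversely, the identity of each
object of `B` becomes zero in the quotient, hence also in every module over it. -/
theorem isZero_restrict_inclusion_iff_essImage (M : Z0 K (DGFunctor K C D)) :
    IsZero (((DGFunctor.inclusion K B).restrict D).underlying.obj M) ↔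
      ((DGQuotient.proj (factorIdeal B hB)).restrict D).underlying.essImage M := by
  constructor
  · intro h
    rw [isZero_restrict_inclusion_iff] at h
    -- The descended module restricts to `M` on the nose, so the identity serves as the isomorphism.
    exact ⟨⟨DGQuotient.lift M.obj fun f hf => M.obj.map_eq_zero_of_mem_factorIdeal hB h f hf⟩,
      ⟨Iso.refl _⟩⟩
  · rintro ⟨N, ⟨e⟩⟩
    refine IsZero.of_iso ?_ (((DGFunctor.inclusion K B).restrict D).underlying.mapIso e.symm)
    refine (isZero_restrict_inclusion_iff _).2 fun Z hZ => ?_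
    have h : DGCategory.id (K := K) (DGQuotient.of Z : DGQuotient (factorIdeal B hB)) = 0 :=
      (Submodule.Quotient.mk_eq_zero _).2 (id_mem_factorIdeal hB hZ)
    refine (N.obj.map_id ⟨Z⟩).symm.trans ?_
    rw [h, map_zero]
    rfl

end FactorIdeal

/-! ### The recollement -/

theorem mainTheorem4 {K : Type u} [CommRing K] {C : Type u} [DGCategory.{u, u} K C]
    [HasFiniteCoproducts (TotalCat K C)] (B : Set C) (hB : ClosedUnderFiniteCoproducts K B) :
    (∃ piUp, IsLan (DGQuotient.proj (factorIdeal B hB)) piUp) ∧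
    (∃ piShriek, IsRan (DGQuotient.proj (factorIdeal B hB)) piShriek) ∧
    (∃ jLow, IsLan (DGFunctor.inclusion K B) jLow) ∧
    (∃ jRight, IsRan (DGFunctor.inclusion K B) jRight) ∧
    ∀ (piUp piShriek : DGFunctor K (DgMod K C) (DgMod K (DGQuotient (factorIdeal B hB))))
      (jLow jRight : DGFunctor K (DgMod K B) (DgMod K C)),
      IsLan (DGQuotient.proj (factorIdeal B hB)) piUp →
      IsRan (DGQuotient.proj (factorIdeal B hB)) piShriek →
      IsLan (DGFunctor.inclusion K B) jLow →
      IsRan (DGFunctor.inclusion K B) jRight →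
      IsAbelianRecollement
        (𝓐 := Z0 K (DgMod K (DGQuotient (factorIdeal B hB))))
        (𝓑 := Z0 K (DgMod K C))
        (𝓒 := Z0 K (DgMod K B))
        piUp.underlying
        ((DGQuotient.proj (factorIdeal B hB)).restrict _).underlying
        piShriek.underlying
        jLow.underlying
        ((DGFunctor.inclusion K B).restrict _).underlying
        jRight.underlying := by
  refine ⟨IsLan.exists _, IsRan.exists _, IsLan.exists _, IsRan.exists _, ?_⟩
  intro piUp piShriek jLow jRight h₁ h₂ h₃ h₄
  obtain ⟨_, adj₁, -, -⟩ := h₁.exists_adjunction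
  obtain ⟨_, adj₃, -, -⟩ := h₃.exists_adjunction
  -- The inclusion is the identity on morphism complexes; this is all that the full faithfulness of
  -- `j_!` and `j_*` requires.
  have hj (a a' : B) (n : ℤ) : Function.Bijective
      ((DGFunctor.inclusion K B).map (X := a) (Y := a') (n := n)) := Function.bijective_id
  obtain ⟨ff₃⟩ := h₃.nonempty_fullyFaithful hj
  obtain ⟨ff₄⟩ := IsRan.nonempty_fullyFaithful h₃ h₄ hj
  exact
    { abelian_left := ⟨Z0.abelianDgMod, rfl⟩
      abelian_middle := ⟨Z0.abelianDgMod, rfl⟩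
      abelian_right := ⟨Z0.abelianDgMod, rfl⟩
      additive_iUp := DGFunctor.additive_underlying _
      additive_iStar := DGFunctor.additive_underlying _
      additive_iShriek := DGFunctor.additive_underlying _
      additive_jLow := DGFunctor.additive_underlying _
      additive_jStar := DGFunctor.additive_underlying _
      additive_jRight := DGFunctor.additive_underlying _
      adj_iUp := ⟨adj₁⟩
      adj_iShriek := h₂.nonempty_adjunction
      adj_jLow := ⟨adj₃⟩
      adj_jRight := h₄.nonempty_adjunction
      ker_eq_im := isZero_restrict_inclusion_iff_essImage hB
      full_iStar := DGQuotient.full_restrict_proj _ _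
      faithful_iStar := DGQuotient.faithful_restrict_proj _ _
      full_jLow := ff₃.full
      faithful_jLow := ff₃.faithful
      full_jRight := ff₄.full
      faithful_jRight := ff₄.faithful }
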